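/- Let $d\ge 1$, let $N$ be an $\mathbb N$-valued random variable and $A_1,A_2,\dots$ random real $d\times d$ matrices, all defined on one probability space. Write $|x|=\sum_i|x_i|$ for $x\in\mathbb R^d$, $\mathbb S^{d-1}=\{|x|=1\}$, $\|a\|$ for the operator norm of a matrix $a$ with respect to $|\cdot|$, $r(a)$ for its spectral radius, and $a>0$ if all entries of $a$ are strictly positive. The support $\mathrm{supp}$ of a law is the set of points all of whose neighbourhoods have positive probability. Assume the following. 1. $N\ge 1$ a.s., $1<\mathbb E[N]<\infty$, and a.s. all $A_i$ have nonnegative entries, $A_i\ne 0$ for $1\le i\le N$ and $A_i=0$ for $i>N$. 2. Let $\mu$ be the probability measure $\mu(B)=\frac1{\mathbb E[N]}\,\mathbb E\big[\sum_{i=1}^N\mathbf 1_{\{A_i\in B\}}\big]$ and $\Gamma=\{a_1\cdots a_n: n\ge 0,\ a_i\in\mathrm{supp}(\mu)\}$ (the empty product being the identity matrix). Every row and every column of each $a\in\Gamma$ has a strictly positive entry, and $\Gamma$ contains some $a>0$. 3. Let $\mathbb U=\bigcup_{n\ge 0}(\mathbb N^*)^n$ be the set of finite words of positive integers. A set $U\subset\mathbb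 U$ is a cover set if every infinite sequence of positive integers has exactly one prefix in $U$; it has finite level if the lengths of its words are bounded. For $k\le|u|$, $u|k$ is the prefix of $u$ of length $k$. There are two cover sets $U_1,U_2$ of finite level and, for $i=1,2$ and each $v\in\mathbb U$, a sequence $(a^{(i)}_{v1},a^{(i)}_{v2},\dots)$ in the support of the law of $(A_1,A_2,\dots)$ (for the product topology), such that the sums $l_i=\sum_{u\in U_i}a^{(i)}_{u|1}a^{(i)}_{u|2}\cdots a^{(i)}_{u||u|}$ converge and $l_1>0$, $l_2>0$, $r(l_1)<1<r(l_2)$. 4. Let $I_\mu=\{s\ge 0:\int\|a\|^s\mu(da)<\infty\}$ and, for $s\in I_\mu$, $\kappa(s)=\lim_{n\to\infty}\big(\mathbb E\|M_n\cdots M_1\|^s\big)^{1/n}$, where $M_1,M_2,\dots$ are i.i.d. with law $\mu$; put $m(s)=\mathbb E[N]\kappa(s)$. There is $\alpha\in(0,1]$ in the interior of $I_\mu$ such that $m(\alpha)=1$, and $m$ is differentiable at $\alpha$ with $m'(\alpha)<0$. 5. For $t\in\mathbb R^d$ let $N(t)=\#\{i\ge1:A_i^Tt\ne0\}$. Almost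 surely $N(t)\ge 1$ for all $t\ne 0$ simultaneously; $\mathbb P[N(t)=1]<1$ for every $t\ne 0$; and there are $\varepsilon_0>0$ and, for each $t\in\mathbb S^{d-1}$, a (possibly random) index $i(t)\in\mathbb N^*$ with $A_{i(t)}^Tt\ne 0$ a.s., such that $\sup_{t\in\mathbb S^{d-1}}\mathbb E\big[|A_{i(t)}^Tt|^{-\varepsilon_0}\big]<\infty$. 6. For $a>0$ let $v(a)$ be its Perron–Frobenius eigenvector, i.e. the unique strictly positive vector with $a\,v(a)=r(a)v(a)$ and $|v(a)|=1$. The set $\Lambda=\overline{\{v(a):a\in\Gamma,\ a>0\}}$ contains $d$ linearly independent vectors. Let $Z$ be an $\mathbb R_+^d$-valued random variable with $\mathbb P[Z=0]=0$ that solves $$Z\overset{\mathcal L}{=}\sum_{i=1}^N A_iZ_i,$$ where $Z_1,Z_2,\dots$ are i.i.d. copies of $Z$, independent of $(N,A_1,A_2,\dots)$. Then the law of $Z$ is absolutely continuous with respect to the Lebesgue measure on $\mathbb R^d$. -/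

import Mathlib

open MeasureTheory Filter Topology
open scoped ENNReal Matrix

noncomputable section

namespace SmoothingTransform

/-- Real `d × d` matrices. -/
abbrev Mat (d : ℕ) : Type := Matrix (Fin d) (Fin d) ℝ

instance instMeasurableSpaceMat (d : ℕ) : MeasurableSpace (Mat d) :=
  inferInstanceAs (MeasurableSpace (Fin d → Fin d → ℝ))

instance instBorelSpaceMat (d : ℕ) : BorelSpace (Mat d) :=
  inferInstanceAs (BorelSpace (Fin d → Fin d → ℝ))

/-- The `L¹` norm `|x| = ∑ |x_i|`. -/
def l1 {d : ℕ} (x : Fin d → ℝ) : ℝ := ∑ i, |x i|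

/-- The operator norm of a matrix acting on `ℝ^d` with the `L¹` norm. -/
def opNorm {d : ℕ} (a : Mat d) : ℝ :=
  ‖LinearMap.toContinuousLinearMap (Matrix.toLpLin 1 1 a)‖

/-- The spectral radius of a real matrix: the largest modulus of a complex eigenvalue. -/
def specRad {d : ℕ} (a : Mat d) : ℝ :=
  (spectralRadius ℂ (a.map (algebraMap ℝ ℂ))).toReal

/-- Strict positivity of all entries. -/
def StrictlyPos {d : ℕ} (a : Mat d) : Prop := ∀ i j, 0 < a i j

/-! In everything below the family `A` is indexed from `0`: `A i` stands for `A_{i+1}`. -/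

section Model

variable {d : ℕ} {Ω : Type*} [MeasurableSpace Ω]

/-- `E[N]`. -/
def meanN (P : Measure Ω) (N : Ω → ℕ) : ℝ≥0∞ := ∫⁻ ω, (N ω : ℝ≥0∞) ∂P

/-- `N ≥ 1` a.s., `1 < E[N] < ∞`, the matrices are nonnegative, the first `N` of them are nonzero
and the others vanish. -/
def CondN (P : Measure Ω) (N : Ω → ℕ) (A : ℕ → Ω → Mat d) : Prop :=
  (∀ᵐ ω ∂P, 1 ≤ N ω) ∧ 1 < meanN P N ∧ meanN P N < ⊤ ∧
  (∀ᵐ ω ∂P, ∀ i, (∀ j k, 0 ≤ A i ω j k) ∧ (i < N ω → A i ω ≠ 0) ∧ (N ω ≤ i → A i ω = 0))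

/-- `μ(B) = E[#{i ≤ N : A_i ∈ B}] / E[N]`. -/
def mu (P : Measure Ω) (N : Ω → ℕ) (A : ℕ → Ω → Mat d) : Measure (Mat d) :=
  (meanN P N)⁻¹ • Measure.sum fun i => (P.restrict {ω | i < N ω}).map (A i)

/-- The semigroup (with identity) generated by the support of a measure on matrices. -/
def Gam (μ : Measure (Mat d)) : Submonoid (Mat d) := Submonoid.closure μ.support

/-- Allowability and positivity. -/
def CondMu (μ : Measure (Mat d)) : Prop :=
  (∀ a ∈ Gam μ, (∀ i, ∃ j, 0 < a i j) ∧ (∀ j, ∃ i, 0 < a i j)) ∧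
  ∃ a ∈ Gam μ, StrictlyPos a

/-- The support of the law of the sequence `(A_1, A_2, …)`, in the product topology. -/
def seqSupport (P : Measure Ω) (A : ℕ → Ω → Mat d) : Set (ℕ → Mat d) :=
  (P.map fun ω i => A i ω).support

/-- `U` is a cover set: every infinite sequence has exactly one prefix in `U`. -/
def IsCoverSet (U : Set (List ℕ)) : Prop :=
  ∀ s : ℕ → ℕ, ∃! k : ℕ, (List.range k).map s ∈ U

/-- The words of `U` have bounded length. -/
def FiniteLevel (U : Set (List ℕ)) : Prop := ∃ L : ℕ, ∀ u ∈ U, u.length ≤ L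

/-- `a_{u|1} a_{u|2} ⋯ a_{u||u|}`, where `a v i` stands for `a_{vi}`. -/
def pathProd (a : List ℕ → ℕ → Mat d) (u : List ℕ) : Mat d :=
  (List.ofFn fun k : Fin u.length => a (u.take k) (u.get k)).prod

/-- `l` is a convergent sum `∑_{u ∈ U} a_{u|1} ⋯ a_{u||u|}`, for a cover set `U` of finite level
and realizations `(a_{v1}, a_{v2}, …)`, `v` a word, in the support of `(A_1, A_2, …)`. -/
def IsCoverSum (P : Measure Ω) (A : ℕ → Ω → Mat d) (l : Mat d) : Prop :=
  ∃ U : Set (List ℕ), IsCoverSet U ∧ FiniteLevel U ∧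
    ∃ a : List ℕ → ℕ → Mat d, (∀ v, a v ∈ seqSupport P A) ∧
      HasSum (fun u : U => pathProd a u) l

/-- There are strictly positive cover sums with spectral radius below and above `1`. -/
def CondCover (P : Measure Ω) (A : ℕ → Ω → Mat d) : Prop :=
  ∃ l₁ l₂ : Mat d, IsCoverSum P A l₁ ∧ IsCoverSum P A l₂ ∧
    StrictlyPos l₁ ∧ StrictlyPos l₂ ∧ specRad l₁ < 1 ∧ 1 < specRad l₂

/-- `I_μ = {s ≥ 0 : ∫ ‖a‖^s dμ < ∞}`. -/
def momentSet (μ : Measure (Mat d)) : Set ℝ :=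
  {s | 0 ≤ s ∧ ∫⁻ a, ENNReal.ofReal (opNorm a ^ s) ∂μ < ⊤}

/-- `E ‖M_n ⋯ M_1‖^s` for independent matrices `M_1, …, M_n` of law `μ`. -/
def normMoment (μ : Measure (Mat d)) (s : ℝ) (n : ℕ) : ℝ :=
  ∫ M : Fin n → Mat d, opNorm (List.ofFn M).reverse.prod ^ s ∂(Measure.pi fun _ => μ)

/-- `κ(s) = lim_n (E ‖M_n ⋯ M_1‖^s)^{1/n}`; for `s ∈ I_μ` the sequence of moments is
submultiplicative, so that the limit exists. -/
def kappa (μ : Measure (Mat d)) (s : ℝ) : ℝ :=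
  limUnder atTop fun n : ℕ => normMoment μ s n ^ (1 / (n : ℝ))

/-- `m(s) = E[N] κ(s)`. -/
def mFun (P : Measure Ω) (N : Ω → ℕ) (A : ℕ → Ω → Mat d) (s : ℝ) : ℝ :=
  (meanN P N).toReal * kappa (mu P N A) s

/-- There is `α ∈ (0, 1] ∩ int I_μ` with `m(α) = 1` and `m'(α) < 0`. -/
def CondAlpha (P : Measure Ω) (N : Ω → ℕ) (A : ℕ → Ω → Mat d) : Prop :=
  ∃ α : ℝ, 0 < α ∧ α ≤ 1 ∧ α ∈ interior (momentSet (mu P N A)) ∧ mFun P N A α = 1 ∧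
    ∃ m' : ℝ, HasDerivAt (mFun P N A) m' α ∧ m' < 0

/-- `N(t) = #{i : A_iᵀ t ≠ 0}`. -/
def countNonzero (A : ℕ → Ω → Mat d) (t : Fin d → ℝ) (ω : Ω) : ℕ∞ :=
  {i : ℕ | (A i ω)ᵀ *ᵥ t ≠ 0}.encard

/-- A.s. `N(t) ≥ 1` for all `t ≠ 0`; `P[N(t) = 1] < 1` for all `t ≠ 0`; and for some random
indices `i(t)` with `A_{i(t)}ᵀ t ≠ 0` a.s., `sup_{|t| = 1} E |A_{i(t)}ᵀ t|^{-ε} < ∞`. -/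
def CondHarmonic (P : Measure Ω) (A : ℕ → Ω → Mat d) : Prop :=
  (∀ᵐ ω ∂P, ∀ t : Fin d → ℝ, t ≠ 0 → 1 ≤ countNonzero A t ω) ∧
  (∀ t : Fin d → ℝ, t ≠ 0 → P {ω | countNonzero A t ω = 1} < 1) ∧
  ∃ ε : ℝ, 0 < ε ∧ ∃ i : (Fin d → ℝ) → Ω → ℕ,
    (∀ t, l1 t = 1 → Measurable (i t) ∧ ∀ᵐ ω ∂P, (A (i t ω) ω)ᵀ *ᵥ t ≠ 0) ∧
    (⨆ (t : Fin d → ℝ) (_ : l1 t = 1),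
      ∫⁻ ω, ENNReal.ofReal (l1 ((A (i t ω) ω)ᵀ *ᵥ t)) ^ (-ε) ∂P) < ⊤

/-- The closure of the set of normalized Perron-Frobenius eigenvectors of the strictly positive
elements of the semigroup. -/
def Lam (μ : Measure (Mat d)) : Set (Fin d → ℝ) :=
  closure {x | ∃ a ∈ Gam μ, StrictlyPos a ∧ (∀ i, 0 < x i) ∧ l1 x = 1 ∧ a *ᵥ x = specRad a • x}

/-- `S(η)`: the law of `∑_{i ≤ N} A_i Z_i`, where the `Z_i` are i.i.d. with law `η` and independent
of `(N, A_1, A_2, …)`. -/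
def smoothing (P : Measure Ω) (N : Ω → ℕ) (A : ℕ → Ω → Mat d) (η : Measure (Fin d → ℝ)) :
    Measure (Fin d → ℝ) :=
  (P.prod (Measure.infinitePi fun _ : ℕ => η)).map
    fun p => ∑ i ∈ Finset.range (N p.1), A i p.1 *ᵥ p.2 i

/-- `η` is a probability measure on `ℝ_+^d` with `S(η) = η`. -/
def IsFixedPoint (P : Measure Ω) (N : Ω → ℕ) (A : ℕ → Ω → Mat d) (η : Measure (Fin d → ℝ)) :
    Prop :=
  IsProbabilityMeasure η ∧ (∀ᵐ z ∂η, ∀ i, 0 ≤ z i) ∧ smoothing P N A η = η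

end Model

end SmoothingTransform

end

/-!
Let `φ` be the characteristic function of a fixed point `η`. Along the branching process of products
of weights, `η` is at each generation a mixture of laws of weighted sums, so `φ(t)` is an average of
products of the values `φ(ℓᵀ t)` over the particles `ℓ` of that generation.

* `|φ| < 1` off the origin. Otherwise, since generations become small, `|φ| = 1` on a sequence of
  points tending to `0`, and the directions in which `η` is carried by an affine hyperplane form
  a nonzero subspace. It is invariant under the transposed semigroup, hence contains a strictly
  positive vector because the Perron-Frobenius eigenvectors span. Pairing this vector with the
  deterministic part of `η` gives a quantity that is excessive along the weights, which a positive
  cover sum of spectral radius above `1` contradicts.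
* `|φ| ≤ ρ < 1` off the unit ball, because far from the origin two particles of some generation
  with norm at most `1` see the same supremum.
* `φ` decays polynomially, because the second particle gains a factor `ρ` while the negative moments
  control the loss on the first one.
* Although `φ` need not be integrable, a weighted sum with sufficiently many particles present in
  each direction has an integrable characteristic function. This event has probability tending
  to `1` along the generations, so `η` gives no mass to null sets.
-/

noncomputable section

namespace SmoothingTransform

open ProbabilityTheory

section CharacteristicFunction

variable {ι X : Type*} [Fintype ι] [MeasurableSpace X]

/-- The characteristic function `t ↦ ∫ exp(i t·x) η(dx)` of a measure on `ℝ^ι`. Mathlib's `charFun`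
needs an inner product, which the function space `ι → ℝ` with its supremum norm does not carry. -/
def cf (η : Measure (ι → ℝ)) (t : ι → ℝ) : ℂ :=
  ∫ x, Complex.exp ((t ⬝ᵥ x : ℝ) * Complex.I) ∂η

@[fun_prop]
lemma continuous_dotProduct_left (t : ι → ℝ) : Continuous fun x : ι → ℝ => t ⬝ᵥ x :=
  continuous_const.dotProduct continuous_id

@[fun_prop]
lemma measurable_dotProduct_left (t : ι → ℝ) : Measurable fun x : ι → ℝ => t ⬝ᵥ x :=
  (continuous_dotProduct_left t).measurable

lemma integrable_exp_dotProduct_mul_I (η : Measure (ι → ℝ)) [IsFiniteMeasure η] (t : ι → ℝ) :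
    Integrable (fun x => Complex.exp ((t ⬝ᵥ x : ℝ) * Complex.I)) η :=
  .of_bound (by fun_prop) 1 (ae_of_all _ fun x => (Complex.norm_exp_ofReal_mul_I _).le)

lemma norm_cf_le_one (η : Measure (ι → ℝ)) [IsProbabilityMeasure η] (t : ι → ℝ) :
    ‖cf η t‖ ≤ 1 :=
  (norm_integral_le_integral_norm _).trans (by simp [Complex.norm_exp_ofReal_mul_I])

@[simp]
lemma cf_zero (η : Measure (ι → ℝ)) [IsProbabilityMeasure η] : cf η 0 = 1 := by
  simp [cf]

lemma continuous_cf (η : Measure (ι → ℝ)) [IsFiniteMeasure η] : Continuous (cf η) := by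
  refine continuous_of_dominated (bound := fun _ => 1) (fun t => by fun_prop)
    (fun t => ae_of_all _ fun x => (Complex.norm_exp_ofReal_mul_I _).le) (integrable_const _)
    (ae_of_all _ fun x => ?_)
  have : Continuous fun t : ι → ℝ => t ⬝ᵥ x := continuous_id.dotProduct continuous_const
  fun_prop

lemma eq_of_cf_eq {μ ν : Measure (ι → ℝ)} [IsFiniteMeasure μ] [IsFiniteMeasure ν]
    (h : ∀ t, cf μ t = cf ν t) : μ = ν := by
  classical
  refine Measure.ext_of_charFunDual (funext fun L => ?_)
  have hL : ∀ x, L x = (fun i => L (Pi.single i 1)) ⬝ᵥ x := fun x => by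
    conv_lhs => rw [pi_eq_sum_univ' x, map_sum]
    exact Finset.sum_congr rfl fun i _ => by rw [map_smul, smul_eq_mul, mul_comm]
  have hcf : ∀ ρ : Measure (ι → ℝ),
      charFunDual ρ L = cf ρ fun i => L (Pi.single i 1) := fun ρ => by
    rw [charFunDual_apply, cf]
    exact integral_congr_ae (ae_of_all _ fun x => by simp only [hL x])
  rw [hcf, hcf, h]

lemma cf_map (P : Measure X) {f : X → ι → ℝ} (hf : AEMeasurable f P) (t : ι → ℝ) :
    cf (P.map f) t = ∫ x, Complex.exp ((t ⬝ᵥ f x : ℝ) * Complex.I) ∂P :=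
  integral_map hf (by fun_prop)

lemma cf_bind (m : Measure X) [IsProbabilityMeasure m] (κ : Kernel X (ι → ℝ)) [IsMarkovKernel κ]
    (t : ι → ℝ) : cf (m.bind κ) t = ∫ x, cf (κ x) t ∂m := by
  have : IsProbabilityMeasure ((κ ∘ₖ Kernel.const Unit m) ()) := inferInstance
  simpa [Kernel.comp_apply, cf] using Kernel.integral_comp (κ := Kernel.const Unit m) (η := κ)
    (a := ()) (integrable_exp_dotProduct_mul_I _ t)

lemma measurable_cf_kernel (κ : Kernel X (ι → ℝ)) (t : ι → ℝ) :
    Measurable fun x => cf (κ x) t :=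
  (StronglyMeasurable.integral_kernel (κ := κ) (by fun_prop)).measurable

end CharacteristicFunction

section InfiniteProduct

variable {ι : Type*} {X : ι → Type*} [∀ i, MeasurableSpace (X i)] (P : ∀ i, Measure (X i))
  [∀ i, IsProbabilityMeasure (P i)]

lemma integral_infinitePi_prod {𝕜 : Type*} [RCLike 𝕜] (s : Finset ι) {f : ∀ i, X i → 𝕜}
    (hf : ∀ i, Measurable (f i)) :
    ∫ z, ∏ i ∈ s, f i (z i) ∂(Measure.infinitePi P) = ∏ i ∈ s, ∫ x, f i x ∂(P i) := by
  have hmeas : Measurable fun y : ∀ i : s, X i => ∏ i : s, f i (y i) :=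
    Finset.measurable_fun_prod _ fun i _ => (hf i).comp (measurable_pi_apply i)
  calc ∫ z, ∏ i ∈ s, f i (z i) ∂(Measure.infinitePi P)
      = ∫ z, ∏ i : s, f i (s.restrict z i) ∂(Measure.infinitePi P) := by
        simp only [Finset.restrict, Finset.prod_coe_sort s fun i => f i (_ : X i)]
    _ = ∏ i : s, ∫ x, f i x ∂(P i) :=
        (integral_restrict_infinitePi (μ := P) (s := s) (f := fun y => ∏ i : s, f i (y i))
          hmeas.aestronglyMeasurable).trans (integral_fintype_prod_eq_prod fun i : s => f i)
    _ = ∏ i ∈ s, ∫ x, f i x ∂(P i) := Finset.prod_coe_sort s fun i => ∫ x, f i x ∂(P i)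

lemma ae_infinitePi_forall [Countable ι] {p : ∀ i, X i → Prop} (h : ∀ i, ∀ᵐ x ∂(P i), p i x) :
    ∀ᵐ z ∂(Measure.infinitePi P), ∀ i, p i (z i) :=
  ae_all_iff.2 fun i =>
    (measurePreserving_eval_infinitePi P i).quasiMeasurePreserving.ae (h i)

end InfiniteProduct

section AbsorbingSets

variable {X : Type*} [MeasurableSpace X] {κ : Kernel X X}

lemma kernel_pow_zero_apply (κ : Kernel X X) (x : X) : (κ ^ 0) x = Measure.dirac x := by
  rw [pow_zero]; exact Kernel.id_apply x

lemma kernel_pow_succ_apply (κ : Kernel X X) (n : ℕ) (x : X) :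
    (κ ^ (n + 1)) x = ((κ ^ n) x).bind κ := by
  rw [pow_succ']; exact Kernel.comp_apply _ _ _

instance isMarkovKernel_pow [IsMarkovKernel κ] (n : ℕ) : IsMarkovKernel (κ ^ n) := by
  induction n with
  | zero => rw [pow_zero]; exact inferInstanceAs (IsMarkovKernel Kernel.id)
  | succ n ih =>
    rw [show κ ^ (n + 1) = Kernel.comp κ (κ ^ n) from pow_succ' κ n]
    infer_instance

/-- A measurable set of states which the chain with transition kernel `κ` a.s. never leaves. -/
structure IsAbsorbing (κ : Kernel X X) (B : Set X) : Prop where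
  measurableSet : MeasurableSet B
  compl_eq_zero : ∀ x ∈ B, κ x Bᶜ = 0

namespace IsAbsorbing

variable {B B' : Set X}

lemma pow_compl_eq_zero (hB : IsAbsorbing κ B) (n : ℕ) {x : X} (hx : x ∈ B) :
    (κ ^ n) x Bᶜ = 0 := by
  induction n with
  | zero =>
    rw [kernel_pow_zero_apply, Measure.dirac_apply' _ hB.measurableSet.compl,
      Set.indicator_of_notMem (not_not.2 hx)]
  | succ n ih =>
    have hmem : ∀ᵐ y ∂((κ ^ n) x), y ∈ B := ih
    rw [kernel_pow_succ_apply, Measure.bind_apply hB.measurableSet.compl κ.aemeasurable,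
      lintegral_eq_zero_iff (κ.measurable_coe hB.measurableSet.compl)]
    filter_upwards [hmem] with y hy using hB.compl_eq_zero y hy

lemma ae_pow_mem (hB : IsAbsorbing κ B) (n : ℕ) {x : X} (hx : x ∈ B) :
    ∀ᵐ y ∂((κ ^ n) x), y ∈ B :=
  hB.pow_compl_eq_zero n hx

lemma inter (hB : IsAbsorbing κ B) (hB' : IsAbsorbing κ B') : IsAbsorbing κ (B ∩ B') where
  measurableSet := hB.measurableSet.inter hB'.measurableSet
  compl_eq_zero x hx := by
    rw [Set.compl_inter]
    exact measure_union_null (hB.compl_eq_zero x hx.1) (hB'.compl_eq_zero x hx.2)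

variable [IsMarkovKernel κ]

lemma pow_compl_antitone (hB : IsAbsorbing κ B) (x : X) : Antitone fun n => (κ ^ n) x Bᶜ := by
  intro m n hmn
  obtain ⟨j, rfl⟩ := Nat.exists_eq_add_of_le hmn
  have hmeas := hB.measurableSet.compl
  change (κ ^ (m + j)) x Bᶜ ≤ (κ ^ m) x Bᶜ
  rw [Kernel.pow_add_apply_eq_lintegral κ m j x hmeas, ← lintegral_indicator_one hmeas]
  refine lintegral_mono fun y => ?_
  by_cases hy : y ∈ B
  · exact (hB.pow_compl_eq_zero j hy).le.trans zero_le
  · simpa [hy] using prob_le_one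

lemma pow_compl_le_pow (hB : IsAbsorbing κ B) (hB' : IsAbsorbing κ B') {q : ℝ≥0∞}
    (hq : ∀ x ∈ B, κ x B'ᶜ ≤ q) (n : ℕ) {x : X} (hx : x ∈ B) : (κ ^ n) x B'ᶜ ≤ q ^ n := by
  have hmeas := hB'.measurableSet.compl
  induction n with
  | zero => rw [pow_zero (M := ℝ≥0∞)]; exact prob_le_one
  | succ n ih =>
    calc (κ ^ (n + 1)) x B'ᶜ = ∫⁻ y, κ y B'ᶜ ∂((κ ^ n) x) :=
          Kernel.pow_succ_apply_eq_lintegral κ n x hmeas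
      _ ≤ ∫⁻ y, q * B'ᶜ.indicator 1 y ∂((κ ^ n) x) := by
          refine lintegral_mono_ae ?_
          filter_upwards [hB.ae_pow_mem n hx] with y hy
          by_cases hy' : y ∈ B'
          · exact (hB'.compl_eq_zero y hy').le.trans zero_le
          · simpa [hy'] using hq y hy
      _ = q * (κ ^ n) x B'ᶜ := by
          rw [lintegral_const_mul _ (measurable_one.indicator hmeas),
            lintegral_indicator_one hmeas]
      _ ≤ q ^ (n + 1) := by
          rw [pow_succ']
          gcongr

lemma tendsto_pow_zero (hB : IsAbsorbing κ B) {E S : Set X} (hE : MeasurableSet E)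
    (hS : MeasurableSet S) {x : X} (hx : x ∈ B)
    (hreach : Tendsto (fun n => (κ ^ n) x Sᶜ) atTop (𝓝 0))
    (hlim : ∀ y ∈ B, y ∈ S → Tendsto (fun n => (κ ^ n) y E) atTop (𝓝 0)) :
    Tendsto (fun n => (κ ^ n) x E) atTop (𝓝 0) := by
  refine ENNReal.tendsto_atTop_zero.2 fun ε hε => ?_
  have hε2 : 0 < ε / 2 := ENNReal.half_pos hε.ne'
  obtain ⟨m, hm⟩ := ENNReal.tendsto_atTop_zero.1 hreach _ hε2
  have hinside : Tendsto (fun n => ∫⁻ y, S.indicator (fun y => (κ ^ n) y E) y ∂((κ ^ m) x))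
      atTop (𝓝 0) := by
    rw [← lintegral_zero (μ := (κ ^ m) x)]
    refine tendsto_lintegral_of_dominated_convergence (fun _ => 1)
      (fun n => ((κ ^ n).measurable_coe hE).indicator hS)
      (fun n => ae_of_all _ (Set.indicator_le' (fun _ _ => prob_le_one) fun _ _ => zero_le))
      (by simp) ?_
    filter_upwards [hB.ae_pow_mem m hx] with y hy
    by_cases hyS : y ∈ S
    · simpa only [Set.indicator_of_mem hyS] using hlim y hy hyS
    · simpa only [Set.indicator_of_notMem hyS] using tendsto_const_nhds
  obtain ⟨n₀, hn₀⟩ := ENNReal.tendsto_atTop_zero.1 hinside _ hε2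
  refine ⟨m + n₀, fun n hn => ?_⟩
  obtain ⟨j, rfl⟩ := Nat.exists_eq_add_of_le hn
  calc (κ ^ (m + n₀ + j)) x E = ∫⁻ y, (κ ^ (n₀ + j)) y E ∂((κ ^ m) x) := by
        rw [add_assoc, Kernel.pow_add_apply_eq_lintegral κ m (n₀ + j) x hE]
    _ ≤ ∫⁻ y, (S.indicator (fun y => (κ ^ (n₀ + j)) y E) y + Sᶜ.indicator 1 y) ∂((κ ^ m) x) := by
        refine lintegral_mono fun y => ?_
        by_cases hy : y ∈ S
        · simp [hy]
        · simpa [hy] using prob_le_one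
    _ ≤ ε / 2 + ε / 2 := by
        rw [lintegral_add_right _ (measurable_one.indicator hS.compl),
          lintegral_indicator_one hS.compl]
        exact add_le_add (hn₀ _ (Nat.le_add_right _ _)) (hm m le_rfl)
    _ = ε := ENNReal.add_halves ε

end IsAbsorbing

/-- The number of steps depends only on `q`, `ε` and `k`, not on the chain of sets: this is what
makes the survival estimates uniform in the direction. -/
lemma exists_forall_pow_compl_le [IsMarkovKernel κ] {q : ℝ≥0∞} (hq : q < 1) {ε : ℝ≥0∞}
    (hε : ε ≠ 0) (k : ℕ) :
    ∃ m : ℕ, ∀ B : ℕ → Set X, (∀ j, IsAbsorbing κ (B j)) →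
      (∀ j, ∀ x ∈ B j, κ x (B (j + 1))ᶜ ≤ q) →
      ∀ n, m ≤ n → ∀ x ∈ B 0, (κ ^ n) x (B k)ᶜ ≤ ε := by
  induction k generalizing ε with
  | zero => exact ⟨0, fun B hB _ n _ x hx => ((hB 0).pow_compl_eq_zero n hx).le.trans zero_le⟩
  | succ k ih =>
    obtain ⟨m, hm⟩ := ih (ENNReal.half_pos hε).ne'
    obtain ⟨j, hj⟩ := ((ENNReal.tendsto_pow_atTop_nhds_zero_of_lt_one hq).eventually_lt_const
      (ENNReal.half_pos hε)).exists
    refine ⟨m + j, fun B hB hstep n hn x hx => ?_⟩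
    have hmeas := (hB k).measurableSet.compl
    calc (κ ^ n) x (B (k + 1))ᶜ ≤ (κ ^ (m + j)) x (B (k + 1))ᶜ :=
          (hB (k + 1)).pow_compl_antitone x hn
      _ = ∫⁻ y, (κ ^ j) y (B (k + 1))ᶜ ∂((κ ^ m) x) :=
          Kernel.pow_add_apply_eq_lintegral κ m j x (hB (k + 1)).measurableSet.compl
      _ ≤ ∫⁻ y, ((B k)ᶜ.indicator 1 y + q ^ j) ∂((κ ^ m) x) := by
          refine lintegral_mono fun y => ?_
          by_cases hy : y ∈ B k
          · exact ((hB k).pow_compl_le_pow (hB (k + 1)) (hstep k) j hy).trans le_add_self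
          · simpa [hy] using prob_le_one.trans le_self_add
      _ = (κ ^ m) x (B k)ᶜ + q ^ j := by
          rw [lintegral_add_right _ measurable_const, lintegral_indicator_one hmeas,
            lintegral_const, measure_univ, mul_one]
      _ ≤ ε / 2 + ε / 2 := add_le_add (hm B hB hstep m le_rfl x hx) hj.le
      _ = ε := ENNReal.add_halves ε

end AbsorbingSets

section Measurability

variable {d : ℕ} {X : Type*} [MeasurableSpace X]

instance : SecondCountableTopology (Mat d) :=
  inferInstanceAs (SecondCountableTopology (Fin d → Fin d → ℝ))

instance : MeasurableSingletonClass (Mat d) :=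
  inferInstanceAs (MeasurableSingletonClass (Fin d → Fin d → ℝ))

@[fun_prop]
lemma measurable_mulVec {f : X → Mat d} {g : X → Fin d → ℝ} (hf : Measurable f)
    (hg : Measurable g) : Measurable fun x => f x *ᵥ g x :=
  (Continuous.matrix_mulVec (A := fun p : Mat d × (Fin d → ℝ) => p.1) continuous_fst
    continuous_snd).measurable.comp (hf.prodMk hg)

@[fun_prop]
lemma measurable_matrix_mul {f g : X → Mat d} (hf : Measurable f) (hg : Measurable g) :
    Measurable fun x => f x * g x :=
  (Continuous.matrix_mul (A := fun p : Mat d × Mat d => p.1) continuous_fst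
    continuous_snd).measurable.comp (hf.prodMk hg)

@[fun_prop]
lemma measurable_transpose {f : X → Mat d} (hf : Measurable f) : Measurable fun x => (f x)ᵀ :=
  (Continuous.matrix_transpose (A := fun p : Mat d => p) continuous_id).measurable.comp hf

lemma measurable_apply_nat_index {β : Type*} [MeasurableSpace β] {N : X → ℕ} (hN : Measurable N)
    {f : ℕ → X → β} (hf : ∀ n, Measurable (f n)) : Measurable fun x => f (N x) x :=
  (measurable_from_prod_countable_right (f := fun p : ℕ × X => f p.1 p.2) hf).comp
    (hN.prodMk measurable_id)

lemma map_id_prod_const_apply {Y Z : Type*} [MeasurableSpace Y] [MeasurableSpace Z]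
    (ρ : Measure Y) [SFinite ρ] {g : X × Y → Z} (hg : Measurable g) (x : X) :
    ((Kernel.id ×ₖ Kernel.const X ρ).map g) x = ρ.map fun y => g (x, y) := by
  rw [Kernel.map_apply _ hg, Kernel.prod_apply, Kernel.id_apply, Kernel.const_apply,
    Measure.dirac_prod, Measure.map_map hg (by fun_prop)]
  rfl

end Measurability

section WeightedSums

variable {d : ℕ}

/-- States of the chain of generations: `ℓ k` is the accumulated weight of the `k`-th particle of
the current generation, and `0` if there is no such particle. -/
abbrev St (d : ℕ) : Type := ℕ → Mat d

/-- The sum `∑ ℓ_k z_k` over the particles of one generation. -/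
def weightedSum (p : St d × (ℕ → Fin d → ℝ)) : Fin d → ℝ := ∑' k, p.1 k *ᵥ p.2 k

/-- The states with finitely many particles. -/
def finStates (d : ℕ) : Set (St d) := {ℓ | ∃ K, ∀ k, K ≤ k → ℓ k = 0}

lemma measurableSet_finStates : MeasurableSet (finStates d) := by
  have : finStates d = ⋃ K, ⋂ k, ⋂ _ : K ≤ k, {ℓ | ℓ k = 0} := by ext; simp [finStates]
  rw [this]
  exact .iUnion fun K => .iInter fun k => .iInter fun _ =>
    (measurable_pi_apply k) (measurableSet_singleton 0)

@[fun_prop]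
lemma measurable_weightedSum : Measurable (weightedSum (d := d)) :=
  Measurable.tsum fun k => by fun_prop

lemma weightedSum_eq_sum {ℓ : St d} {s : Finset ℕ} (h : ∀ k ∉ s, ℓ k = 0)
    (z : ℕ → Fin d → ℝ) : weightedSum (ℓ, z) = ∑ k ∈ s, ℓ k *ᵥ z k :=
  tsum_eq_sum fun k hk => by simp [h k hk]

variable (η : Measure (Fin d → ℝ)) [IsProbabilityMeasure η]

/-- The law of `∑ ℓ_k Z_k` for independent `Z_k` of law `η`, as a kernel in `ℓ`. -/
def sumLaw : Kernel (St d) (Fin d → ℝ) :=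
  (Kernel.id ×ₖ Kernel.const _ (Measure.infinitePi fun _ : ℕ => η)).map weightedSum

instance : IsMarkovKernel (sumLaw η) :=
  Kernel.IsMarkovKernel.map _ measurable_weightedSum

lemma integral_exp_dotProduct_sum_mulVec (s : Finset ℕ) (B : ℕ → Mat d) (t : Fin d → ℝ) :
    ∫ z : ℕ → Fin d → ℝ, Complex.exp ((t ⬝ᵥ ∑ k ∈ s, B k *ᵥ z k : ℝ) * Complex.I)
      ∂(Measure.infinitePi fun _ : ℕ => η) = ∏ k ∈ s, cf η ((B k)ᵀ *ᵥ t) := by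
  simp only [cf]
  rw [← integral_infinitePi_prod (fun _ => η) s
    (f := fun k x => Complex.exp ((((B k)ᵀ *ᵥ t) ⬝ᵥ x : ℝ) * Complex.I)) fun k => by fun_prop]
  congr 1 with z
  simp only [dotProduct_sum, Matrix.dotProduct_mulVec, Matrix.mulVec_transpose,
    Complex.ofReal_sum, Finset.sum_mul, Complex.exp_sum]

lemma cf_sumLaw {ℓ : St d} {s : Finset ℕ} (h : ∀ k ∉ s, ℓ k = 0) (t : Fin d → ℝ) :
    cf (sumLaw η ℓ) t = ∏ k ∈ s, cf η ((ℓ k)ᵀ *ᵥ t) := by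
  rw [sumLaw, map_id_prod_const_apply _ measurable_weightedSum, cf_map _ (by fun_prop)]
  simp only [weightedSum_eq_sum h]
  exact integral_exp_dotProduct_sum_mulVec η s ℓ t

lemma norm_cf_sumLaw_le {ℓ : St d} (hℓ : ℓ ∈ finStates d) (t : Fin d → ℝ) (F : Finset ℕ) :
    ‖cf (sumLaw η ℓ) t‖ ≤ ∏ k ∈ F, ‖cf η ((ℓ k)ᵀ *ᵥ t)‖ := by
  obtain ⟨K, hK⟩ := hℓ
  have hsupp : ∀ k ∉ Finset.range K ∪ F, ℓ k = 0 := fun k hk =>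
    hK k (not_lt.1 fun hlt => hk (Finset.mem_union_left _ (Finset.mem_range.2 hlt)))
  rw [cf_sumLaw η hsupp, norm_prod]
  exact Finset.prod_le_prod_of_subset_of_le_one Finset.subset_union_right
    (fun _ _ => norm_nonneg _) (fun _ _ _ => norm_cf_le_one η _)

end WeightedSums

section Chain

variable {d : ℕ} {Ω : Type*}

/-- One generation of branching: particle `i` gets the children `Nat.pair i j`, of weights
`ℓ_i A_j(ω_i)`. -/
def branch (A : ℕ → Ω → Mat d) (p : St d × (ℕ → Ω)) : St d :=
  fun k => p.1 k.unpair.1 * A k.unpair.2 (p.2 k.unpair.1)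

/-- The labels `Nat.pair i j`, `j < n i`, of the children of the first `K` particles, when
particle `i` has `n i` children. -/
def offspring (K : ℕ) (n : ℕ → ℕ) : Finset ℕ :=
  ((Finset.range K).sigma fun i => Finset.range (n i)).map
    ((Equiv.sigmaEquivProd ℕ ℕ).trans Nat.pairEquiv).toEmbedding

lemma branch_eq_zero_of_notMem_offspring {N : Ω → ℕ} {A : ℕ → Ω → Mat d} {ℓ : St d} {K : ℕ}
    (hK : ∀ k, K ≤ k → ℓ k = 0) {ω : ℕ → Ω} (hω : ∀ i j, N (ω i) ≤ j → A j (ω i) = 0) {k : ℕ}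
    (hk : k ∉ offspring K fun i => N (ω i)) : branch A (ℓ, ω) k = 0 := by
  rw [offspring, Finset.mem_map_equiv, Finset.mem_sigma, Finset.mem_range, Finset.mem_range,
    not_and, not_lt] at hk
  rcases le_or_gt K k.unpair.1 with h | h
  · simp [branch, hK _ h]
  · have : A k.unpair.2 (ω k.unpair.1) = 0 := hω _ _ (hk h)
    simp [branch, this]

variable [MeasurableSpace Ω]

lemma measurable_branch {A : ℕ → Ω → Mat d} (hA : ∀ i, Measurable (A i)) :
    Measurable (branch A) :=
  measurable_pi_lambda _ fun _ => measurable_matrix_mul (by fun_prop) ((hA _).comp (by fun_prop))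

lemma measurable_branch_right {A : ℕ → Ω → Mat d} (hA : ∀ i, Measurable (A i)) (ℓ : St d) :
    Measurable fun ω => branch A (ℓ, ω) :=
  (measurable_branch hA).comp (by fun_prop)

variable (P : Measure Ω) [IsProbabilityMeasure P]

/-- The transition kernel of the chain of generations: each particle branches independently. -/
def step (A : ℕ → Ω → Mat d) : Kernel (St d) (St d) :=
  (Kernel.id ×ₖ Kernel.const _ (Measure.infinitePi fun _ : ℕ => P)).map (branch A)

variable {A : ℕ → Ω → Mat d}

lemma isMarkovKernel_step (hA : ∀ i, Measurable (A i)) : IsMarkovKernel (step P A) :=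
  Kernel.IsMarkovKernel.map _ (measurable_branch hA)

lemma step_apply (hA : ∀ i, Measurable (A i)) (ℓ : St d) :
    step P A ℓ = (Measure.infinitePi fun _ : ℕ => P).map fun ω => branch A (ℓ, ω) :=
  map_id_prod_const_apply _ (measurable_branch hA) ℓ

lemma ae_step_iff (hA : ∀ i, Measurable (A i)) (ℓ : St d) {S : Set (St d)}
    (hS : MeasurableSet S) : (∀ᵐ ℓ' ∂(step P A ℓ), ℓ' ∈ S) ↔
      ∀ᵐ ω ∂(Measure.infinitePi fun _ : ℕ => P), branch A (ℓ, ω) ∈ S := by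
  rw [step_apply P hA]
  exact ae_map_iff (measurable_branch_right hA ℓ).aemeasurable hS

/-- The standing assumptions on the weights of the smoothing transform: measurability, and
`A_i = 0` for `i ≥ N` (indices start from `0`). -/
structure IsWeightFamily (P : Measure Ω) (N : Ω → ℕ) (A : ℕ → Ω → Mat d) : Prop where
  measurable_card : Measurable N
  measurable : ∀ i, Measurable (A i)
  ae_eq_zero : ∀ᵐ ω ∂P, ∀ i, N ω ≤ i → A i ω = 0

variable {P} {N : Ω → ℕ}

lemma isAbsorbing_finStates (hA : IsWeightFamily P N A) :
    IsAbsorbing (step P A) (finStates d) := by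
  refine ⟨measurableSet_finStates, fun ℓ hℓ => ?_⟩
  refine (ae_step_iff P hA.measurable ℓ measurableSet_finStates).2 ?_
  filter_upwards [ae_infinitePi_forall _ fun _ => hA.ae_eq_zero] with ω hω
  obtain ⟨K, hK⟩ := hℓ
  refine ⟨(offspring K fun i => N (ω i)).sup id + 1, fun k hk =>
    branch_eq_zero_of_notMem_offspring hK hω fun hmem => ?_⟩
  exact (Nat.lt_of_succ_le hk).not_ge (Finset.le_sup (f := id) hmem)

variable {η : Measure (Fin d → ℝ)} [IsProbabilityMeasure η]

lemma measurable_smoothing_sum (hN : Measurable N) (hA : ∀ i, Measurable (A i)) :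
    Measurable fun p : Ω × (ℕ → Fin d → ℝ) => ∑ i ∈ Finset.range (N p.1), A i p.1 *ᵥ p.2 i :=
  measurable_apply_nat_index (X := Ω × (ℕ → Fin d → ℝ)) (N := fun p => N p.1)
    (f := fun n p => ∑ i ∈ Finset.range n, A i p.1 *ᵥ p.2 i) (hN.comp measurable_fst) fun _ =>
    Finset.measurable_fun_sum _ fun i _ =>
      measurable_mulVec ((hA i).comp measurable_fst) (by fun_prop)

lemma measurable_prod_cf (hN : Measurable N) (hA : ∀ i, Measurable (A i)) (t : Fin d → ℝ) :
    Measurable fun ω => ∏ j ∈ Finset.range (N ω), cf η ((A j ω)ᵀ *ᵥ t) :=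
  measurable_apply_nat_index hN fun _ => Finset.measurable_fun_prod _ fun i _ =>
    (continuous_cf η).measurable.comp
      (measurable_mulVec (measurable_transpose (hA i)) measurable_const)

lemma cf_smoothing (hN : Measurable N) (hA : ∀ i, Measurable (A i)) (t : Fin d → ℝ) :
    cf (smoothing P N A η) t
      = ∫ ω, ∏ j ∈ Finset.range (N ω), cf η ((A j ω)ᵀ *ᵥ t) ∂P := by
  have hm := measurable_smoothing_sum hN hA
  rw [smoothing, cf_map _ hm.aemeasurable, integral_prod]
  · simp only [integral_exp_dotProduct_sum_mulVec]
  · refine .of_bound ?_ 1 (ae_of_all _ fun x => (Complex.norm_exp_ofReal_mul_I _).le)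
    have := (measurable_dotProduct_left t).comp hm
    exact ((Complex.measurable_ofReal.comp this).mul_const _).cexp.aestronglyMeasurable

lemma bind_step_sumLaw (hA : IsWeightFamily P N A) (hη : smoothing P N A η = η) {ℓ : St d}
    (hℓ : ℓ ∈ finStates d) : (step P A ℓ).bind (sumLaw η) = sumLaw η ℓ := by
  have := isMarkovKernel_step P hA.measurable
  have hcf (s : Fin d → ℝ) :
      cf η s = ∫ ω, ∏ j ∈ Finset.range (N ω), cf η ((A j ω)ᵀ *ᵥ s) ∂P := by
    rw [← cf_smoothing hA.measurable_card hA.measurable, hη]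
  obtain ⟨K, hK⟩ := hℓ
  refine eq_of_cf_eq fun t => ?_
  calc cf ((step P A ℓ).bind (sumLaw η)) t
      = ∫ ω, cf (sumLaw η (branch A (ℓ, ω))) t ∂(Measure.infinitePi fun _ => P) := by
        rw [cf_bind, step_apply P hA.measurable, integral_map
          (measurable_branch_right hA.measurable ℓ).aemeasurable
          (measurable_cf_kernel _ t).aestronglyMeasurable]
    _ = ∫ ω, ∏ i ∈ Finset.range K, ∏ j ∈ Finset.range (N (ω i)),
          cf η ((A j (ω i))ᵀ *ᵥ (ℓ i)ᵀ *ᵥ t) ∂(Measure.infinitePi fun _ => P) := by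
        refine integral_congr_ae ?_
        filter_upwards [ae_infinitePi_forall _ fun _ => hA.ae_eq_zero] with ω hω
        rw [cf_sumLaw η fun k => branch_eq_zero_of_notMem_offspring hK hω, offspring,
          Finset.prod_map, Finset.prod_sigma]
        simp [branch, Matrix.transpose_mul, Matrix.mulVec_mulVec]
    _ = ∏ i ∈ Finset.range K, cf η ((ℓ i)ᵀ *ᵥ t) := by
        rw [integral_infinitePi_prod (fun _ => P) (Finset.range K)
          fun i => measurable_prod_cf hA.measurable_card hA.measurable ((ℓ i)ᵀ *ᵥ t)]
        simp only [← hcf]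
    _ = cf (sumLaw η ℓ) t := (cf_sumLaw η (fun k hk => hK k (by simpa using hk)) t).symm

lemma bind_step_pow_sumLaw (hA : IsWeightFamily P N A) (hη : smoothing P N A η = η) {ℓ : St d}
    (hℓ : ℓ ∈ finStates d) (n : ℕ) :
    ((step P A ^ n) ℓ).bind (sumLaw η) = sumLaw η ℓ := by
  induction n with
  | zero => rw [kernel_pow_zero_apply, Measure.dirac_bind (Kernel.measurable _)]
  | succ n ih =>
    rw [kernel_pow_succ_apply, Measure.bind_bind (Kernel.aemeasurable _)
      (Kernel.aemeasurable _), ← ih]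
    refine Measure.bind_congr_right ?_
    filter_upwards [(isAbsorbing_finStates hA).ae_pow_mem n hℓ] with ℓ' hℓ'
    exact bind_step_sumLaw hA hη hℓ'

/-- The initial state: a single particle, with weight the identity. -/
def root (d : ℕ) : St d := Pi.single 0 1

lemma root_eq_zero {k : ℕ} (hk : k ≠ 0) : root d k = 0 := Pi.single_eq_of_ne hk 1

lemma root_mem_finStates : root d ∈ finStates d :=
  ⟨1, fun _ hk => root_eq_zero (Nat.one_le_iff_ne_zero.1 hk)⟩

lemma sumLaw_root : sumLaw η (root d) = η := by
  refine eq_of_cf_eq fun t => ?_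
  rw [cf_sumLaw η (s := {0}) fun k hk => root_eq_zero (by simpa using hk)]
  simp [root]

lemma bind_step_pow_root (hA : IsWeightFamily P N A) (hη : smoothing P N A η = η) (n : ℕ) :
    ((step P A ^ n) (root d)).bind (sumLaw η) = η := by
  rw [bind_step_pow_sumLaw hA hη root_mem_finStates, sumLaw_root]

end Chain

section LargeImages

variable {d : ℕ}

/-- At least `k` of the vectors `ℓ_jᵀ t` have norm larger than `r`. -/
def HasLargeImages (r : ℝ) (k : ℕ) (ℓ : St d) (t : Fin d → ℝ) : Prop :=
  ∃ F : Finset ℕ, F.card = k ∧ ∀ j ∈ F, r < ‖(ℓ j)ᵀ *ᵥ t‖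

namespace HasLargeImages

variable {r : ℝ} {k : ℕ} {ℓ : St d} {t : Fin d → ℝ}

lemma mono_radius {r' : ℝ} (h : r' ≤ r) (hl : HasLargeImages r k ℓ t) :
    HasLargeImages r' k ℓ t := by
  obtain ⟨F, hF, hl⟩ := hl
  exact ⟨F, hF, fun j hj => h.trans_lt (hl j hj)⟩

lemma mono_card {k' : ℕ} (h : k' ≤ k) (hl : HasLargeImages r k ℓ t) :
    HasLargeImages r k' ℓ t := by
  obtain ⟨F, hF, hl⟩ := hl
  obtain ⟨F', hF', hcard⟩ := Finset.exists_subset_card_eq (hF.symm ▸ h)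
  exact ⟨F', hcard, fun j hj => hl j (hF' hj)⟩

end HasLargeImages

lemma hasLargeImages_smul_iff {r c : ℝ} (hc : 0 < c) {k : ℕ} {ℓ : St d} {t : Fin d → ℝ} :
    HasLargeImages (c * r) k ℓ (c • t) ↔ HasLargeImages r k ℓ t := by
  simp only [HasLargeImages, Matrix.mulVec_smul, norm_smul, Real.norm_of_nonneg hc.le,
    mul_lt_mul_iff_right₀ hc]

lemma isOpen_setOf_lt_norm_transpose_mulVec (F : Finset ℕ) :
    IsOpen {p : ℝ × St d × (Fin d → ℝ) | ∀ j ∈ F, p.1 < ‖(p.2.1 j)ᵀ *ᵥ p.2.2‖} := by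
  simp only [Set.ofPred_forall]
  exact isOpen_biInter_finset fun j _ => isOpen_lt (by fun_prop) (by fun_prop)

lemma isOpen_setOf_hasLargeImages (k : ℕ) :
    IsOpen {p : ℝ × St d × (Fin d → ℝ) | HasLargeImages p.1 k p.2.1 p.2.2} := by
  simp only [HasLargeImages, Set.ofPred_exists, Set.ofPred_and]
  exact isOpen_iUnion fun F => isOpen_const.inter (isOpen_setOf_lt_norm_transpose_mulVec F)

lemma measurableSet_hasLargeImages (r : ℝ) (k : ℕ) (t : Fin d → ℝ) :
    MeasurableSet {ℓ : St d | HasLargeImages r k ℓ t} :=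
  ((isOpen_setOf_hasLargeImages k).preimage (f := fun ℓ : St d => (r, ℓ, t))
    (by fun_prop)).measurableSet

lemma isOpen_forall_hasLargeImages (r : ℝ) (k : ℕ) {C : Set (Fin d → ℝ)} (hC : IsCompact C) :
    IsOpen {ℓ : St d | ∀ t ∈ C, HasLargeImages r k ℓ t} := by
  refine isOpen_iff_eventually.2 fun ℓ hℓ => ?_
  refine hC.eventually_forall_of_forall_eventually (P := HasLargeImages r k) fun t ht => ?_
  exact ((isOpen_setOf_hasLargeImages k).preimage
    (f := fun p : St d × (Fin d → ℝ) => (r, p)) (by fun_prop)).eventually_mem (hℓ t ht)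

lemma measurableSet_forall_hasLargeImages (r : ℝ) (k : ℕ) {C : Set (Fin d → ℝ)}
    (hC : IsSigmaCompact C) : MeasurableSet {ℓ : St d | ∀ t ∈ C, HasLargeImages r k ℓ t} := by
  obtain ⟨K, hK, rfl⟩ := hC
  simp only [Set.mem_iUnion, forall_exists_index, Set.ofPred_forall]
  rw [Set.iInter_comm]
  refine .iInter fun n => ?_
  simpa only [Set.ofPred_forall] using (isOpen_forall_hasLargeImages r k (hK n)).measurableSet

lemma HasLargeImages.exists_ball {k : ℕ} {ℓ : St d} {t₀ : Fin d → ℝ}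
    (h : HasLargeImages 0 k ℓ t₀) : ∃ m : ℕ, ∀ t ∈ Metric.ball t₀ (1 / ((m : ℝ) + 1)),
      HasLargeImages (1 / ((m : ℝ) + 1)) k ℓ t := by
  have hopen : IsOpen {p : ℝ × (Fin d → ℝ) | HasLargeImages p.1 k ℓ p.2} :=
    (isOpen_setOf_hasLargeImages k).preimage (f := fun p : ℝ × (Fin d → ℝ) => (p.1, ℓ, p.2))
      (by fun_prop)
  obtain ⟨ε, hε, hball⟩ := Metric.isOpen_iff.1 hopen (0, t₀) h
  obtain ⟨m, hm⟩ := exists_nat_one_div_lt hε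
  refine ⟨m, fun t ht => hball (a := (_, t)) ?_⟩
  rw [← ball_prod_same]
  refine ⟨?_, Metric.ball_subset_ball hm.le ht⟩
  have hpos : (0 : ℝ) < 1 / ((m : ℝ) + 1) := by positivity
  rwa [Metric.mem_ball, Real.dist_eq, sub_zero, abs_of_pos hpos]

lemma exists_ball_lt_measure_hasLargeImages (Q : Measure (St d)) {k : ℕ} {c : ℝ≥0∞}
    {t₀ : Fin d → ℝ} (h : c < Q {ℓ | HasLargeImages 0 k ℓ t₀}) :
    ∃ r : ℝ, 0 < r ∧ c < Q {ℓ | ∀ t ∈ Metric.ball t₀ r, HasLargeImages r k ℓ t} := by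
  set E : ℕ → Set (St d) := fun m => {ℓ | ∀ t ∈ Metric.ball t₀ (1 / ((m : ℝ) + 1)),
    HasLargeImages (1 / ((m : ℝ) + 1)) k ℓ t}
  have hmono : Monotone E := fun m n hmn ℓ hℓ t ht => by
    have hle : 1 / ((n : ℝ) + 1) ≤ 1 / ((m : ℝ) + 1) :=
      one_div_le_one_div_of_le (by positivity) (by gcongr)
    exact (hℓ t (Metric.ball_subset_ball hle ht)).mono_radius hle
  have hsub : {ℓ | HasLargeImages 0 k ℓ t₀} ⊆ ⋃ m, E m := fun ℓ hℓ =>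
    Set.mem_iUnion.2 hℓ.exists_ball
  have hlt := h.trans_le (measure_mono hsub)
  rw [hmono.measure_iUnion, lt_iSup_iff] at hlt
  obtain ⟨m, hm⟩ := hlt
  exact ⟨1 / ((m : ℝ) + 1), by positivity, hm⟩

lemma exists_radius_le_measure_hasLargeImages (Q : Measure (St d)) {C : Set (Fin d → ℝ)}
    (hC : IsCompact C) (k : ℕ) {c : ℝ≥0∞} (hc : c < ⊤)
    (h : ∀ t ∈ C, c < Q {ℓ | HasLargeImages 0 k ℓ t}) :
    ∃ r : ℝ, 0 < r ∧ ∃ b, c < b ∧ ∀ t ∈ C, b ≤ Q {ℓ | HasLargeImages r k ℓ t} := by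
  refine hC.induction_on
    (p := fun S => ∃ r : ℝ, 0 < r ∧ ∃ b, c < b ∧ ∀ t ∈ S, b ≤ Q {ℓ | HasLargeImages r k ℓ t})
    ⟨1, one_pos, ⊤, hc, by simp⟩ ?_ ?_ ?_
  · rintro s t hst ⟨r, hr, b, hb, h⟩
    exact ⟨r, hr, b, hb, fun x hx => h x (hst hx)⟩
  · rintro s t ⟨r, hr, b, hb, h⟩ ⟨r', hr', b', hb', h'⟩
    refine ⟨min r r', lt_min hr hr', min b b', lt_min hb hb', fun x hx => ?_⟩
    rcases hx with hx | hx
    · exact (min_le_left _ _).trans ((h x hx).trans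
        (measure_mono fun ℓ hl => hl.mono_radius (min_le_left _ _)))
    · exact (min_le_right _ _).trans ((h' x hx).trans
        (measure_mono fun ℓ hl => hl.mono_radius (min_le_right _ _)))
  · intro t₀ ht₀
    obtain ⟨r, hr, hlt⟩ := exists_ball_lt_measure_hasLargeImages Q (h t₀ ht₀)
    exact ⟨Metric.ball t₀ r, mem_nhdsWithin_of_mem_nhds (Metric.ball_mem_nhds _ hr), r, hr, _,
      hlt, fun t ht => measure_mono fun ℓ hℓ => hℓ t ht⟩

lemma isSigmaCompact_isClosed_inter_isOpen {X : Type*} [PseudoEMetricSpace X]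
    [SigmaCompactSpace X] {C U : Set X} (hC : IsClosed C) (hU : IsOpen U) :
    IsSigmaCompact (C ∩ U) := by
  obtain ⟨F, hF, -, hFU, -⟩ := hU.exists_iUnion_isClosed
  rw [← hFU, Set.inter_iUnion]
  exact isSigmaCompact_iUnion _ fun n => isSigmaCompact_univ.of_isClosed_subset
    (hC.inter (hF n)) (Set.subset_univ _)

lemma isSigmaCompact_setOf_hasLargeImages (r : ℝ) (k : ℕ) (ℓ : St d) :
    IsSigmaCompact {t | HasLargeImages r k ℓ t} := by
  rw [← Set.univ_inter {t | HasLargeImages r k ℓ t}]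
  exact isSigmaCompact_isClosed_inter_isOpen isClosed_univ
    ((isOpen_setOf_hasLargeImages k).preimage (f := fun t : Fin d → ℝ => (r, ℓ, t)) (by fun_prop))

lemma isSigmaCompact_submodule_diff_zero (W : Submodule ℝ (Fin d → ℝ)) :
    IsSigmaCompact ((W : Set (Fin d → ℝ)) \ {0}) :=
  isSigmaCompact_isClosed_inter_isOpen W.closed_of_finiteDimensional isOpen_compl_singleton

lemma exists_submodules_not_hasLargeImages_iff {ℓ : St d} (hℓ : ℓ ∈ finStates d) (k : ℕ) :
    ∃ 𝒱 : Finset (Submodule ℝ (Fin d → ℝ)),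
      ∀ t, ¬ HasLargeImages 0 k ℓ t ↔ ∃ V ∈ 𝒱, t ∈ V := by
  classical
  obtain ⟨K, hK⟩ := hℓ
  let killed (J : Finset ℕ) : Submodule ℝ (Fin d → ℝ) :=
    ⨅ u : ℕ, ⨅ _ : u ∉ J, LinearMap.ker (Matrix.mulVecLin (ℓ u)ᵀ)
  have mem_killed (J : Finset ℕ) (t : Fin d → ℝ) :
      t ∈ killed J ↔ ∀ u ∉ J, (ℓ u)ᵀ *ᵥ t = 0 := by
    simp only [killed, Submodule.mem_iInf, LinearMap.mem_ker, Matrix.mulVecLin_apply]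
  refine ⟨((Finset.range K).powerset.filter fun J => J.card < k).image killed, fun t => ?_⟩
  simp only [Finset.exists_mem_image, Finset.mem_filter, Finset.mem_powerset, mem_killed]
  constructor
  · intro hsmall
    refine ⟨(Finset.range K).filter fun u => (ℓ u)ᵀ *ᵥ t ≠ 0, ⟨Finset.filter_subset _ _, ?_⟩,
      fun u hu => ?_⟩
    · by_contra! hcard
      refine hsmall (HasLargeImages.mono_card hcard ⟨_, rfl, fun j hj => ?_⟩)
      exact norm_pos_iff.2 (Finset.mem_filter.1 hj).2
    · rcases lt_or_ge u K with huK | huK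
      · by_contra hne
        exact hu (Finset.mem_filter.2 ⟨Finset.mem_range.2 huK, hne⟩)
      · simp [hK u huK]
  · rintro ⟨J, ⟨-, hJ⟩, hzero⟩ ⟨F, hF, hlarge⟩
    obtain ⟨j, hjF, hjJ⟩ := Finset.exists_mem_notMem_of_card_lt_card (hF.symm ▸ hJ)
    exact (norm_pos_iff.1 (hlarge j hjF)) (hzero j hjJ)

end LargeImages

section Survival

variable {d : ℕ} {Ω : Type*} {A : ℕ → Ω → Mat d}

lemma HasLargeImages.branch {r : ℝ} {F : Finset ℕ} {n : ℕ → ℕ} {ℓ : St d} {ω : ℕ → Ω}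
    {t : Fin d → ℝ} (h : ∀ i ∈ F, HasLargeImages r (n i) (fun j => A j (ω i)) ((ℓ i)ᵀ *ᵥ t)) :
    HasLargeImages r (∑ i ∈ F, n i) (branch A (ℓ, ω)) t := by
  choose! G hcard hG using h
  refine ⟨(F.sigma G).map ((Equiv.sigmaEquivProd ℕ ℕ).trans Nat.pairEquiv).toEmbedding, ?_, ?_⟩
  · rw [Finset.card_map, Finset.card_sigma]
    exact Finset.sum_congr rfl hcard
  · intro j hj
    obtain ⟨⟨i, j⟩, hij, rfl⟩ := Finset.mem_map.1 hj
    obtain ⟨hi, hj⟩ := Finset.mem_sigma.1 hij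
    simpa [SmoothingTransform.branch, Matrix.transpose_mul, Matrix.mulVec_mulVec] using hG i hi j hj

variable [MeasurableSpace Ω] (P : Measure Ω)

/-- Almost surely every nonzero vector has a nonzero image under some `A_jᵀ`. -/
def Survives (A : ℕ → Ω → Mat d) : Prop :=
  ∀ᵐ ω ∂P, ∀ t : Fin d → ℝ, t ≠ 0 → HasLargeImages 0 1 (fun j => A j ω) t

/-- The states in which each vector of `C` has at least `k` nonzero images. -/
def survivingStates (k : ℕ) (C : Set (Fin d → ℝ)) : Set (St d) :=
  {ℓ | ∀ t ∈ C, HasLargeImages 0 k ℓ t}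

variable {P} [IsProbabilityMeasure P] {k : ℕ}

lemma isAbsorbing_survivingStates (hA : ∀ i, Measurable (A i)) (hne : Survives P A)
    {C : Set (Fin d → ℝ)} (hC : IsSigmaCompact C) :
    IsAbsorbing (step P A) (survivingStates k C) := by
  have hmeas : MeasurableSet (survivingStates k C) := measurableSet_forall_hasLargeImages 0 k hC
  refine ⟨hmeas, fun ℓ hℓ => (ae_step_iff P hA ℓ hmeas).2 ?_⟩
  filter_upwards [ae_infinitePi_forall _ fun _ => hne] with ω hω t ht
  obtain ⟨F, rfl, hF⟩ := hℓ t ht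
  rw [Finset.card_eq_sum_ones]
  exact .branch fun i hi => hω i _ (norm_pos_iff.1 (hF i hi))

lemma isAbsorbing_setOf_hasLargeImages (hA : ∀ i, Measurable (A i)) (hne : Survives P A)
    (t : Fin d → ℝ) : IsAbsorbing (step P A) {ℓ | HasLargeImages 0 k ℓ t} := by
  simpa [survivingStates] using
    isAbsorbing_survivingStates (k := k) hA hne (isCompact_singleton (x := t)).isSigmaCompact

variable {q : ℝ≥0∞}

lemma step_compl_hasLargeImages_succ_le (hA : ∀ i, Measurable (A i)) (hne : Survives P A)
    (hq : ∀ t : Fin d → ℝ, t ≠ 0 → P {ω | HasLargeImages 0 2 (fun j => A j ω) t}ᶜ ≤ q)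
    {t : Fin d → ℝ} {ℓ : St d} (hℓ : HasLargeImages 0 (k + 1) ℓ t) :
    step P A ℓ {ℓ' | HasLargeImages 0 (k + 2) ℓ' t}ᶜ ≤ q := by
  obtain ⟨F, hF, hpos⟩ := hℓ
  obtain ⟨i₀, hi₀⟩ : F.Nonempty := Finset.card_pos.1 (hF ▸ k.succ_pos)
  have hsplit : MeasurableSet {ω | HasLargeImages 0 2 (fun j => A j ω) ((ℓ i₀)ᵀ *ᵥ t)}ᶜ :=
    ((measurableSet_hasLargeImages 0 2 _).preimage (measurable_pi_lambda _ hA)).compl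
  calc step P A ℓ {ℓ' | HasLargeImages 0 (k + 2) ℓ' t}ᶜ
      = Measure.infinitePi (fun _ : ℕ => P)
          {ω | HasLargeImages 0 (k + 2) (branch A (ℓ, ω)) t}ᶜ := by
        rw [step_apply P hA, Measure.map_apply (measurable_branch_right hA ℓ)
          (measurableSet_hasLargeImages _ _ _).compl]
        rfl
    _ ≤ Measure.infinitePi (fun _ : ℕ => P) ((fun ω : ℕ → Ω => ω i₀) ⁻¹'
          {ω | HasLargeImages 0 2 (fun j => A j ω) ((ℓ i₀)ᵀ *ᵥ t)}ᶜ) := by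
        refine measure_mono_ae ?_
        filter_upwards [ae_infinitePi_forall _ fun _ => hne] with ω hω hnot htwo
        have hcard : k + 2 = ∑ i ∈ F, (1 + if i = i₀ then 1 else 0) := by
          simp [Finset.sum_add_distrib, hi₀, hF]
        refine hnot ?_
        rw [Set.mem_ofPred_eq, hcard]
        refine .branch fun i hi => ?_
        rcases eq_or_ne i i₀ with rfl | hne
        · simpa using htwo
        · simpa [hne] using hω i _ (norm_pos_iff.1 (hpos i hi))
    _ = P {ω | HasLargeImages 0 2 (fun j => A j ω) ((ℓ i₀)ᵀ *ᵥ t)}ᶜ :=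
        (measurePreserving_eval_infinitePi (fun _ : ℕ => P) i₀).measure_preimage
          hsplit.nullMeasurableSet
    _ ≤ q := hq _ (norm_pos_iff.1 (hpos i₀ hi₀))

lemma exists_forall_pow_compl_hasLargeImages_le (hA : ∀ i, Measurable (A i))
    (hne : Survives P A) (hq1 : q < 1)
    (hq : ∀ t : Fin d → ℝ, t ≠ 0 → P {ω | HasLargeImages 0 2 (fun j => A j ω) t}ᶜ ≤ q)
    {ε : ℝ≥0∞} (hε : ε ≠ 0) (k : ℕ) :
    ∃ m : ℕ, ∀ n, m ≤ n → ∀ (t : Fin d → ℝ) (ℓ : St d), HasLargeImages 0 1 ℓ t →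
      (step P A ^ n) ℓ {ℓ' | HasLargeImages 0 k ℓ' t}ᶜ ≤ ε := by
  have := isMarkovKernel_step P hA
  obtain ⟨m, hm⟩ := exists_forall_pow_compl_le (κ := step P A) hq1 hε k
  refine ⟨m, fun n hn t ℓ hℓ => ?_⟩
  refine (measure_mono (Set.compl_subset_compl.2 fun ℓ' h => h.mono_card (Nat.le_succ k))).trans
    (hm (fun k => {ℓ | HasLargeImages 0 (k + 1) ℓ t})
      (fun k => isAbsorbing_setOf_hasLargeImages hA hne t)
      (fun k x hx => step_compl_hasLargeImages_succ_le hA hne hq hx) n hn ℓ hℓ)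

/-- Vectors which already have `k` nonzero images keep them, and the other ones form finitely many
subspaces. -/
lemma exists_pow_compl_survivingStates_le_sum (hA : ∀ i, Measurable (A i)) (hne : Survives P A)
    {ℓ : St d} (hℓ : ℓ ∈ finStates d) (k : ℕ) (W : Submodule ℝ (Fin d → ℝ)) :
    ∃ 𝒱 : Finset (Submodule ℝ (Fin d → ℝ)),
      (∀ V ∈ 𝒱, V ≤ W ∧ ∀ t ∈ V, ¬ HasLargeImages 0 k ℓ t) ∧
      ∀ n, (step P A ^ n) ℓ (survivingStates k (W \ {0}))ᶜ
        ≤ ∑ V ∈ 𝒱, (step P A ^ n) ℓ (survivingStates k (V \ {0}))ᶜ := by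
  classical
  obtain ⟨𝒱, h𝒱⟩ := exists_submodules_not_hasLargeImages_iff hℓ k
  refine ⟨𝒱.image (W ⊓ ·), ?_, fun n => ?_⟩
  · simp only [Finset.forall_mem_image]
    exact fun V hV => ⟨inf_le_left, fun t ht => (h𝒱 t).2 ⟨V, hV, ht.2⟩⟩
  refine (measure_mono_ae ?_).trans (measure_biUnion_finset_le _ _)
  filter_upwards [(isAbsorbing_survivingStates hA hne
    (isSigmaCompact_setOf_hasLargeImages 0 k ℓ)).ae_pow_mem n fun t ht => ht] with ℓ' hkeep hℓ'
  obtain ⟨t, ⟨htW, ht0⟩, ht⟩ : ∃ t ∈ (W : Set (Fin d → ℝ)) \ {0}, ¬ HasLargeImages 0 k ℓ' t := by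
    by_contra! h
    exact hℓ' h
  obtain ⟨V, hV, htV⟩ := (h𝒱 t).1 fun h => ht (hkeep t h)
  exact Set.mem_biUnion (Finset.mem_image_of_mem _ hV) fun h => ht (h t ⟨⟨htW, htV⟩, ht0⟩)

/-- Induction on the dimension of `W`: once some `t₀ ∈ W` has `k` nonzero images, the vectors of `W`
with fewer images lie in finitely many proper subspaces. -/
lemma tendsto_pow_compl_survivingStates {N : Ω → ℕ} (hA : IsWeightFamily P N A)
    (hne : Survives P A) (hq1 : q < 1)
    (hq : ∀ t : Fin d → ℝ, t ≠ 0 → P {ω | HasLargeImages 0 2 (fun j => A j ω) t}ᶜ ≤ q) (k : ℕ)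
    (W : Submodule ℝ (Fin d → ℝ)) {ℓ : St d} (hfin : ℓ ∈ finStates d)
    (hℓ : ∀ t : Fin d → ℝ, t ≠ 0 → HasLargeImages 0 1 ℓ t) :
    Tendsto (fun n => (step P A ^ n) ℓ (survivingStates k (W \ {0}))ᶜ) atTop (𝓝 0) := by
  have := isMarkovKernel_step P hA.measurable
  induction hw : Module.finrank ℝ W using Nat.strong_induction_on generalizing W ℓ with
  | _ w ih =>
  rcases eq_or_ne W ⊥ with rfl | hWne
  · simp [survivingStates]
  obtain ⟨t₀, ht₀W, ht₀⟩ := W.exists_mem_ne_zero_of_ne_bot hWne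
  have habs : IsAbsorbing (step P A)
      (finStates d ∩ survivingStates 1 ((⊤ : Submodule ℝ (Fin d → ℝ)) \ {0})) :=
    (isAbsorbing_finStates hA).inter (isAbsorbing_survivingStates hA.measurable hne
      (isSigmaCompact_submodule_diff_zero ⊤))
  have hmem : ℓ ∈ finStates d ∩ survivingStates 1 ((⊤ : Submodule ℝ (Fin d → ℝ)) \ {0}) :=
    ⟨hfin, fun t ht => hℓ t ht.2⟩
  refine habs.tendsto_pow_zero (S := {ℓ | HasLargeImages 0 k ℓ t₀})
    (measurableSet_forall_hasLargeImages 0 k (isSigmaCompact_submodule_diff_zero W)).compl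
    (measurableSet_hasLargeImages 0 k t₀) hmem ?_ ?_
  · refine ENNReal.tendsto_atTop_zero.2 fun ε hε => ?_
    obtain ⟨m, hm⟩ :=
      exists_forall_pow_compl_hasLargeImages_le hA.measurable hne hq1 hq hε.ne' k
    exact ⟨m, fun n hn => hm n hn t₀ ℓ (hℓ t₀ ht₀)⟩
  · intro ℓ' hℓ' ht₀'
    obtain ⟨𝒱, h𝒱, hle⟩ := exists_pow_compl_survivingStates_le_sum hA.measurable hne hℓ'.1 k W
    refine tendsto_of_tendsto_of_tendsto_of_le_of_le tendsto_const_nhds ?_ (fun n => zero_le) hle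
    rw [← Finset.sum_const_zero (M := ℝ≥0∞) (s := 𝒱)]
    refine tendsto_finsetSum 𝒱 fun V hV => ?_
    have hlt : V < W := (h𝒱 V hV).1.lt_of_ne fun h => (h𝒱 V hV).2 t₀ (h ▸ ht₀W) ht₀'
    exact ih _ (hw ▸ Submodule.finrank_lt_finrank_of_lt hlt) V hℓ'.1
      (fun t ht => hℓ'.2 t ⟨Submodule.mem_top, ht⟩) rfl

end Survival

section FourierInversion

open FourierTransform SchwartzMap
open scoped Manifold ContDiff

variable {E : Type*} [NormedAddCommGroup E] [InnerProductSpace ℝ E] [FiniteDimensional ℝ E]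

lemma exists_contDiff_one_of_mem_zero_of_notMem {K U : Set E} (hK : IsCompact K) (hU : IsOpen U)
    (hKU : K ⊆ U) : ∃ f : E → ℝ, ContDiff ℝ ∞ f ∧ HasCompactSupport f ∧
      (∀ x, f x ∈ Set.Icc 0 1) ∧ (∀ x ∈ K, f x = 1) ∧ ∀ x ∉ U, f x = 0 := by
  obtain ⟨R, hR⟩ := hK.isBounded.subset_ball 0
  obtain ⟨f, hsmooth, hrange, hsupp, hone⟩ := exists_contMDiff_support_eq_eq_one_iff (n := ⊤)
    𝓘(ℝ, E) (hU.inter (Metric.isOpen_ball (x := (0 : E)) (ε := R))) hK.isClosed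
    (Set.subset_inter hKU hR)
  refine ⟨f, hsmooth.contDiff, ?_, fun x => hrange ⟨x, rfl⟩, fun x hx => (hone x).1 hx,
    fun x hx => ?_⟩
  · refine .of_support_subset_isCompact (isCompact_closedBall (0 : E) R) ?_
    rw [hsupp]
    exact Set.inter_subset_right.trans Metric.ball_subset_closedBall
  · rw [← Function.notMem_support, hsupp]
    exact fun h => hx h.1

variable [MeasurableSpace E] [BorelSpace E] (η : Measure E) [IsProbabilityMeasure η]

omit [FiniteDimensional ℝ E] [BorelSpace E] [IsProbabilityMeasure η] in
lemma fourierIntegral_one_eq_charFun (v : E) :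
    VectorFourier.fourierIntegral Real.fourierChar η (innerₗ E).flip (fun _ => (1 : ℂ)) v
      = charFun η (-(2 * Real.pi) • v) := by
  have hscale : -(2 * Real.pi)⁻¹ * -(2 * Real.pi) = 1 := by field_simp
  have hflip : (innerₗ E).flip = innerₗ E := by ext x y; simp
  rw [charFun_eq_fourierIntegral', smul_smul, hscale, one_smul, hflip]
  rfl

lemma integral_schwartz_eq_integral_fourierInv_mul_charFun (f : 𝓢(E, ℂ)) :
    ∫ x, f x ∂η = ∫ v, (𝓕⁻ f : 𝓢(E, ℂ)) v * charFun η (-(2 * Real.pi) • v) := by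
  have hswap := VectorFourier.integral_fourierIntegral_smul_eq_flip (μ := volume) (ν := η)
    (e := Real.fourierChar) (L := innerₗ E) (f := (𝓕⁻ f : 𝓢(E, ℂ))) (g := fun _ => (1 : ℂ))
    Real.continuous_fourierChar (by simpa using continuous_inner) (𝓕⁻ f : 𝓢(E, ℂ)).integrable
    (integrable_const _)
  simp only [fourierIntegral_one_eq_charFun, smul_eq_mul, mul_one] at hswap
  have hinv : 𝓕 (𝓕⁻ f : 𝓢(E, ℂ)) = f := fourier_fourierInv_eq f
  rw [← hswap]
  conv_lhs => rw [← hinv]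
  rfl

lemma norm_integral_schwartz_le (h : Integrable (charFun η)) (f : 𝓢(E, ℂ)) :
    ‖∫ x, f x ∂η‖ ≤ (∫ v, ‖charFun η (-(2 * Real.pi) • v)‖) * ∫ x, ‖f x‖ := by
  have hsup (v : E) : ‖(𝓕⁻ f : 𝓢(E, ℂ)) v‖ ≤ ∫ x, ‖f x‖ := by
    rw [SchwartzMap.fourierInv_coe, Real.fourierInv_eq_fourier_neg]
    exact VectorFourier.norm_fourierIntegral_le_integral_norm _ _ _ _ _
  have hint : Integrable fun v : E => ‖charFun η (-(2 * Real.pi) • v)‖ :=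
    (h.comp_smul (neg_ne_zero.2 Real.two_pi_pos.ne')).norm
  calc ‖∫ x, f x ∂η‖ ≤ ∫ v, ‖(𝓕⁻ f : 𝓢(E, ℂ)) v * charFun η (-(2 * Real.pi) • v)‖ := by
        rw [integral_schwartz_eq_integral_fourierInv_mul_charFun]
        exact norm_integral_le_integral_norm _
    _ ≤ ∫ v, ‖charFun η (-(2 * Real.pi) • v)‖ * ∫ x, ‖f x‖ := by
        refine integral_mono_of_nonneg (ae_of_all _ fun _ => norm_nonneg _) (hint.mul_const _)
          (ae_of_all _ fun v => ?_)
        simp only [norm_mul]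
        rw [mul_comm]
        exact mul_le_mul_of_nonneg_left (hsup v) (norm_nonneg _)
    _ = (∫ v, ‖charFun η (-(2 * Real.pi) • v)‖) * ∫ x, ‖f x‖ := integral_mul_const _ _

lemma lintegral_ofReal_le_of_contDiff (h : Integrable (charFun η)) {f : E → ℝ}
    (hsmooth : ContDiff ℝ ∞ f) (hsupp : HasCompactSupport f) (hf : ∀ x, 0 ≤ f x) :
    ∫⁻ x, ENNReal.ofReal (f x) ∂η ≤ ENNReal.ofReal (∫ v, ‖charFun η (-(2 * Real.pi) • v)‖) *
      ∫⁻ x, ENNReal.ofReal (f x) := by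
  let F : 𝓢(E, ℂ) := (hsupp.comp_left (g := ((↑) : ℝ → ℂ)) Complex.ofReal_zero).toSchwartzMap
    (Complex.ofRealCLM.contDiff.comp hsmooth)
  have hbound : ∫ x, f x ∂η ≤ (∫ v, ‖charFun η (-(2 * Real.pi) • v)‖) * ∫ x, f x := by
    have hnorm (x : E) : ‖(f x : ℂ)‖ = f x := by
      rw [Complex.norm_real, Real.norm_of_nonneg (hf x)]
    have := norm_integral_schwartz_le η h F
    change ‖∫ x, (f x : ℂ) ∂η‖ ≤ _ * ∫ x, ‖(f x : ℂ)‖ at this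
    rwa [integral_complex_ofReal, Complex.norm_real, Real.norm_of_nonneg (integral_nonneg hf),
      integral_congr_ae (ae_of_all volume hnorm)] at this
  rw [← ofReal_integral_eq_lintegral_ofReal
      (hsmooth.continuous.integrable_of_hasCompactSupport hsupp) (ae_of_all _ hf),
    ← ofReal_integral_eq_lintegral_ofReal
      (hsmooth.continuous.integrable_of_hasCompactSupport hsupp) (ae_of_all _ hf),
    ← ENNReal.ofReal_mul (integral_nonneg fun _ => norm_nonneg _)]
  exact ENNReal.ofReal_le_ofReal hbound

lemma measure_isCompact_le_mul_volume (h : Integrable (charFun η)) {K U : Set E}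
    (hK : IsCompact K) (hU : IsOpen U) (hKU : K ⊆ U) :
    η K ≤ ENNReal.ofReal (∫ v, ‖charFun η (-(2 * Real.pi) • v)‖) * volume U := by
  obtain ⟨f, hsmooth, hsupp, hf01, hfK, hfU⟩ :=
    exists_contDiff_one_of_mem_zero_of_notMem hK hU hKU
  calc η K ≤ ∫⁻ x, ENNReal.ofReal (f x) ∂η := by
        rw [← lintegral_indicator_one hK.measurableSet]
        exact lintegral_mono <| Set.indicator_le fun x hx => by simp [hfK x hx]
    _ ≤ ENNReal.ofReal (∫ v, ‖charFun η (-(2 * Real.pi) • v)‖) * ∫⁻ x, ENNReal.ofReal (f x) :=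
        lintegral_ofReal_le_of_contDiff η h hsmooth hsupp fun x => (hf01 x).1
    _ ≤ ENNReal.ofReal (∫ v, ‖charFun η (-(2 * Real.pi) • v)‖) * volume U := by
        gcongr
        rw [← lintegral_indicator_one hU.measurableSet]
        refine lintegral_mono fun x => ?_
        by_cases hx : x ∈ U
        · simpa [hx] using (hf01 x).2
        · simp [hx, hfU x hx]

theorem absolutelyContinuous_of_integrable_charFun (h : Integrable (charFun η)) :
    η ≪ volume := by
  refine Measure.AbsolutelyContinuous.mk fun B hB hB0 => ?_
  rw [hB.measure_eq_iSup_isCompact]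
  simp only [ENNReal.iSup_eq_zero]
  intro K hKB hK
  refine le_antisymm (le_of_forall_gt fun ε hε => ?_) zero_le
  set C := ∫ v, ‖charFun η (-(2 * Real.pi) • v)‖
  have hδ : volume K < ε / (ENNReal.ofReal C + 1) := by
    rw [measure_mono_null hKB hB0]
    exact ENNReal.div_pos hε.ne' (by simp)
  obtain ⟨U, hKU, hU, hUvol⟩ := K.exists_isOpen_lt_of_lt _ hδ
  calc η K ≤ ENNReal.ofReal C * volume U := measure_isCompact_le_mul_volume η h hK hU hKU
    _ ≤ (ENNReal.ofReal C + 1) * volume U := by gcongr; exact le_self_add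
    _ < ε := by
        rw [mul_comm]
        exact (ENNReal.lt_div_iff_mul_lt (by simp) (by simp)).1 hUvol

end FourierInversion

lemma charFun_map_toLp {ι : Type*} [Fintype ι] (η : Measure (ι → ℝ)) (t : EuclideanSpace ℝ ι) :
    charFun (η.map (WithLp.toLp 2)) t = cf η (WithLp.ofLp t) := by
  rw [charFun_apply, integral_map (by fun_prop) (by fun_prop), cf]
  refine integral_congr_ae (ae_of_all _ fun x => ?_)
  simp [EuclideanSpace.inner_eq_star_dotProduct]

theorem absolutelyContinuous_of_integrable_cf {ι : Type*} [Fintype ι] (η : Measure (ι → ℝ))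
    [IsProbabilityMeasure η] (h : Integrable (cf η)) : η ≪ volume := by
  have hto := PiLp.volume_preserving_toLp ι
  have hof := PiLp.volume_preserving_ofLp ι
  have : IsProbabilityMeasure (η.map (WithLp.toLp 2)) :=
    Measure.isProbabilityMeasure_map hto.measurable.aemeasurable
  have hint : Integrable (charFun (η.map (WithLp.toLp 2))) := by
    rw [funext (charFun_map_toLp η)]
    exact hof.integrable_comp_of_integrable h
  refine Measure.AbsolutelyContinuous.mk fun B hB hB0 => ?_
  have hnull : η.map (WithLp.toLp 2) (WithLp.ofLp ⁻¹' B) = 0 :=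
    absolutelyContinuous_of_integrable_charFun _ hint
      (by rw [hof.measure_preimage hB.nullMeasurableSet, hB0])
  rwa [Measure.map_apply hto.measurable (hof.measurable hB)] at hnull

section OperatorNorm

variable {d : ℕ}

/-- A matrix as a continuous linear map of `ℝ^d` with the `L¹` norm: `opNorm` is the pullback of
the operator norm under this linear map. -/
def toL1 : Mat d →ₗ[ℝ] (PiLp 1 (fun _ : Fin d => ℝ) →L[ℝ] PiLp 1 (fun _ : Fin d => ℝ)) :=
  (LinearMap.toContinuousLinearMap (𝕜 := ℝ) (E := PiLp 1 (fun _ : Fin d => ℝ))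
    (F' := PiLp 1 (fun _ : Fin d => ℝ))).toLinearMap ∘ₗ (Matrix.toLpLin 1 1).toLinearMap

lemma opNorm_eq_norm_toL1 (a : Mat d) : opNorm a = ‖toL1 a‖ := rfl

lemma opNorm_nonneg (a : Mat d) : 0 ≤ opNorm a := norm_nonneg _

lemma opNorm_zero : opNorm (0 : Mat d) = 0 := by
  rw [opNorm_eq_norm_toL1, map_zero, norm_zero]

@[fun_prop]
lemma continuous_opNorm : Continuous (opNorm (d := d)) :=
  continuous_norm.comp (toL1 (d := d)).continuous_of_finiteDimensional

lemma toL1_mul (a b : Mat d) : toL1 (a * b) = (toL1 a).comp (toL1 b) := by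
  ext x i
  simp [toL1, Matrix.mulVec_mulVec]

lemma opNorm_mul_le (a b : Mat d) : opNorm (a * b) ≤ opNorm a * opNorm b := by
  rw [opNorm_eq_norm_toL1, toL1_mul]
  exact ContinuousLinearMap.opNorm_comp_le _ _

lemma sum_abs_apply_le_opNorm (a : Mat d) (j : Fin d) : ∑ i, |a i j| ≤ opNorm a := by
  have h := (toL1 a).le_opNorm (PiLp.single 1 j (1 : ℝ))
  rw [PiLp.norm_single, norm_one, mul_one] at h
  refine le_trans (le_of_eq ?_) h
  rw [PiLp.norm_eq_of_L1]
  simp [toL1]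

lemma norm_transpose_mulVec_le (a : Mat d) (t : Fin d → ℝ) : ‖aᵀ *ᵥ t‖ ≤ opNorm a * ‖t‖ := by
  refine (pi_norm_le_iff_of_nonneg (mul_nonneg (opNorm_nonneg a) (norm_nonneg t))).2 fun j => ?_
  calc ‖(aᵀ *ᵥ t) j‖ ≤ ∑ i, |a i j| * ‖t‖ := by
        simp only [Matrix.mulVec, dotProduct, Matrix.transpose_apply]
        refine (norm_sum_le _ _).trans (Finset.sum_le_sum fun i _ => ?_)
        rw [norm_mul, Real.norm_eq_abs]
        gcongr
        exact norm_le_pi_norm t i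
    _ ≤ opNorm a * ‖t‖ := by
        rw [← Finset.sum_mul]
        gcongr
        exact sum_abs_apply_le_opNorm a j

lemma measurable_ofReal_opNorm_rpow (s : ℝ) :
    Measurable fun a : Mat d => ENNReal.ofReal (opNorm a ^ s) :=
  (continuous_opNorm.measurable.pow_const s).ennreal_ofReal

lemma ofReal_opNorm_zero_rpow {s : ℝ} (hs : 0 < s) :
    ENNReal.ofReal (opNorm (0 : Mat d) ^ s) = 0 := by
  rw [opNorm_zero, Real.zero_rpow hs.ne', ENNReal.ofReal_zero]

lemma ofReal_opNorm_mul_rpow_le {s : ℝ} (hs : 0 ≤ s) (a b : Mat d) :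
    ENNReal.ofReal (opNorm (a * b) ^ s)
      ≤ ENNReal.ofReal (opNorm a ^ s) * ENNReal.ofReal (opNorm b ^ s) := by
  rw [← ENNReal.ofReal_mul (Real.rpow_nonneg (opNorm_nonneg _) _),
    ← Real.mul_rpow (opNorm_nonneg _) (opNorm_nonneg _)]
  exact ENNReal.ofReal_le_ofReal (Real.rpow_le_rpow (opNorm_nonneg _) (opNorm_mul_le a b) hs)

end OperatorNorm

section RandomProducts

variable {d : ℕ}

lemma measurable_ofFn_reverse_prod (n : ℕ) :
    Measurable fun M : Fin n → Mat d => (List.ofFn M).reverse.prod := by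
  have h := continuous_list_prod (f := fun (i : Fin n) (M : Fin n → Mat d) => M i)
    (List.finRange n).reverse (fun i _ => continuous_apply i)
  refine Continuous.measurable ?_
  simpa [List.ofFn_eq_map, List.map_reverse] using h

variable (μ : Measure (Mat d))

lemma lintegral_pi_succ_reverse_prod [SigmaFinite μ] (n : ℕ) {f : Mat d → ℝ≥0∞}
    (hf : Measurable f) :
    ∫⁻ M : Fin (n + 1) → Mat d, f (List.ofFn M).reverse.prod ∂(Measure.pi fun _ => μ)
      = ∫⁻ M : Fin n → Mat d, ∫⁻ b, f ((List.ofFn M).reverse.prod * b) ∂μ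
          ∂(Measure.pi fun _ => μ) := by
  have hsplit := measurePreserving_piFinSuccAbove (fun _ : Fin (n + 1) => μ) 0
  have hmeas : Measurable fun p : Mat d × (Fin n → Mat d) =>
      f ((List.ofFn p.2).reverse.prod * p.1) :=
    hf.comp (measurable_matrix_mul ((measurable_ofFn_reverse_prod n).comp measurable_snd)
      measurable_fst)
  rw [← lintegral_prod_symm' _ hmeas, ← hsplit.lintegral_comp hmeas]
  refine lintegral_congr fun M => ?_
  rw [List.ofFn_succ, List.reverse_cons, List.prod_append, List.prod_singleton]
  rfl

lemma lintegral_pi_add_reverse_prod [SigmaFinite μ] (m n : ℕ) {f : Mat d → ℝ≥0∞}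
    (hf : Measurable f) :
    ∫⁻ M : Fin (m + n) → Mat d, f (List.ofFn M).reverse.prod ∂(Measure.pi fun _ => μ)
      = ∫⁻ M : Fin m → Mat d, ∫⁻ M' : Fin n → Mat d,
          f ((List.ofFn M).reverse.prod * (List.ofFn M').reverse.prod)
          ∂(Measure.pi fun _ => μ) ∂(Measure.pi fun _ => μ) := by
  induction n generalizing f with
  | zero => simp
  | succ n ih =>
    have hmul : Measurable fun p : Mat d × Mat d => f (p.1 * p.2) :=
      hf.comp (measurable_matrix_mul measurable_fst measurable_snd)
    have hmul_left (a : Mat d) : Measurable fun b => f (a * b) := hmul.comp measurable_prodMk_left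
    rw [← add_assoc, lintegral_pi_succ_reverse_prod μ (m + n) hf,
      ih (f := fun a => ∫⁻ b, f (a * b) ∂μ) hmul.lintegral_prod_right']
    simp only [lintegral_pi_succ_reverse_prod μ n (hmul_left _), mul_assoc]

/-- `E ‖M_n ⋯ M_1‖^s` as an extended nonnegative number; unlike `normMoment` it does not collapse
to `0` when it is infinite. -/
def lnormMoment (s : ℝ) (n : ℕ) : ℝ≥0∞ :=
  ∫⁻ M : Fin n → Mat d, ENNReal.ofReal (opNorm (List.ofFn M).reverse.prod ^ s)
    ∂(Measure.pi fun _ => μ)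

lemma toReal_lnormMoment (s : ℝ) (n : ℕ) : (lnormMoment μ s n).toReal = normMoment μ s n := by
  rw [normMoment, lnormMoment, integral_eq_lintegral_of_nonneg_ae
    (ae_of_all _ fun M => Real.rpow_nonneg (opNorm_nonneg _) s)]
  exact ((continuous_opNorm.measurable.comp
    (measurable_ofFn_reverse_prod n)).pow_const s).aestronglyMeasurable

lemma lnormMoment_one [SigmaFinite μ] (s : ℝ) :
    lnormMoment μ s 1 = ∫⁻ a, ENNReal.ofReal (opNorm a ^ s) ∂μ := by
  have h := lintegral_pi_succ_reverse_prod μ 0 (measurable_ofReal_opNorm_rpow s)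
  simpa [lnormMoment] using h

lemma lnormMoment_add_le [SigmaFinite μ] {s : ℝ} (hs : 0 ≤ s) (m n : ℕ) :
    lnormMoment μ s (m + n) ≤ lnormMoment μ s m * lnormMoment μ s n := by
  have hmeas (n : ℕ) := (measurable_ofReal_opNorm_rpow (d := d) s).comp
    (measurable_ofFn_reverse_prod n)
  calc lnormMoment μ s (m + n)
      = ∫⁻ M : Fin m → Mat d, ∫⁻ M' : Fin n → Mat d,
          ENNReal.ofReal (opNorm ((List.ofFn M).reverse.prod * (List.ofFn M').reverse.prod) ^ s)
          ∂(Measure.pi fun _ => μ) ∂(Measure.pi fun _ => μ) :=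
        lintegral_pi_add_reverse_prod μ m n (measurable_ofReal_opNorm_rpow s)
    _ ≤ ∫⁻ M : Fin m → Mat d, ∫⁻ M' : Fin n → Mat d,
          ENNReal.ofReal (opNorm (List.ofFn M).reverse.prod ^ s) *
            ENNReal.ofReal (opNorm (List.ofFn M').reverse.prod ^ s)
          ∂(Measure.pi fun _ => μ) ∂(Measure.pi fun _ => μ) :=
        lintegral_mono fun _ => lintegral_mono fun _ => ofReal_opNorm_mul_rpow_le hs _ _
    _ = lnormMoment μ s m * lnormMoment μ s n :=
        lintegral_lintegral_mul (hmeas m).aemeasurable (hmeas n).aemeasurable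

lemma lnormMoment_lt_top [IsProbabilityMeasure μ] {s : ℝ} (hs : s ∈ momentSet μ) (n : ℕ) :
    lnormMoment μ s n < ⊤ := by
  induction n with
  | zero => simp [lnormMoment]
  | succ n ih =>
    refine (lnormMoment_add_le μ hs.1 n 1).trans_lt (ENNReal.mul_lt_top ih ?_)
    rw [lnormMoment_one]
    exact hs.2

end RandomProducts

section GrowthRate

variable {x : ℕ → ℝ} {b : ℝ}

lemma pow_le_of_submultiplicative (hb : 0 < b) (hsub : ∀ m n, x (m + n) ≤ x m * x n)
    (hx : ∀ n, 1 ≤ n → b ^ n ≤ x n) (n : ℕ) : b ^ n ≤ x n := by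
  rcases n.eq_zero_or_pos with rfl | hn
  · have hx1 : 0 < x 1 := (pow_pos hb 1).trans_le (hx 1 le_rfl)
    have h : 1 * x 1 ≤ x 0 * x 1 := by simpa using hsub 0 1
    simpa using le_of_mul_le_mul_right h hx1
  · exact hx n hn

lemma exists_tendsto_rpow_inv_of_submultiplicative (hb : 0 < b)
    (hsub : ∀ m n, x (m + n) ≤ x m * x n) (hx : ∀ n, b ^ n ≤ x n) :
    ∃ L, b ≤ L ∧ Tendsto (fun n : ℕ => x n ^ (1 / (n : ℝ))) atTop (𝓝 L) := by
  have hpos (n : ℕ) : 0 < x n := (pow_pos hb n).trans_le (hx n)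
  have hlog : Subadditive fun n => Real.log (x n) := fun m n => by
    rw [← Real.log_mul (hpos m).ne' (hpos n).ne']
    exact Real.log_le_log (hpos _) (hsub m n)
  have hlow (n : ℕ) (hn : 1 ≤ n) : Real.log b ≤ Real.log (x n) / n := by
    rw [le_div_iff₀ (by exact_mod_cast hn), mul_comm, ← Real.log_pow]
    exact Real.log_le_log (pow_pos hb n) (hx n)
  have hbdd : BddBelow (Set.range fun n : ℕ => Real.log (x n) / n) := by
    refine ⟨min (Real.log b) 0, Set.forall_mem_range.2 fun n => ?_⟩
    rcases n.eq_zero_or_pos with rfl | hn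
    · simp
    · exact (min_le_left _ _).trans (hlow n hn)
  have hlim := hlog.tendsto_lim hbdd
  refine ⟨Real.exp hlog.lim, ?_, ((Real.continuous_exp.tendsto _).comp hlim).congr fun n => ?_⟩
  · rw [← Real.exp_log hb]
    exact Real.exp_le_exp.2 (ge_of_tendsto hlim (eventually_atTop.2 ⟨1, hlow⟩))
  · rw [Real.rpow_def_of_pos (hpos n), mul_one_div]
    rfl

lemma exists_pow_mul_lnormMoment_lt_one {d : ℕ} (μ : Measure (Mat d)) [IsProbabilityMeasure μ]
    {c : ℝ≥0∞} (hc0 : c ≠ 0) (hctop : c ≠ ⊤) {s : ℝ} (hs : s ∈ momentSet μ)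
    (hlt : c.toReal * kappa μ s < 1) : ∃ n, 1 ≤ n ∧ c ^ n * lnormMoment μ s n < 1 := by
  by_contra! hge
  have hc : 0 < c.toReal := ENNReal.toReal_pos hc0 hctop
  have htop := lnormMoment_lt_top μ hs
  have hsub (m n : ℕ) : normMoment μ s (m + n) ≤ normMoment μ s m * normMoment μ s n := by
    simp only [← toReal_lnormMoment, ← ENNReal.toReal_mul]
    exact ENNReal.toReal_mono (ENNReal.mul_lt_top (htop m) (htop n)).ne
      (lnormMoment_add_le μ hs.1 m n)
  have hlow (n : ℕ) (hn : 1 ≤ n) : (c.toReal)⁻¹ ^ n ≤ normMoment μ s n := by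
    have h := ENNReal.toReal_mono
      (ENNReal.mul_lt_top (ENNReal.pow_lt_top hctop.lt_top) (htop n)).ne (hge n hn)
    rw [ENNReal.toReal_one, ENNReal.toReal_mul, ENNReal.toReal_pow, toReal_lnormMoment] at h
    rwa [inv_pow, inv_le_iff_one_le_mul₀' (pow_pos hc n)]
  obtain ⟨L, hL, hlim⟩ := exists_tendsto_rpow_inv_of_submultiplicative (inv_pos.2 hc) hsub
    (pow_le_of_submultiplicative (inv_pos.2 hc) hsub hlow)
  rw [kappa, hlim.limUnder_eq] at hlt
  exact hlt.not_ge ((inv_le_iff_one_le_mul₀' hc).1 hL)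

end GrowthRate

section Moments

variable {d : ℕ} {Ω : Type*} [MeasurableSpace Ω] {P : Measure Ω} {N : Ω → ℕ}
  {A : ℕ → Ω → Mat d}

lemma meanN_eq_tsum (hN : Measurable N) : meanN P N = ∑' i : ℕ, P {ω | i < N ω} := by
  have hcount (ω : Ω) : (N ω : ℝ≥0∞) = ∑' i : ℕ, {ω | i < N ω}.indicator 1 ω := by
    have hout (i : ℕ) (hi : i ∉ Finset.range (N ω)) :
        {ω | i < N ω}.indicator (1 : Ω → ℝ≥0∞) ω = 0 :=
      Set.indicator_of_notMem (by simpa using hi) _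
    have hin (i : ℕ) (hi : i ∈ Finset.range (N ω)) :
        {ω | i < N ω}.indicator (1 : Ω → ℝ≥0∞) ω = 1 :=
      Set.indicator_of_mem (by simpa using hi) _
    rw [tsum_eq_sum hout, Finset.sum_congr rfl hin]
    simp
  have hmeas (i : ℕ) : AEMeasurable ({ω | i < N ω}.indicator (1 : Ω → ℝ≥0∞)) P :=
    (measurable_one.indicator (hN measurableSet_Ioi)).aemeasurable
  rw [meanN, lintegral_congr hcount, lintegral_tsum hmeas]
  exact tsum_congr fun i => lintegral_indicator_one (hN measurableSet_Ioi)

lemma isProbabilityMeasure_mu (hN : Measurable N) (hA : ∀ i, Measurable (A i))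
    (h0 : meanN P N ≠ 0) (htop : meanN P N ≠ ⊤) : IsProbabilityMeasure (mu P N A) := by
  refine ⟨?_⟩
  rw [mu, Measure.smul_apply, Measure.sum_apply _ .univ]
  simp only [Measure.map_apply (hA _) .univ, Set.preimage_univ, Measure.restrict_apply_univ]
  rw [← meanN_eq_tsum hN, smul_eq_mul]
  exact ENNReal.inv_mul_cancel h0 htop

lemma tsum_lintegral_eq_meanN_mul (hA : IsWeightFamily P N A) (h0 : meanN P N ≠ 0)
    (htop : meanN P N ≠ ⊤) {f : Mat d → ℝ≥0∞} (hf : Measurable f) (hf0 : f 0 = 0) :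
    ∑' j, ∫⁻ ω, f (A j ω) ∂P = meanN P N * ∫⁻ a, f a ∂(mu P N A) := by
  rw [mu, lintegral_smul_measure, lintegral_sum_measure, smul_eq_mul, ← mul_assoc,
    ENNReal.mul_inv_cancel h0 htop, one_mul]
  refine tsum_congr fun j => ?_
  have hmeas : MeasurableSet {ω | j < N ω} := hA.measurable_card measurableSet_Ioi
  rw [lintegral_map hf (hA.measurable j), ← lintegral_indicator hmeas]
  refine lintegral_congr_ae ?_
  filter_upwards [hA.ae_eq_zero] with ω hω
  by_cases h : j < N ω
  · rw [Set.indicator_of_mem (by exact h)]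
  · rw [Set.indicator_of_notMem (by exact h), hω j (not_lt.1 h), hf0]

variable [IsProbabilityMeasure P]

lemma lintegral_tsum_step (hA : IsWeightFamily P N A) (h0 : meanN P N ≠ 0)
    (htop : meanN P N ≠ ⊤) {f : Mat d → ℝ≥0∞} (hf : Measurable f) (hf0 : f 0 = 0) (ℓ : St d) :
    ∫⁻ ℓ', ∑' k, f (ℓ' k) ∂(step P A ℓ)
      = ∑' k, meanN P N * ∫⁻ b, f (ℓ k * b) ∂(mu P N A) := by
  have hmul (a : Mat d) : Measurable fun b => f (a * b) :=
    hf.comp (measurable_matrix_mul measurable_const measurable_id)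
  have hbranch := measurable_branch_right hA.measurable ℓ
  have heval (k : ℕ) :
      ∫⁻ ω : ℕ → Ω, f (branch A (ℓ, ω) k) ∂(Measure.infinitePi fun _ : ℕ => P)
        = ∫⁻ ω, f (ℓ k.unpair.1 * A k.unpair.2 ω) ∂P :=
    (measurePreserving_eval_infinitePi (fun _ : ℕ => P) k.unpair.1).lintegral_comp
      ((hmul (ℓ k.unpair.1)).comp (hA.measurable k.unpair.2))
  calc ∫⁻ ℓ', ∑' k, f (ℓ' k) ∂(step P A ℓ)
      = ∑' k : ℕ, ∫⁻ ω, f (ℓ k.unpair.1 * A k.unpair.2 ω) ∂P := by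
        have hmeas (k : ℕ) : AEMeasurable (fun ω : ℕ → Ω => f (branch A (ℓ, ω) k))
            (Measure.infinitePi fun _ : ℕ => P) :=
          (hf.comp ((measurable_pi_apply k).comp hbranch)).aemeasurable
        rw [step_apply P hA.measurable, lintegral_map (by fun_prop) hbranch, lintegral_tsum hmeas]
        exact tsum_congr heval
    _ = ∑' i, ∑' j, ∫⁻ ω, f (ℓ i * A j ω) ∂P := by
        rw [← Nat.pairEquiv.tsum_eq, ← ENNReal.tsum_prod]
        simp only [Nat.pairEquiv_apply, Function.uncurry, Nat.unpair_pair]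
    _ = ∑' k, meanN P N * ∫⁻ b, f (ℓ k * b) ∂(mu P N A) := tsum_congr fun i =>
        tsum_lintegral_eq_meanN_mul hA h0 htop (hmul (ℓ i)) (by simpa using hf0)

lemma lintegral_tsum_step_pow (hA : IsWeightFamily P N A) (h0 : meanN P N ≠ 0)
    (htop : meanN P N ≠ ⊤) (n : ℕ) {f : Mat d → ℝ≥0∞} (hf : Measurable f) (hf0 : f 0 = 0)
    (ℓ : St d) :
    ∫⁻ ℓ', ∑' k, f (ℓ' k) ∂((step P A ^ n) ℓ)
      = ∑' k, meanN P N ^ n * ∫⁻ M : Fin n → Mat d, f (ℓ k * (List.ofFn M).reverse.prod)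
          ∂(Measure.pi fun _ => mu P N A) := by
  have := isProbabilityMeasure_mu hA.measurable_card hA.measurable h0 htop
  have := isMarkovKernel_step P hA.measurable
  induction n generalizing f with
  | zero =>
    have hmeas : Measurable fun ℓ' : St d => ∑' k, f (ℓ' k) := by fun_prop
    rw [kernel_pow_zero_apply, lintegral_dirac' _ hmeas]
    simp
  | succ n ih =>
    have hmeas : Measurable fun ℓ' : St d => ∑' k, f (ℓ' k) := by fun_prop
    have hmul : Measurable fun p : Mat d × Mat d => f (p.1 * p.2) :=
      hf.comp (measurable_matrix_mul measurable_fst measurable_snd)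
    have hmul_left (a : Mat d) : Measurable fun b => f (a * b) := hmul.comp measurable_prodMk_left
    have hmul_prod (a : Mat d) : Measurable fun M : Fin n → Mat d =>
        ∫⁻ b, f (a * (List.ofFn M).reverse.prod * b) ∂(mu P N A) :=
      hmul.lintegral_prod_right'.comp
        (measurable_matrix_mul measurable_const (measurable_ofFn_reverse_prod n))
    rw [kernel_pow_succ_apply, Measure.lintegral_bind (Kernel.aemeasurable _) hmeas.aemeasurable,
      lintegral_congr fun ℓ' => lintegral_tsum_step hA h0 htop hf hf0 ℓ',
      ih (hmul.lintegral_prod_right'.const_mul _) (by simp [hf0])]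
    refine tsum_congr fun k => ?_
    rw [lintegral_pi_succ_reverse_prod (mu P N A) n (hmul_left _),
      lintegral_const_mul _ (hmul_prod _), pow_succ]
    simp only [mul_assoc]

/-- The sum of the `s`-th powers of the norms of the weights of a generation. -/
def weightMoment (s : ℝ) (ℓ : St d) : ℝ≥0∞ := ∑' k, ENNReal.ofReal (opNorm (ℓ k) ^ s)

lemma measurable_weightMoment (s : ℝ) : Measurable (weightMoment (d := d) s) :=
  Measurable.tsum fun k => (measurable_ofReal_opNorm_rpow s).comp (measurable_pi_apply k)

lemma weightMoment_root_lt_top {s : ℝ} (hs : 0 < s) : weightMoment s (root d) < ⊤ := by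
  rw [weightMoment, tsum_eq_single 0 fun k hk => ?_]
  · exact ENNReal.ofReal_lt_top
  · rw [root_eq_zero hk, ofReal_opNorm_zero_rpow hs]

lemma lintegral_weightMoment_step_pow_le (hA : IsWeightFamily P N A) (h0 : meanN P N ≠ 0)
    (htop : meanN P N ≠ ⊤) (n : ℕ) {s : ℝ} (hs : 0 < s) (ℓ : St d) :
    ∫⁻ ℓ', weightMoment s ℓ' ∂((step P A ^ n) ℓ)
      ≤ meanN P N ^ n * lnormMoment (mu P N A) s n * weightMoment s ℓ := by
  unfold weightMoment
  rw [lintegral_tsum_step_pow hA h0 htop n (measurable_ofReal_opNorm_rpow s)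
    (ofReal_opNorm_zero_rpow hs), ← ENNReal.tsum_mul_left]
  refine ENNReal.tsum_le_tsum fun k => ?_
  have hmeas : Measurable fun M : Fin n → Mat d =>
      ENNReal.ofReal (opNorm (List.ofFn M).reverse.prod ^ s) :=
    (measurable_ofReal_opNorm_rpow s).comp (measurable_ofFn_reverse_prod n)
  rw [mul_assoc, mul_comm (lnormMoment _ _ _), lnormMoment, ← lintegral_const_mul _ hmeas]
  gcongr
  exact ofReal_opNorm_mul_rpow_le hs.le _ _

lemma lintegral_weightMoment_step_pow_mul_le (hA : IsWeightFamily P N A) (h0 : meanN P N ≠ 0)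
    (htop : meanN P N ≠ ⊤) (n j : ℕ) {s : ℝ} (hs : 0 < s) (ℓ : St d) :
    ∫⁻ ℓ', weightMoment s ℓ' ∂((step P A ^ (n * j)) ℓ)
      ≤ (meanN P N ^ n * lnormMoment (mu P N A) s n) ^ j * weightMoment s ℓ := by
  set c := meanN P N ^ n * lnormMoment (mu P N A) s n
  induction j with
  | zero =>
    rw [mul_zero, kernel_pow_zero_apply, lintegral_dirac' _ (measurable_weightMoment s), pow_zero,
      one_mul]
  | succ j ih =>
    have hsplit : (step P A ^ (n * (j + 1))) ℓ
        = ((step P A ^ (n * j)) ℓ).bind (step P A ^ n) := by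
      rw [mul_add, mul_one, add_comm, Kernel.pow_add, Kernel.comp_apply]
    calc ∫⁻ ℓ', weightMoment s ℓ' ∂((step P A ^ (n * (j + 1))) ℓ)
        = ∫⁻ ℓ', ∫⁻ ℓ'', weightMoment s ℓ'' ∂((step P A ^ n) ℓ') ∂((step P A ^ (n * j)) ℓ) := by
          rw [hsplit, Measure.lintegral_bind (Kernel.aemeasurable _)
            (measurable_weightMoment s).aemeasurable]
      _ ≤ ∫⁻ ℓ', c * weightMoment s ℓ' ∂((step P A ^ (n * j)) ℓ) :=
          lintegral_mono fun ℓ' => lintegral_weightMoment_step_pow_le hA h0 htop n hs ℓ'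
      _ ≤ c * (c ^ j * weightMoment s ℓ) := by
          rw [lintegral_const_mul _ (measurable_weightMoment s)]
          gcongr
      _ = c ^ (j + 1) * weightMoment s ℓ := by rw [pow_succ', ← mul_assoc]

lemma measure_exists_lt_opNorm_le (Q : Measure (St d)) {s ε : ℝ} (hs : 0 ≤ s) (hε : 0 < ε) :
    Q {ℓ | ∃ k, ε < opNorm (ℓ k)} ≤ (∫⁻ ℓ, weightMoment s ℓ ∂Q) / ENNReal.ofReal (ε ^ s) := by
  refine (measure_mono ?_).trans (meas_ge_le_lintegral_div
    (measurable_weightMoment s).aemeasurable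
    (ENNReal.ofReal_pos.2 (Real.rpow_pos_of_pos hε s)).ne' ENNReal.ofReal_ne_top)
  rintro ℓ ⟨k, hk⟩
  exact (ENNReal.ofReal_le_ofReal (Real.rpow_le_rpow hε.le hk.le hs)).trans (ENNReal.le_tsum k)

/-- Arbitrarily late generations exist whose weights are, with probability as close to one as
desired, all as small as desired. -/
def HasSmallGenerations (P : Measure Ω) (A : ℕ → Ω → Mat d) : Prop :=
  ∀ m : ℕ, ∀ ε : ℝ, 0 < ε → ∀ δ : ℝ≥0∞, δ ≠ 0 →
    ∃ n, m ≤ n ∧ (step P A ^ n) (root d) {ℓ | ∃ k, ε < opNorm (ℓ k)} ≤ δ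

lemma hasSmallGenerations_of_mFun_lt_one (hA : IsWeightFamily P N A) (h0 : meanN P N ≠ 0)
    (htop : meanN P N ≠ ⊤) {s : ℝ} (hs : 0 < s) (hmem : s ∈ momentSet (mu P N A))
    (hlt : mFun P N A s < 1) : HasSmallGenerations P A := by
  intro m ε hε δ hδ
  have := isProbabilityMeasure_mu hA.measurable_card hA.measurable h0 htop
  obtain ⟨n, hn, hc⟩ := exists_pow_mul_lnormMoment_lt_one _ h0 htop hmem hlt
  set c := meanN P N ^ n * lnormMoment (mu P N A) s n
  have hεs : ENNReal.ofReal (ε ^ s) ≠ 0 := (ENNReal.ofReal_pos.2 (Real.rpow_pos_of_pos hε s)).ne'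
  have hlim : Tendsto (fun j => c ^ j * weightMoment s (root d) / ENNReal.ofReal (ε ^ s)) atTop
      (𝓝 0) := by
    have h := ENNReal.Tendsto.mul_const (b := weightMoment s (root d) / ENNReal.ofReal (ε ^ s))
      (ENNReal.tendsto_pow_atTop_nhds_zero_of_lt_one hc)
      (Or.inr (ENNReal.div_ne_top (weightMoment_root_lt_top hs).ne hεs))
    rw [zero_mul] at h
    simpa only [mul_div_assoc] using h
  obtain ⟨j, hj, hmj⟩ :=
    ((hlim.eventually_lt_const (pos_iff_ne_zero.2 hδ)).and (eventually_ge_atTop m)).exists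
  refine ⟨n * j, hmj.trans (Nat.le_mul_of_pos_left j hn), ?_⟩
  refine (measure_exists_lt_opNorm_le _ hs.le hε).trans (le_trans ?_ hj.le)
  gcongr
  exact lintegral_weightMoment_step_pow_mul_le hA h0 htop n j hs _

end Moments

lemma CondAlpha.exists_mFun_lt_one {d : ℕ} {Ω : Type*} [MeasurableSpace Ω] {P : Measure Ω}
    {N : Ω → ℕ} {A : ℕ → Ω → Mat d} (h : CondAlpha P N A) :
    ∃ s, 0 < s ∧ s ∈ momentSet (mu P N A) ∧ mFun P N A s < 1 := by
  obtain ⟨α, hα, -, hint, hm, m', hderiv, hm'⟩ := h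
  have hslope : ∀ᶠ s in 𝓝[>] α, slope (mFun P N A) α s < 0 :=
    ((hasDerivAt_iff_tendsto_slope.1 hderiv).eventually_lt_const hm').filter_mono
      (nhdsWithin_mono _ fun x hx => ne_of_gt hx)
  have hmem : ∀ᶠ s in 𝓝[>] α, s ∈ momentSet (mu P N A) :=
    nhdsWithin_le_nhds (mem_interior_iff_mem_nhds.1 hint)
  obtain ⟨s, hslope, hmem, hαs⟩ := (hslope.and (hmem.and self_mem_nhdsWithin)).exists
  have hαs : α < s := hαs
  refine ⟨s, hα.trans hαs, hmem, ?_⟩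
  rw [slope_def_field, hm] at hslope
  linarith [(div_lt_iff₀ (sub_pos.2 hαs)).1 hslope]

section DegenerateDirections

variable {ι : Type*} [Fintype ι] {η : Measure (ι → ℝ)}

lemma ae_exp_eq_cf [IsProbabilityMeasure η] {t : ι → ℝ} (ht : ‖cf η t‖ = 1) :
    ∀ᵐ x ∂η, Complex.exp ((t ⬝ᵥ x : ℝ) * Complex.I) = cf η t := by
  have hle : ∀ᵐ x ∂η, ‖Complex.exp ((t ⬝ᵥ x : ℝ) * Complex.I)‖ ≤ 1 :=
    ae_of_all _ fun x => (Complex.norm_exp_ofReal_mul_I _).le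
  -- equality case of `‖∫ f‖ ≤ 1` for a function with values in the strictly convex unit disc
  rcases ae_eq_const_or_norm_integral_lt_of_norm_le_const hle with h | h
  · rwa [average_eq_integral] at h
  · rw [probReal_univ, one_mul] at h
    exact absurd ht h.ne

lemma ae_exists_dotProduct_sub_eq [IsProbabilityMeasure η] {t : ι → ℝ} (ht : ‖cf η t‖ = 1) :
    ∀ᵐ p ∂(η.prod η), ∃ m : ℤ, t ⬝ᵥ p.1 - t ⬝ᵥ p.2 = m * (2 * Real.pi) := by
  have h := ae_exp_eq_cf ht
  filter_upwards [Measure.quasiMeasurePreserving_fst.ae h, Measure.quasiMeasurePreserving_snd.ae h]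
    with p h1 h2
  rw [← h2, Complex.exp_eq_exp_iff_exists_int] at h1
  obtain ⟨m, hm⟩ := h1
  refine ⟨m, ?_⟩
  have him := congrArg Complex.im hm
  simp only [Complex.ofReal_re, Complex.add_im, Complex.mul_im, Complex.intCast_re,
    Complex.intCast_im, Complex.mul_re, Complex.re_ofNat, Complex.im_ofNat, Complex.ofReal_im,
    Complex.I_im, zero_mul, mul_zero, sub_zero, add_zero, mul_one, Complex.I_re] at him
  linarith

lemma ae_eventually_dotProduct_eq [IsProbabilityMeasure η] {s : ℕ → ι → ℝ}
    (hs : ∀ n, ‖cf η (s n)‖ = 1) (hs0 : Tendsto s atTop (𝓝 0)) :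
    ∀ᵐ p ∂(η.prod η), ∀ᶠ n in atTop, s n ⬝ᵥ p.1 = s n ⬝ᵥ p.2 := by
  filter_upwards [ae_all_iff.2 fun n => ae_exists_dotProduct_sub_eq (hs n)] with p hp
  have hc : Continuous fun t : ι → ℝ => |t ⬝ᵥ p.1 - t ⬝ᵥ p.2| := by
    unfold dotProduct; fun_prop
  have hlim : Tendsto (fun n => |s n ⬝ᵥ p.1 - s n ⬝ᵥ p.2|) atTop (𝓝 0) := by
    simpa [Function.comp_def] using (hc.tendsto 0).comp hs0
  filter_upwards [hlim.eventually_lt_const Real.two_pi_pos] with n hn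
  obtain ⟨m, hm⟩ := hp n
  rw [hm, abs_mul, abs_of_pos Real.two_pi_pos, mul_lt_iff_lt_one_left Real.two_pi_pos] at hn
  have hm0 : m = 0 := Int.abs_lt_one_iff.1 (by exact_mod_cast hn)
  rw [hm0, Int.cast_zero, zero_mul] at hm
  exact sub_eq_zero.1 hm

/-- The directions `t` in which `η` is degenerate: `t · x` is the same constant for `η`-almost all
`x`. This is expressed through two independent copies, so that the constant need not be named. -/
def degenerateDirections (η : Measure (ι → ℝ)) : Submodule ℝ (ι → ℝ) where
  carrier := {t | ∀ᵐ p ∂(η.prod η), t ⬝ᵥ p.1 = t ⬝ᵥ p.2}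
  add_mem' := fun {s t} hs ht => by
    change ∀ᵐ p ∂(η.prod η), (s + t) ⬝ᵥ p.1 = (s + t) ⬝ᵥ p.2
    filter_upwards [hs, ht] with p h1 h2
    rw [add_dotProduct, add_dotProduct, h1, h2]
  zero_mem' := ae_of_all _ fun p => by rw [zero_dotProduct, zero_dotProduct]
  smul_mem' := fun c t ht => by
    change ∀ᵐ p ∂(η.prod η), (c • t) ⬝ᵥ p.1 = (c • t) ⬝ᵥ p.2
    filter_upwards [ht] with p h
    rw [smul_dotProduct, smul_dotProduct, h]

lemma mem_degenerateDirections {t : ι → ℝ} :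
    t ∈ degenerateDirections η ↔ ∀ᵐ p ∂(η.prod η), t ⬝ᵥ p.1 = t ⬝ᵥ p.2 := Iff.rfl

lemma ae_forall_mem_degenerateDirections :
    ∀ᵐ p ∂(η.prod η), ∀ t ∈ degenerateDirections η, t ⬝ᵥ p.1 = t ⬝ᵥ p.2 := by
  set b := Module.finBasis ℝ (degenerateDirections η)
  filter_upwards [ae_all_iff.2 fun i => mem_degenerateDirections.1 (b i).2] with p hp t ht
  have hrep : ((∑ i, b.repr ⟨t, ht⟩ i • b i : degenerateDirections η) : ι → ℝ) = t :=
    congrArg Subtype.val (b.sum_repr ⟨t, ht⟩)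
  rw [← hrep]
  simp only [Submodule.coe_sum, Submodule.coe_smul, sum_dotProduct, smul_dotProduct, hp]

variable [IsProbabilityMeasure η]

lemma norm_cf_eq_one_of_mem_degenerateDirections {t : ι → ℝ} (ht : t ∈ degenerateDirections η) :
    ‖cf η t‖ = 1 := by
  obtain ⟨y, hy⟩ := (Measure.ae_ae_of_ae_prod (mem_degenerateDirections.1 ht)).exists
  have hcf : cf η t = ∫ _, Complex.exp ((t ⬝ᵥ y : ℝ) * Complex.I) ∂η :=
    integral_congr_ae (hy.mono fun x hx => by simp only [hx])
  rw [hcf, integral_const, probReal_univ, one_smul, Complex.norm_exp_ofReal_mul_I]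

lemma mem_degenerateDirections_of_forall_smul {t : ι → ℝ}
    (ht : ∀ n : ℕ, ‖cf η ((1 / ((n : ℝ) + 1)) • t)‖ = 1) : t ∈ degenerateDirections η := by
  have h0 : Tendsto (fun n : ℕ => (1 / ((n : ℝ) + 1)) • t) atTop (𝓝 0) := by
    simpa using (tendsto_one_div_add_atTop_nhds_zero_nat (𝕜 := ℝ)).smul_const t
  refine mem_degenerateDirections.2 ?_
  filter_upwards [ae_eventually_dotProduct_eq ht h0] with p hp
  obtain ⟨n, hn⟩ := hp.exists
  rw [smul_dotProduct, smul_dotProduct] at hn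
  exact smul_right_injective ℝ (Nat.one_div_pos_of_nat (α := ℝ) (n := n)).ne' hn

lemma transpose_mulVec_mem_degenerateDirections {a : Matrix ι ι ℝ} {t : ι → ℝ}
    (ha : ∀ t, ‖cf η t‖ = 1 → ‖cf η (aᵀ *ᵥ t)‖ = 1) (ht : t ∈ degenerateDirections η) :
    aᵀ *ᵥ t ∈ degenerateDirections η := by
  refine mem_degenerateDirections_of_forall_smul fun n => ?_
  rw [← Matrix.mulVec_smul]
  exact ha _ (norm_cf_eq_one_of_mem_degenerateDirections (Submodule.smul_mem _ _ ht))

lemma degenerateDirections_ne_bot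
    (h : ∀ δ : ℝ, 0 < δ → ∃ s, s ≠ 0 ∧ ‖s‖ ≤ δ ∧ ‖cf η s‖ = 1) :
    degenerateDirections η ≠ ⊥ := by
  choose s hs0 hsle hs1 using fun n : ℕ => h (1 / ((n : ℝ) + 1)) (by positivity)
  have hlim : Tendsto s atTop (𝓝 0) :=
    squeeze_zero_norm hsle tendsto_one_div_add_atTop_nhds_zero_nat
  have hsphere : ∀ n, ‖s n‖⁻¹ • s n ∈ Metric.sphere (0 : ι → ℝ) 1 := fun n => by
    rw [mem_sphere_zero_iff_norm, norm_smul, norm_inv, norm_norm,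
      inv_mul_cancel₀ (norm_ne_zero_iff.2 (hs0 n))]
  obtain ⟨u, hu, φ, hφ, hφu⟩ := (isCompact_sphere (0 : ι → ℝ) 1).tendsto_subseq hsphere
  refine (Submodule.ne_bot_iff _).2 ⟨u, mem_degenerateDirections.2 ?_, ?_⟩
  · filter_upwards [ae_eventually_dotProduct_eq hs1 hlim] with p hp
    have hc : ∀ x : ι → ℝ, Continuous fun t : ι → ℝ => t ⬝ᵥ x := fun x =>
      continuous_id.dotProduct continuous_const
    refine tendsto_nhds_unique_of_eventuallyEq (((hc p.1).tendsto u).comp hφu)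
      (((hc p.2).tendsto u).comp hφu) ?_
    filter_upwards [hφ.tendsto_atTop.eventually hp] with n hn
    simp only [Function.comp_apply, smul_dotProduct, hn]
  · rintro rfl
    simp at hu

end DegenerateDirections

section Positivity

variable {ι : Type*} [Fintype ι]

lemma transpose_mulVec_dotProduct (a : Matrix ι ι ℝ) (w x : ι → ℝ) :
    (aᵀ *ᵥ w) ⬝ᵥ x = w ⬝ᵥ (a *ᵥ x) := by
  rw [Matrix.mulVec_transpose, Matrix.dotProduct_mulVec]

lemma mulVec_nonneg {a : Matrix ι ι ℝ} (ha : ∀ i j, 0 ≤ a i j) {y : ι → ℝ} (hy : 0 ≤ y) :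
    0 ≤ a *ᵥ y :=
  fun i => dotProduct_nonneg_of_nonneg (ha i) hy

/-- The total negative mass of a vector, which strictly positive stochastic matrices contract. -/
def negMass (y : ι → ℝ) : ℝ := ∑ i, (y i)⁻

lemma sum_vecMul {p : Matrix ι ι ℝ} (hrow : ∀ i, ∑ j, p i j = 1) (y : ι → ℝ) :
    ∑ j, (y ᵥ* p) j = ∑ i, y i := by
  simp only [Matrix.vecMul, dotProduct]
  rw [Finset.sum_comm]
  exact Finset.sum_congr rfl fun i _ => by rw [← Finset.mul_sum, hrow, mul_one]

lemma negMass_vecMul_le {p : Matrix ι ι ℝ} {δ : ℝ} (hδ : 0 ≤ δ) (hp : ∀ i j, δ ≤ p i j)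
    (hrow : ∀ i, ∑ j, p i j = 1) {y : ι → ℝ} (hy : 0 ≤ ∑ i, y i) :
    negMass (y ᵥ* p) ≤ (1 - Fintype.card ι * δ) * negMass y := by
  have hcoord : ∀ j, ((y ᵥ* p) j)⁻ ≤ ∑ i, (y i)⁻ * (p i j - δ) := by
    intro j
    have hsplit : -(y ᵥ* p) j = ∑ i, -y i * (p i j - δ) - δ * ∑ i, y i := by
      simp only [Matrix.vecMul, dotProduct, mul_sub, Finset.sum_sub_distrib, neg_mul,
        Finset.sum_neg_distrib, Finset.sum_mul, mul_comm δ]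
      ring
    have hneg : ∑ i, -y i * (p i j - δ) ≤ ∑ i, (y i)⁻ * (p i j - δ) :=
      Finset.sum_le_sum fun i _ =>
        mul_le_mul_of_nonneg_right (neg_le_negPart _) (sub_nonneg.2 (hp i j))
    have hmass : 0 ≤ δ * ∑ i, y i := mul_nonneg hδ hy
    exact max_le (by linarith) (Finset.sum_nonneg fun i _ =>
      mul_nonneg (negPart_nonneg _) (sub_nonneg.2 (hp i j)))
  calc negMass (y ᵥ* p) ≤ ∑ j, ∑ i, (y i)⁻ * (p i j - δ) :=
        Finset.sum_le_sum fun j _ => hcoord j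
    _ = ∑ i, (y i)⁻ * (1 - Fintype.card ι * δ) := by
        rw [Finset.sum_comm]
        refine Finset.sum_congr rfl fun i _ => ?_
        rw [← Finset.mul_sum, Finset.sum_sub_distrib, hrow, Finset.sum_const, Finset.card_univ,
          nsmul_eq_mul]
    _ = (1 - Fintype.card ι * δ) * negMass y := by rw [← Finset.sum_mul, mul_comm, negMass]

lemma mul_sum_sub_negMass_le_vecMul {p : Matrix ι ι ℝ} {δ : ℝ} (hδ : 0 ≤ δ)
    (hp : ∀ i j, δ ≤ p i j) (hp1 : ∀ i j, p i j ≤ 1) (z : ι → ℝ) (j : ι) :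
    δ * ∑ i, z i - negMass z ≤ (z ᵥ* p) j := by
  rw [Finset.mul_sum, negMass, ← Finset.sum_sub_distrib]
  refine Finset.sum_le_sum fun i _ => ?_
  rcases le_total 0 (z i) with h | h
  · rw [negPart_eq_zero.2 h, sub_zero, mul_comm]
    exact mul_le_mul_of_nonneg_left (hp i j) h
  · rw [negPart_eq_neg.2 h]
    have hle := mul_le_mul_of_nonpos_left (hp1 i j) h
    have hneg : δ * z i ≤ 0 := mul_nonpos_of_nonneg_of_nonpos hδ h
    linarith

variable [DecidableEq ι]

lemma sum_vecMul_pow {p : Matrix ι ι ℝ} (hrow : ∀ i, ∑ j, p i j = 1) (y : ι → ℝ) (n : ℕ) :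
    ∑ j, (y ᵥ* p ^ n) j = ∑ i, y i := by
  induction n with
  | zero => rw [pow_zero, Matrix.vecMul_one]
  | succ n ih => rw [pow_succ, ← Matrix.vecMul_vecMul, sum_vecMul hrow, ih]

lemma negMass_vecMul_pow_le {p : Matrix ι ι ℝ} {δ : ℝ} (hδ : 0 ≤ δ)
    (hδ1 : Fintype.card ι * δ ≤ 1) (hp : ∀ i j, δ ≤ p i j) (hrow : ∀ i, ∑ j, p i j = 1)
    {y : ι → ℝ} (hy : 0 ≤ ∑ i, y i) (n : ℕ) :
    negMass (y ᵥ* p ^ n) ≤ (1 - Fintype.card ι * δ) ^ n * negMass y := by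
  induction n with
  | zero => simp
  | succ n ih =>
    rw [pow_succ, ← Matrix.vecMul_vecMul, pow_succ' (1 - Fintype.card ι * δ), mul_assoc]
    exact (negMass_vecMul_le hδ hp hrow (by rwa [sum_vecMul_pow hrow])).trans
      (mul_le_mul_of_nonneg_left ih (sub_nonneg.2 hδ1))

lemma exists_pow_vecMul_pos {p : Matrix ι ι ℝ} (hp : ∀ i j, 0 < p i j)
    (hrow : ∀ i, ∑ j, p i j = 1) {y : ι → ℝ} (hy : 0 < ∑ i, y i) :
    ∃ n : ℕ, ∀ j, 0 < (y ᵥ* p ^ n) j := by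
  rcases isEmpty_or_nonempty ι with he | hne
  · exact ⟨0, fun j => (he.false j).elim⟩
  obtain ⟨⟨i₀, j₀⟩, hmin⟩ := Finite.exists_min fun ij : ι × ι => p ij.1 ij.2
  have hδ : 0 < p i₀ j₀ := hp i₀ j₀
  set δ := p i₀ j₀
  have hpδ : ∀ i j, δ ≤ p i j := fun i j => hmin (i, j)
  have hp1 : ∀ i j, p i j ≤ 1 := fun i j => by
    rw [← hrow i]
    exact Finset.single_le_sum (f := p i) (fun j _ => (hp i j).le) (Finset.mem_univ j)
  have hδ1 : Fintype.card ι * δ ≤ 1 := by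
    rw [← hrow i₀, ← nsmul_eq_mul]
    exact Finset.card_nsmul_le_sum Finset.univ _ _ fun j _ => hpδ i₀ j
  have hcontr : 1 - Fintype.card ι * δ < 1 :=
    sub_lt_self _ (mul_pos (by exact_mod_cast Fintype.card_pos) hδ)
  have hlim : Tendsto (fun n : ℕ => (1 - Fintype.card ι * δ) ^ n * negMass y) atTop (𝓝 0) := by
    simpa using (tendsto_pow_atTop_nhds_zero_of_lt_one (sub_nonneg.2 hδ1) hcontr).mul_const
      (negMass y)
  obtain ⟨n, hn⟩ := (hlim.eventually_lt_const (mul_pos hδ hy)).exists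
  refine ⟨n + 1, fun j => ?_⟩
  have hsmall := (negMass_vecMul_pow_le hδ.le hδ1 hpδ hrow hy.le n).trans_lt hn
  have hlower := mul_sum_sub_negMass_le_vecMul hδ.le hpδ hp1 (y ᵥ* p ^ n) j
  rw [sum_vecMul_pow hrow] at hlower
  rw [pow_succ, ← Matrix.vecMul_vecMul]
  linarith

/-- The Doob transform `a_{ij} x_j / (r x_i)` of a matrix `a` by a vector `x`. It is a stochastic
matrix when `x` is a positive eigenvector of the nonnegative matrix `a` for the eigenvalue `r`. -/
def doobTransform (a : Matrix ι ι ℝ) (x : ι → ℝ) (r : ℝ) : Matrix ι ι ℝ :=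
  .of fun i j => a i j * x j / (r * x i)

omit [DecidableEq ι] in
lemma sum_doobTransform {a : Matrix ι ι ℝ} {x : ι → ℝ} {r : ℝ} (hr : r ≠ 0) (hx : ∀ i, x i ≠ 0)
    (hax : a *ᵥ x = r • x) (i : ι) : ∑ j, doobTransform a x r i j = 1 := by
  simp only [doobTransform, Matrix.of_apply]
  rw [← Finset.sum_div, div_eq_one_iff_eq (mul_ne_zero hr (hx i))]
  exact congrFun hax i

lemma mul_vecMul_doobTransform_pow (a : Matrix ι ι ℝ) {x : ι → ℝ} (hx : ∀ i, x i ≠ 0) (r : ℝ)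
    (s : ι → ℝ) (n : ℕ) (j : ι) :
    ((s * x) ᵥ* doobTransform a x r ^ n) j = (s ᵥ* a ^ n) j * x j / r ^ n := by
  induction n generalizing j with
  | zero => simp
  | succ n ih =>
    simp only [pow_succ, ← Matrix.vecMul_vecMul]
    rw [Matrix.vecMul, Matrix.vecMul, dotProduct, dotProduct, Finset.sum_mul, Finset.sum_div]
    refine Finset.sum_congr rfl fun i _ => ?_
    have hxi := hx i
    rw [ih, doobTransform, Matrix.of_apply]
    field_simp

lemma exists_pow_transpose_mulVec_pos {a : Matrix ι ι ℝ} (ha : ∀ i j, 0 < a i j) {x t : ι → ℝ}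
    {r : ℝ} (hx : ∀ i, 0 < x i) (hax : a *ᵥ x = r • x) (ht : 0 < x ⬝ᵥ t) :
    ∃ n : ℕ, ∀ j, 0 < ((a ^ n)ᵀ *ᵥ t) j := by
  rcases isEmpty_or_nonempty ι with he | ⟨⟨i₀⟩⟩
  · exact ⟨0, fun j => (he.false j).elim⟩
  have hr : 0 < r := by
    have hpos : 0 < (a *ᵥ x) i₀ :=
      Finset.sum_pos (fun j _ => mul_pos (ha i₀ j) (hx j)) ⟨i₀, Finset.mem_univ _⟩
    rw [hax] at hpos
    exact pos_of_mul_pos_left hpos (hx i₀).le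
  obtain ⟨n, hn⟩ := exists_pow_vecMul_pos (p := doobTransform a x r) (y := t * x)
    (fun i j => div_pos (mul_pos (ha i j) (hx j)) (mul_pos hr (hx i)))
    (sum_doobTransform hr.ne' (fun i => (hx i).ne') hax)
    (by rwa [dotProduct_comm] at ht)
  refine ⟨n, fun j => ?_⟩
  have hj := hn j
  rw [mul_vecMul_doobTransform_pow a fun i => (hx i).ne'] at hj
  rw [Matrix.mulVec_transpose]
  exact pos_of_mul_pos_left ((div_pos_iff_of_pos_right (pow_pos hr n)).1 hj) (hx j).le

omit [DecidableEq ι] in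
lemma exists_dotProduct_ne_zero_of_span_eq_top {κ : Type*} {v : κ → ι → ℝ}
    (hv : Submodule.span ℝ (Set.range v) = ⊤) {t : ι → ℝ} (ht : t ≠ 0) :
    ∃ k, v k ⬝ᵥ t ≠ 0 := by
  by_contra! h
  refine ht (dotProduct_self_eq_zero.1 ?_)
  have hspan : t ∈ Submodule.span ℝ (Set.range v) := hv ▸ Submodule.mem_top
  refine Submodule.span_induction (p := fun u _ => u ⬝ᵥ t = 0) ?_ (zero_dotProduct t)
    (fun x y _ _ hx hy => by rw [add_dotProduct, hx, hy, add_zero])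
    (fun c x _ hx => by rw [smul_dotProduct, hx, smul_zero]) hspan
  rintro _ ⟨k, rfl⟩
  exact h k

lemma exists_pos_mem_of_linearIndependent_Lam {d : ℕ} {μ : Measure (Mat d)}
    {V : Submodule ℝ (Fin d → ℝ)} (hV : V ≠ ⊥) (hinv : ∀ a ∈ Gam μ, ∀ t ∈ V, aᵀ *ᵥ t ∈ V)
    {v : Fin d → Fin d → ℝ} (hv : ∀ i, v i ∈ Lam μ) (hli : LinearIndependent ℝ v) :
    ∃ w ∈ V, ∀ i, 0 < w i := by
  obtain ⟨t, htV, ht0⟩ := V.exists_mem_ne_zero_of_ne_bot hV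
  obtain ⟨i, hi⟩ := exists_dotProduct_ne_zero_of_span_eq_top
    (hli.span_eq_top_of_card_eq_finrank' (by simp)) ht0
  have hopen : IsOpen {x : Fin d → ℝ | x ⬝ᵥ t ≠ 0} :=
    isOpen_ne_fun (continuous_id.dotProduct continuous_const) continuous_const
  obtain ⟨x, hxt, a, haG, hapos, hxpos, -, hax⟩ := mem_closure_iff.1 (hv i) _ hopen hi
  have exists_pos : ∀ s ∈ V, 0 < x ⬝ᵥ s → ∃ w ∈ V, ∀ i, 0 < w i := fun s hs hpos => by
    obtain ⟨n, hn⟩ := exists_pow_transpose_mulVec_pos hapos hxpos hax hpos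
    exact ⟨_, hinv _ (pow_mem haG n) s hs, hn⟩
  rcases lt_or_gt_of_ne (show x ⬝ᵥ t ≠ 0 from hxt) with h | h
  · exact exists_pos (-t) (neg_mem htV) (by rwa [dotProduct_neg, neg_pos])
  · exact exists_pos t htV h

end Positivity

section SpectralRadius

lemma spectralRadius_le_one_of_norm_pow_le {B : Type*} [NormedRing B] [NormedAlgebra ℂ B]
    [CompleteSpace B] {b : B} {C : ℝ} (h : ∀ n : ℕ, ‖b ^ n‖ ≤ C) : spectralRadius ℂ b ≤ 1 := by
  refine iSup₂_le fun k hk => ?_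
  suffices ‖k‖ ≤ 1 by exact_mod_cast this
  by_contra! hk1
  obtain ⟨n, hn⟩ := pow_unbounded_of_one_lt (C * ‖(1 : B)‖) hk1
  have hle := spectrum.norm_le_norm_mul_of_mem (spectrum.pow_mem_pow b n hk)
  rw [norm_pow] at hle
  exact absurd (hle.trans (mul_le_mul_of_nonneg_right (h n) (norm_nonneg _))) hn.not_ge

lemma spectralRadius_le_one_of_norm_pow_apply_le {ι : Type*} [Fintype ι] [DecidableEq ι]
    {b : Matrix ι ι ℂ} {C : ι → ι → ℝ} (h : ∀ n i j, ‖(b ^ n) i j‖ ≤ C i j) :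
    spectralRadius ℂ b ≤ 1 := by
  let _ := Matrix.linftyOpNormedRing (n := ι) (α := ℂ)
  let _ := Matrix.linftyOpNormedAlgebra (n := ι) (R := ℂ) (α := ℂ)
  have : CompleteSpace (Matrix ι ι ℂ) := FiniteDimensional.complete ℂ _
  refine spectralRadius_le_one_of_norm_pow_le (C := ∑ i, ∑ j, C i j) fun n => ?_
  have hsup : ‖b ^ n‖₊ ≤ ∑ i, ∑ j, ‖(b ^ n) i j‖₊ := by
    rw [Matrix.linfty_opNNNorm_def]
    exact Finset.sup_le fun i hi => Finset.single_le_sum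
      (f := fun i => ∑ j, ‖(b ^ n) i j‖₊) (fun _ _ => bot_le) hi
  calc ‖b ^ n‖ ≤ ∑ i, ∑ j, ‖(b ^ n) i j‖ := by simpa using NNReal.coe_le_coe.2 hsup
    _ ≤ ∑ i, ∑ j, C i j := Finset.sum_le_sum fun i _ => Finset.sum_le_sum fun j _ => h n i j

lemma StrictlyPos.mulVec_pos {d : ℕ} {l : Mat d} (hl : StrictlyPos l) {z : Fin d → ℝ}
    (hz : 0 ≤ z) (hz0 : z ≠ 0) (i : Fin d) : 0 < (l *ᵥ z) i := by
  obtain ⟨j, hj⟩ := Function.ne_iff.1 hz0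
  exact Finset.sum_pos' (fun k _ => mul_nonneg (hl i k).le (hz k))
    ⟨j, Finset.mem_univ _, mul_pos (hl i j) ((hz j).lt_of_ne' hj)⟩

lemma StrictlyPos.pow_apply_nonneg {d : ℕ} {l : Mat d} (hl : StrictlyPos l) (n : ℕ)
    (i j : Fin d) : 0 ≤ (l ^ n) i j := by
  induction n generalizing i j with
  | zero => rw [pow_zero, Matrix.one_apply]; split_ifs <;> norm_num
  | succ n ih =>
    rw [pow_succ, Matrix.mul_apply]
    exact Finset.sum_nonneg fun k _ => mul_nonneg (ih i k) (hl k j).le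

lemma specRad_le_one_of_dotProduct_pow_mulVec_le {d : ℕ} {l : Mat d} (hl : StrictlyPos l)
    {z w : Fin d → ℝ} (hz : 0 ≤ z) (hz0 : z ≠ 0) (hw : ∀ i, 0 < w i)
    (hb : ∀ n : ℕ, w ⬝ᵥ (l ^ n *ᵥ z) ≤ w ⬝ᵥ z) : specRad l ≤ 1 := by
  have hy := hl.mulVec_pos hz hz0
  have hentry : ∀ n i j, (l ^ n) i j ≤ w ⬝ᵥ z / (w i * (l *ᵥ z) j) := fun n i j => by
    rw [le_div_iff₀ (mul_pos (hw i) (hy j))]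
    have hpow : 0 ≤ l ^ n *ᵥ (l *ᵥ z) :=
      mulVec_nonneg (hl.pow_apply_nonneg n) fun j => (hy j).le
    calc (l ^ n) i j * (w i * (l *ᵥ z) j) = w i * ((l ^ n) i j * (l *ᵥ z) j) := by ring
      _ ≤ w i * (l ^ n *ᵥ (l *ᵥ z)) i := mul_le_mul_of_nonneg_left
          (Finset.single_le_sum (f := fun j => (l ^ n) i j * (l *ᵥ z) j)
            (fun j _ => mul_nonneg (hl.pow_apply_nonneg n i j) (hy j).le) (Finset.mem_univ j))
          (hw i).le
      _ ≤ w ⬝ᵥ (l ^ n *ᵥ (l *ᵥ z)) :=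
          Finset.single_le_sum (f := fun i => w i * (l ^ n *ᵥ (l *ᵥ z)) i)
            (fun i _ => mul_nonneg (hw i).le (hpow i)) (Finset.mem_univ i)
      _ ≤ w ⬝ᵥ z := by rw [Matrix.mulVec_mulVec, ← pow_succ]; exact hb (n + 1)
  have hrad : spectralRadius ℂ (l.map (algebraMap ℝ ℂ)) ≤ 1 := by
    refine spectralRadius_le_one_of_norm_pow_apply_le fun n i j => le_trans ?_ (hentry n i j)
    have hmap : (l.map (algebraMap ℝ ℂ)) ^ n = (l ^ n).map (algebraMap ℝ ℂ) :=
      (map_pow (algebraMap ℝ ℂ).mapMatrix l n).symm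
    rw [hmap, Matrix.map_apply, norm_algebraMap', Real.norm_of_nonneg (hl.pow_apply_nonneg n i j)]
  exact ENNReal.toReal_le_of_le_ofReal zero_le_one (by simpa using hrad)

end SpectralRadius

section CoverSums

variable {d : ℕ}

lemma pathProd_nil (a : List ℕ → ℕ → Mat d) : pathProd a [] = 1 := rfl

lemma pathProd_cons (a : List ℕ → ℕ → Mat d) (i : ℕ) (u : List ℕ) :
    pathProd a (i :: u) = a [] i * pathProd (fun v => a (i :: v)) u := by
  simp [pathProd, List.ofFn_succ]

lemma IsCoverSet.eq_of_prefix {U : Set (List ℕ)} (hU : IsCoverSet U) {u u' : List ℕ} (hu : u ∈ U)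
    (hu' : u' ∈ U) (h : u <+: u') : u = u' := by
  obtain ⟨k, -, hk⟩ := hU fun k => u'.getD k 0
  have hmap : ∀ w : List ℕ, w <+: u' →
      (List.range w.length).map (fun k => u'.getD k 0) = w := by
    rintro w ⟨w', rfl⟩
    refine List.ext_getElem (by simp) fun n h1 h2 => ?_
    simp [List.getElem?_append_left h2, h2]
  have hlen : u.length = k := hk _ (by beta_reduce; rwa [hmap u h])
  have hlen' : u'.length = k := hk _ (by beta_reduce; rwa [hmap u' List.prefix_rfl])
  exact h.eq_of_length (hlen.trans hlen'.symm)

lemma sum_eq_sum_preimage_cons {F : Finset (List ℕ)} (hF : [] ∉ F) (f : List ℕ → ℝ) :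
    ∑ u ∈ F, f u = ∑ i ∈ F.image List.headI,
      ∑ u ∈ F.preimage (List.cons i) List.cons_injective.injOn, f (i :: u) := by
  rw [← Finset.sum_fiberwise_of_maps_to (g := List.headI) (t := F.image List.headI)
    (fun u hu => Finset.mem_image_of_mem _ hu)]
  refine Finset.sum_congr rfl fun i _ => ?_
  classical
  rw [Finset.sum_preimage' (List.cons i) F List.cons_injective.injOn f]
  refine Finset.sum_congr (Finset.filter_congr fun u hu => ?_) fun _ _ => rfl
  cases u with
  | nil => exact (hF hu).elim
  | cons j u => simp [eq_comm]

/-- The sequences `(a_1, a_2, …)` in `S` are nonnegative, their transposes preserve `V`, and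
`∑ w · a_i z ≤ w · z` for all nonnegative `w ∈ V`: the vector `z` is excessive for the one-step
transition, when tested against `V`. -/
structure IsExcessive (S : Set (ℕ → Mat d)) (V : Submodule ℝ (Fin d → ℝ)) (z : Fin d → ℝ) :
    Prop where
  nonneg : ∀ a ∈ S, ∀ i j k, 0 ≤ a i j k
  transpose_mulVec_mem : ∀ a ∈ S, ∀ w ∈ V, ∀ i, (a i)ᵀ *ᵥ w ∈ V
  sum_le : ∀ a ∈ S, ∀ w ∈ V, 0 ≤ w → ∀ n, ∑ i ∈ Finset.range n, w ⬝ᵥ (a i *ᵥ z) ≤ w ⬝ᵥ z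

namespace IsExcessive

variable {S : Set (ℕ → Mat d)} {V : Submodule ℝ (Fin d → ℝ)} {z : Fin d → ℝ}

lemma transpose_pathProd_mulVec_mem (h : IsExcessive S V z) {a : List ℕ → ℕ → Mat d}
    (ha : ∀ v, a v ∈ S) (u : List ℕ) {w : Fin d → ℝ} (hw : w ∈ V) :
    (pathProd a u)ᵀ *ᵥ w ∈ V := by
  induction u generalizing a w with
  | nil => simpa [pathProd_nil] using hw
  | cons i u ih =>
    rw [pathProd_cons, Matrix.transpose_mul, ← Matrix.mulVec_mulVec]
    exact ih (fun v => ha _) (h.transpose_mulVec_mem _ (ha []) w hw i)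

lemma sum_finset_le (h : IsExcessive S V z) (hz : 0 ≤ z) {a : ℕ → Mat d} (ha : a ∈ S)
    {w : Fin d → ℝ} (hwV : w ∈ V) (hw : 0 ≤ w) (I : Finset ℕ) :
    ∑ i ∈ I, w ⬝ᵥ (a i *ᵥ z) ≤ w ⬝ᵥ z := by
  refine le_trans ?_ (h.sum_le a ha w hwV hw (I.sup id + 1))
  exact Finset.sum_le_sum_of_subset_of_nonneg I.subset_range_sup_succ fun i _ _ =>
    dotProduct_nonneg_of_nonneg hw (mulVec_nonneg (h.nonneg a ha i) hz)

lemma sum_pathProd_le (h : IsExcessive S V z) (hz : 0 ≤ z) {L : ℕ} {F : Finset (List ℕ)}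
    (hL : ∀ u ∈ F, u.length ≤ L) (hF : ∀ u ∈ F, ∀ u' ∈ F, u <+: u' → u = u')
    {a : List ℕ → ℕ → Mat d} (ha : ∀ v, a v ∈ S) {w : Fin d → ℝ} (hwV : w ∈ V) (hw : 0 ≤ w) :
    ∑ u ∈ F, w ⬝ᵥ (pathProd a u *ᵥ z) ≤ w ⬝ᵥ z := by
  induction L generalizing F a w with
  | zero =>
    have hsub : F ⊆ {[]} := fun u hu => by simpa using hL u hu
    rcases Finset.subset_singleton_iff.1 hsub with rfl | rfl
    · simpa using dotProduct_nonneg_of_nonneg hw hz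
    · simp [pathProd_nil]
  | succ L ih =>
    by_cases hnil : [] ∈ F
    · have hsingle : F = {[]} := Finset.eq_singleton_iff_unique_mem.2
        ⟨hnil, fun u hu => (hF [] hnil u hu List.nil_prefix).symm⟩
      simp [hsingle, pathProd_nil]
    have hletter : ∀ i, ∑ u ∈ F.preimage (List.cons i) List.cons_injective.injOn,
        w ⬝ᵥ (pathProd a (i :: u) *ᵥ z) ≤ w ⬝ᵥ (a [] i *ᵥ z) := fun i => by
      simp only [pathProd_cons, ← Matrix.mulVec_mulVec]
      simp only [← transpose_mulVec_dotProduct (a [] i) w]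
      refine ih (fun u hu => ?_) (fun u hu u' hu' huu' => ?_) (fun v => ha _)
        (h.transpose_mulVec_mem _ (ha []) w hwV i)
        (mulVec_nonneg (fun j k => h.nonneg _ (ha []) i k j) hw)
      · exact Nat.le_of_succ_le_succ (hL _ (Finset.mem_preimage.1 hu))
      · exact List.cons_injective (hF _ (Finset.mem_preimage.1 hu) _ (Finset.mem_preimage.1 hu')
          ((List.prefix_cons_inj i).2 huu'))
    rw [sum_eq_sum_preimage_cons hnil]
    exact (Finset.sum_le_sum fun i _ => hletter i).trans (h.sum_finset_le hz (ha []) hwV hw _)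

variable {U : Set (List ℕ)} {a : List ℕ → ℕ → Mat d} {l : Mat d} {w : Fin d → ℝ}

lemma transpose_hasSum_mulVec_mem (h : IsExcessive S V z) (ha : ∀ v, a v ∈ S)
    (hl : HasSum (fun u : U => pathProd a u) l) (hwV : w ∈ V) : lᵀ *ᵥ w ∈ V := by
  have hc : Continuous fun M : Mat d => Mᵀ *ᵥ w := by fun_prop
  refine V.closed_of_finiteDimensional.mem_of_tendsto ((hc.tendsto l).comp hl)
    (Eventually.of_forall fun F => ?_)
  rw [Function.comp_apply, Matrix.transpose_sum, Matrix.sum_mulVec]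
  exact V.sum_mem fun u _ => h.transpose_pathProd_mulVec_mem ha u hwV

lemma dotProduct_hasSum_mulVec_le (h : IsExcessive S V z) (hz : 0 ≤ z) (hU : IsCoverSet U)
    (hfin : FiniteLevel U) (ha : ∀ v, a v ∈ S) (hl : HasSum (fun u : U => pathProd a u) l)
    (hwV : w ∈ V) (hw : 0 ≤ w) : w ⬝ᵥ (l *ᵥ z) ≤ w ⬝ᵥ z := by
  obtain ⟨L, hL⟩ := hfin
  have hc : Continuous fun M : Mat d => w ⬝ᵥ (M *ᵥ z) :=
    (continuous_dotProduct_left w).comp (by fun_prop)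
  refine le_of_tendsto ((hc.tendsto l).comp hl) (Eventually.of_forall fun F => ?_)
  rw [Function.comp_apply, Matrix.sum_mulVec, dotProduct_sum]
  have hsub : ∀ u ∈ F.map (Function.Embedding.subtype _), u ∈ U := fun u hu => by
    obtain ⟨v, -, rfl⟩ := Finset.mem_map.1 hu
    exact v.2
  have hle := h.sum_pathProd_le hz (F := F.map (Function.Embedding.subtype _))
    (fun u hu => hL u (hsub u hu)) (fun u hu u' hu' => hU.eq_of_prefix (hsub u hu) (hsub u' hu'))
    ha hwV hw
  rwa [Finset.sum_map] at hle

lemma specRad_le_one_of_isCoverSum {Ω : Type*} [MeasurableSpace Ω] {P : Measure Ω}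
    {A : ℕ → Ω → Mat d} (h : IsExcessive (seqSupport P A) V z) (hz : 0 ≤ z) (hz0 : z ≠ 0)
    (hl : IsCoverSum P A l) (hpos : StrictlyPos l) (hwV : w ∈ V) (hw : ∀ i, 0 < w i) :
    specRad l ≤ 1 := by
  obtain ⟨U, hU, hfin, a, ha, hsum⟩ := hl
  have hpow : ∀ n : ℕ, ∀ w ∈ V, 0 ≤ w → w ⬝ᵥ (l ^ n *ᵥ z) ≤ w ⬝ᵥ z := fun n => by
    induction n with
    | zero => intro w _ _; rw [pow_zero, Matrix.one_mulVec]
    | succ n ih =>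
      intro w hwV hw
      have hstep := ih _ (h.transpose_hasSum_mulVec_mem ha hsum hwV)
        (mulVec_nonneg (fun i j => (hpos j i).le) hw)
      rw [transpose_mulVec_dotProduct, transpose_mulVec_dotProduct, Matrix.mulVec_mulVec,
        ← pow_succ'] at hstep
      exact hstep.trans (h.dotProduct_hasSum_mulVec_le hz hU hfin ha hsum hwV hw)
  exact specRad_le_one_of_dotProduct_pow_mulVec_le hpos hz hz0 hw fun n =>
    hpow n w hwV fun i => (hw i).le

end IsExcessive

end CoverSums

section UnitModulus

variable {d : ℕ} {Ω : Type*} [MeasurableSpace Ω] {P : Measure Ω} [IsProbabilityMeasure P]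
  {N : Ω → ℕ} {A : ℕ → Ω → Mat d} {η : Measure (Fin d → ℝ)} [IsProbabilityMeasure η]

lemma ae_eq_one_of_one_le_integral {f : Ω → ℝ} (hf : Integrable f P) (hf1 : ∀ ω, f ω ≤ 1)
    (h : 1 ≤ ∫ ω, f ω ∂P) : ∀ᵐ ω ∂P, f ω = 1 := by
  have hsub : Integrable (fun ω => 1 - f ω) P := (integrable_const 1).sub hf
  have hzero : ∫ ω, (1 - f ω) ∂P = 0 := by
    refine le_antisymm ?_ (integral_nonneg fun ω => sub_nonneg.2 (hf1 ω))
    rw [integral_sub (integrable_const 1) hf]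
    simpa using h
  filter_upwards [(integral_eq_zero_iff_of_nonneg (fun ω => sub_nonneg.2 (hf1 ω)) hsub).1 hzero]
    with ω hω
  exact (sub_eq_zero.1 hω).symm

lemma norm_prod_cf_le_one (s : Finset ℕ) (f : ℕ → Fin d → ℝ) : ‖∏ j ∈ s, cf η (f j)‖ ≤ 1 := by
  rw [norm_prod]
  exact Finset.prod_le_one (fun _ _ => norm_nonneg _) fun _ _ => norm_cf_le_one η _

lemma integrable_norm_prod_cf (hN : Measurable N) (hA : ∀ i, Measurable (A i))
    (t : Fin d → ℝ) :
    Integrable (fun ω => ‖∏ j ∈ Finset.range (N ω), cf η ((A j ω)ᵀ *ᵥ t)‖) P := by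
  refine Integrable.of_bound (C := 1) (measurable_prod_cf hN hA t).norm.aestronglyMeasurable
    (ae_of_all _ fun ω => ?_)
  rw [norm_norm]
  exact norm_prod_cf_le_one _ _

lemma norm_cf_le_integral_norm_prod (hN : Measurable N) (hA : ∀ i, Measurable (A i))
    (hη : smoothing P N A η = η) (t : Fin d → ℝ) :
    ‖cf η t‖ ≤ ∫ ω, ‖∏ j ∈ Finset.range (N ω), cf η ((A j ω)ᵀ *ᵥ t)‖ ∂P := by
  conv_lhs => rw [← hη, cf_smoothing hN hA]
  exact norm_integral_le_integral_norm _

lemma ae_norm_cf_transpose_mulVec_eq_one (hA : IsWeightFamily P N A)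
    (hη : smoothing P N A η = η) {t : Fin d → ℝ} (ht : ‖cf η t‖ = 1) :
    ∀ᵐ ω ∂P, ∀ j, ‖cf η ((A j ω)ᵀ *ᵥ t)‖ = 1 := by
  have hprod := ae_eq_one_of_one_le_integral
    (integrable_norm_prod_cf hA.measurable_card hA.measurable t)
    (fun ω => norm_prod_cf_le_one _ _)
    (ht ▸ norm_cf_le_integral_norm_prod hA.measurable_card hA.measurable hη t)
  filter_upwards [hprod, hA.ae_eq_zero] with ω hω hzero j
  by_cases hj : j < N ω
  · refine le_antisymm (norm_cf_le_one _ _) ?_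
    have hle := Finset.prod_le_prod_of_subset_of_le_one (s := {j}) (t := Finset.range (N ω))
      (f := fun j => ‖cf η ((A j ω)ᵀ *ᵥ t)‖) (by simpa using hj) (fun _ _ => norm_nonneg _)
      (fun _ _ _ => norm_cf_le_one η _)
    rwa [← norm_prod, hω, Finset.prod_singleton] at hle
  · simp [hzero j (not_lt.1 hj)]

omit [IsProbabilityMeasure η] in
lemma isClosed_setOf_norm_cf_eq_one [IsFiniteMeasure η] {X : Type*} [TopologicalSpace X]
    {f : X → Fin d → ℝ} (hf : Continuous f) : IsClosed {x | ‖cf η (f x)‖ = 1} :=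
  isClosed_eq ((continuous_cf η).comp hf).norm continuous_const

lemma isAbsorbing_setOf_norm_cf_eq_one (hA : IsWeightFamily P N A)
    (hη : smoothing P N A η = η) (t : Fin d → ℝ) :
    IsAbsorbing (step P A) {ℓ | ∀ k, ‖cf η ((ℓ k)ᵀ *ᵥ t)‖ = 1} := by
  have hmeas : MeasurableSet {ℓ : St d | ∀ k, ‖cf η ((ℓ k)ᵀ *ᵥ t)‖ = 1} := by
    rw [Set.ofPred_forall]
    exact (isClosed_iInter fun k =>
      isClosed_setOf_norm_cf_eq_one (by fun_prop)).measurableSet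
  refine ⟨hmeas, fun ℓ hℓ => mem_ae_iff.1 ((ae_step_iff P hA.measurable ℓ hmeas).2 ?_)⟩
  filter_upwards [ae_infinitePi_forall (fun _ : ℕ => P) fun i =>
    ae_norm_cf_transpose_mulVec_eq_one hA hη (hℓ i)] with ω hω k
  simpa [branch, Matrix.transpose_mul, Matrix.mulVec_mulVec] using hω k.unpair.1 k.unpair.2

lemma hasLargeImages_root {t : Fin d → ℝ} (ht : t ≠ 0) : HasLargeImages 0 1 (root d) t :=
  ⟨{0}, rfl, fun j hj => by rw [Finset.mem_singleton.1 hj]; simpa [root] using ht⟩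

-- The particles of a late generation carry `t` to small nonzero directions of unit modulus.
lemma exists_norm_le_norm_cf_eq_one (hA : IsWeightFamily P N A) (hne : Survives P A)
    (hgen : HasSmallGenerations P A) (hη : smoothing P N A η = η) {t : Fin d → ℝ}
    (ht0 : t ≠ 0) (ht : ‖cf η t‖ = 1) {δ : ℝ} (hδ : 0 < δ) :
    ∃ u, u ≠ 0 ∧ ‖u‖ ≤ δ ∧ ‖cf η u‖ = 1 := by
  have hmk := isMarkovKernel_step P hA.measurable
  have htn : 0 < ‖t‖ := norm_pos_iff.2 ht0
  obtain ⟨n, -, hn⟩ := hgen 0 _ (div_pos hδ htn) (1 / 2) (by simp)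
  have hunit : ∀ k, ‖cf η ((root d k)ᵀ *ᵥ t)‖ = 1 := fun k => by
    by_cases hk : k = 0
    · simpa [hk, root] using ht
    · simp [root_eq_zero hk]
  have hsmall : ∃ᵐ ℓ ∂((step P A ^ n) (root d)), ∀ k, opNorm (ℓ k) ≤ δ / ‖t‖ := by
    intro hlarge
    have huniv : (step P A ^ n) (root d) Set.univ ≤ 1 / 2 :=
      (measure_mono_ae (hlarge.mono fun ℓ hℓ _ => show ∃ k, _ by simpa using hℓ)).trans hn
    norm_num [measure_univ] at huniv
  obtain ⟨ℓ, hℓ, hone, F, hF, hpos⟩ := (hsmall.and_eventually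
    (((isAbsorbing_setOf_norm_cf_eq_one hA hη t).ae_pow_mem n hunit).and
      ((isAbsorbing_setOf_hasLargeImages hA.measurable hne t).ae_pow_mem n
        (hasLargeImages_root ht0)))).exists
  obtain ⟨k, hk⟩ : F.Nonempty := Finset.card_pos.1 (hF ▸ one_pos)
  refine ⟨(ℓ k)ᵀ *ᵥ t, norm_pos_iff.1 (hpos k hk), ?_, hone k⟩
  calc ‖(ℓ k)ᵀ *ᵥ t‖ ≤ opNorm (ℓ k) * ‖t‖ := norm_transpose_mulVec_le _ _
    _ ≤ δ / ‖t‖ * ‖t‖ := by gcongr; exact hℓ k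
    _ = δ := div_mul_cancel₀ _ htn.ne'

end UnitModulus

section Supports

variable {d : ℕ} {Ω : Type*} [MeasurableSpace Ω] {P : Measure Ω} {N : Ω → ℕ}
  {A : ℕ → Ω → Mat d}

lemma mem_of_mem_support_mu (hA : ∀ i, Measurable (A i)) {C : Set (Mat d)} (hC : IsClosed C)
    (h : ∀ᵐ ω ∂P, ∀ i, A i ω ∈ C) {a : Mat d} (ha : a ∈ (mu P N A).support) : a ∈ C := by
  refine Measure.support_subset_of_isClosed hC ?_ ha
  refine Measure.ae_smul_measure (Measure.ae_sum_iff.2 fun i => ?_) _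
  exact (ae_map_iff (hA i).aemeasurable hC.measurableSet).2
    (ae_restrict_of_ae (h.mono fun ω hω => hω i))

lemma mem_of_mem_seqSupport (hA : ∀ i, Measurable (A i)) {C : Set (ℕ → Mat d)}
    (hC : IsClosed C) (h : ∀ᵐ ω ∂P, (fun i => A i ω) ∈ C) {a : ℕ → Mat d}
    (ha : a ∈ seqSupport P A) : a ∈ C :=
  Measure.support_subset_of_isClosed hC
    ((ae_map_iff (measurable_pi_lambda _ hA).aemeasurable hC.measurableSet).2 h) ha

lemma nonneg_of_mem_seqSupport (hA : ∀ i, Measurable (A i))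
    (hnn : ∀ᵐ ω ∂P, ∀ i j k, 0 ≤ A i ω j k) {a : ℕ → Mat d} (ha : a ∈ seqSupport P A) (i : ℕ)
    (j k : Fin d) : 0 ≤ a i j k := by
  have hcont : Continuous fun a : ℕ → Mat d => a i j k := by fun_prop
  exact mem_of_mem_seqSupport hA (isClosed_le continuous_const hcont)
    (hnn.mono fun ω h => h i j k) ha

variable [IsProbabilityMeasure P] {η : Measure (Fin d → ℝ)} [IsProbabilityMeasure η]

lemma norm_cf_transpose_mulVec_eq_one_of_mem_Gam (hA : IsWeightFamily P N A)
    (hη : smoothing P N A η = η) {a : Mat d} (ha : a ∈ Gam (mu P N A)) :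
    ∀ t : Fin d → ℝ, ‖cf η t‖ = 1 → ‖cf η (aᵀ *ᵥ t)‖ = 1 := by
  induction ha using Submonoid.closure_induction with
  | mem x hx =>
    exact fun t ht => mem_of_mem_support_mu hA.measurable
      (isClosed_setOf_norm_cf_eq_one (f := fun a : Mat d => aᵀ *ᵥ t) (by fun_prop))
      (ae_norm_cf_transpose_mulVec_eq_one hA hη ht) hx
  | one => intro t ht; simpa using ht
  | mul x y _ _ hx hy =>
    intro t ht
    rw [Matrix.transpose_mul, ← Matrix.mulVec_mulVec]
    exact hy _ (hx t ht)

lemma norm_cf_transpose_mulVec_eq_one_of_mem_seqSupport (hA : IsWeightFamily P N A)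
    (hη : smoothing P N A η = η) {a : ℕ → Mat d} (ha : a ∈ seqSupport P A) (i : ℕ)
    (t : Fin d → ℝ) (ht : ‖cf η t‖ = 1) : ‖cf η ((a i)ᵀ *ᵥ t)‖ = 1 :=
  mem_of_mem_seqSupport hA.measurable
    (isClosed_setOf_norm_cf_eq_one (f := fun a : ℕ → Mat d => (a i)ᵀ *ᵥ t) (by fun_prop))
    ((ae_norm_cf_transpose_mulVec_eq_one hA hη ht).mono fun _ h => h i) ha

end Supports

section StrictBound

variable {d : ℕ} {Ω : Type*} [MeasurableSpace Ω] {P : Measure Ω} [IsProbabilityMeasure P]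
  {N : Ω → ℕ} {A : ℕ → Ω → Mat d} {η : Measure (Fin d → ℝ)} [IsProbabilityMeasure η]
  {z w : Fin d → ℝ}

lemma ae_forall_transpose_mulVec_mem_degenerateDirections (hA : IsWeightFamily P N A)
    (hη : smoothing P N A η = η) (hw : w ∈ degenerateDirections η) :
    ∀ᵐ ω ∂P, ∀ i, (A i ω)ᵀ *ᵥ w ∈ degenerateDirections η := by
  have hunit : ∀ n : ℕ, ‖cf η ((1 / ((n : ℝ) + 1)) • w)‖ = 1 := fun n =>
    norm_cf_eq_one_of_mem_degenerateDirections (Submodule.smul_mem _ _ hw)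
  filter_upwards [ae_all_iff.2 fun n => ae_norm_cf_transpose_mulVec_eq_one hA hη (hunit n)]
    with ω hω i
  refine mem_degenerateDirections_of_forall_smul fun n => ?_
  rw [← Matrix.mulVec_smul]
  exact hω n i

lemma ae_sum_dotProduct_mulVec_eq (hA : IsWeightFamily P N A) (hη : smoothing P N A η = η)
    (hz : ∀ᵐ x ∂η, ∀ t ∈ degenerateDirections η, t ⬝ᵥ x = t ⬝ᵥ z)
    (hw : w ∈ degenerateDirections η) :
    ∀ᵐ ω ∂P, ∑ i ∈ Finset.range (N ω), w ⬝ᵥ (A i ω *ᵥ z) = w ⬝ᵥ z := by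
  have hfix : ∀ᵐ x ∂(smoothing P N A η), w ⬝ᵥ x = w ⬝ᵥ z := by
    rw [hη]; exact hz.mono fun x h => h w hw
  have hsum := ae_of_ae_map
    (measurable_smoothing_sum hA.measurable_card hA.measurable).aemeasurable hfix
  filter_upwards [Measure.ae_ae_of_ae_prod hsum,
    ae_forall_transpose_mulVec_mem_degenerateDirections hA hη hw] with ω hω hmem
  obtain ⟨x, hx, hxz⟩ := (hω.and (ae_infinitePi_forall (fun _ : ℕ => η) fun _ => hz)).exists
  rw [← hx, dotProduct_sum]
  refine Finset.sum_congr rfl fun i _ => ?_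
  rw [← transpose_mulVec_dotProduct, ← transpose_mulVec_dotProduct, hxz i _ (hmem i)]

lemma sum_dotProduct_mulVec_le_of_mem_seqSupport (hA : IsWeightFamily P N A)
    (hnn : ∀ᵐ ω ∂P, ∀ i j k, 0 ≤ A i ω j k) (hη : smoothing P N A η = η)
    (hz : ∀ᵐ x ∂η, ∀ t ∈ degenerateDirections η, t ⬝ᵥ x = t ⬝ᵥ z) (hz0 : 0 ≤ z)
    (hw : w ∈ degenerateDirections η) (hw0 : 0 ≤ w) {a : ℕ → Mat d} (ha : a ∈ seqSupport P A)
    (n : ℕ) : ∑ i ∈ Finset.range n, w ⬝ᵥ (a i *ᵥ z) ≤ w ⬝ᵥ z := by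
  have hclosed : IsClosed {a : ℕ → Mat d | ∑ i ∈ Finset.range n, w ⬝ᵥ (a i *ᵥ z) ≤ w ⬝ᵥ z} :=
    isClosed_le (by fun_prop) continuous_const
  refine mem_of_mem_seqSupport hA.measurable hclosed ?_ ha
  filter_upwards [ae_sum_dotProduct_mulVec_eq hA hη hz hw, hnn, hA.ae_eq_zero]
    with ω hsum hnonneg hzero
  have hterm : ∀ i, 0 ≤ w ⬝ᵥ (A i ω *ᵥ z) := fun i =>
    dotProduct_nonneg_of_nonneg hw0 (mulVec_nonneg (hnonneg i) hz0)
  calc ∑ i ∈ Finset.range n, w ⬝ᵥ (A i ω *ᵥ z)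
      ≤ ∑ i ∈ Finset.range (max n (N ω)), w ⬝ᵥ (A i ω *ᵥ z) :=
        Finset.sum_le_sum_of_subset_of_nonneg
          (Finset.range_subset_range.2 (le_max_left _ _)) fun i _ _ => hterm i
    _ = ∑ i ∈ Finset.range (N ω), w ⬝ᵥ (A i ω *ᵥ z) := by
        refine (Finset.sum_subset (Finset.range_subset_range.2 (le_max_right _ _)) ?_).symm
        intro i _ hi
        rw [hzero i (by simpa using hi), Matrix.zero_mulVec, dotProduct_zero]
    _ = w ⬝ᵥ z := hsum

lemma isExcessive_degenerateDirections (hA : IsWeightFamily P N A)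
    (hnn : ∀ᵐ ω ∂P, ∀ i j k, 0 ≤ A i ω j k) (hη : smoothing P N A η = η)
    (hz : ∀ᵐ x ∂η, ∀ t ∈ degenerateDirections η, t ⬝ᵥ x = t ⬝ᵥ z) (hz0 : 0 ≤ z) :
    IsExcessive (seqSupport P A) (degenerateDirections η) z where
  nonneg _ ha := nonneg_of_mem_seqSupport hA.measurable hnn ha
  transpose_mulVec_mem _ ha _ hw i := transpose_mulVec_mem_degenerateDirections
    (norm_cf_transpose_mulVec_eq_one_of_mem_seqSupport hA hη ha i) hw
  sum_le _ ha _ hw hw0 := sum_dotProduct_mulVec_le_of_mem_seqSupport hA hnn hη hz hz0 hw hw0 ha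

lemma ae_ae_forall_mem_degenerateDirections :
    ∀ᵐ z ∂η, ∀ᵐ x ∂η, ∀ t ∈ degenerateDirections η, t ⬝ᵥ x = t ⬝ᵥ z := by
  filter_upwards [Measure.ae_ae_of_ae_prod (ae_forall_mem_degenerateDirections (η := η))]
    with z hz
  filter_upwards [hz] with x hx t ht using (hx t ht).symm

-- A direction of unit modulus would make `z` excessive along a strictly positive direction,
-- which the cover sum of spectral radius above one forbids.
lemma norm_cf_lt_one (hA : IsWeightFamily P N A) (hne : Survives P A)
    (hnn : ∀ᵐ ω ∂P, ∀ i j k, 0 ≤ A i ω j k) (hgen : HasSmallGenerations P A) {l : Mat d}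
    (hl : IsCoverSum P A l) (hlpos : StrictlyPos l) (hlr : 1 < specRad l)
    {v : Fin d → Fin d → ℝ} (hv : ∀ i, v i ∈ Lam (mu P N A)) (hli : LinearIndependent ℝ v)
    (hη : smoothing P N A η = η) (hη0 : ∀ᵐ z ∂η, ∀ i, 0 ≤ z i) (hηz : η {0} = 0)
    {t : Fin d → ℝ} (ht : t ≠ 0) : ‖cf η t‖ < 1 := by
  refine (norm_cf_le_one η t).lt_of_ne fun hone => hlr.not_ge ?_
  have hbot : degenerateDirections η ≠ ⊥ := degenerateDirections_ne_bot fun _ hδ =>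
    exists_norm_le_norm_cf_eq_one hA hne hgen hη ht hone hδ
  obtain ⟨w, hwV, hw⟩ := exists_pos_mem_of_linearIndependent_Lam hbot (fun a ha t ht =>
    transpose_mulVec_mem_degenerateDirections
      (norm_cf_transpose_mulVec_eq_one_of_mem_Gam hA hη ha) ht) hv hli
  have hae0 : ∀ᵐ z ∂η, z ≠ 0 := by rw [ae_iff]; simpa using hηz
  obtain ⟨z, hz, hz0, hzne⟩ :=
    ((ae_ae_forall_mem_degenerateDirections (η := η)).and (hη0.and hae0)).exists
  exact (isExcessive_degenerateDirections hA hnn hη hz hz0).specRad_le_one_of_isCoverSum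
    hz0 hzne hl hlpos hwV hw

end StrictBound

section Branching

variable {d : ℕ}

lemma exists_radius_le_measure_hasLargeImages_of_ne_zero (Q : Measure (St d)) (k : ℕ)
    {c : ℝ≥0∞} (hc : c < ⊤)
    (h : ∀ t : Fin d → ℝ, t ≠ 0 → c < Q {ℓ | HasLargeImages 0 k ℓ t}) :
    ∃ r : ℝ, 0 < r ∧ ∃ b, c < b ∧
      ∀ t : Fin d → ℝ, t ≠ 0 → b ≤ Q {ℓ | HasLargeImages (‖t‖ * r) k ℓ t} := by
  obtain ⟨r, hr, b, hb, hsphere⟩ := exists_radius_le_measure_hasLargeImages Q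
    (isCompact_sphere (0 : Fin d → ℝ) 1) k hc fun t ht => h t (ne_zero_of_mem_unit_sphere ⟨t, ht⟩)
  refine ⟨r, hr, b, hb, fun t ht => ?_⟩
  have htn : 0 < ‖t‖ := norm_pos_iff.2 ht
  refine (hsphere (‖t‖⁻¹ • t) (by simp [norm_smul, ht])).trans (measure_mono fun ℓ hℓ => ?_)
  have hscaled := (hasLargeImages_smul_iff htn).2 (Set.mem_ofPred.1 hℓ)
  rwa [smul_inv_smul₀ htn.ne'] at hscaled

lemma exists_radius_hasLargeImages {k : ℕ} {ℓ : St d}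
    (h : ∀ t : Fin d → ℝ, t ≠ 0 → HasLargeImages 0 k ℓ t) :
    ∃ r : ℝ, 0 < r ∧ ∀ t : Fin d → ℝ, t ≠ 0 → HasLargeImages (‖t‖ * r) k ℓ t := by
  obtain ⟨r, hr, b, hb, hdirac⟩ := exists_radius_le_measure_hasLargeImages_of_ne_zero
    (Measure.dirac ℓ) k (c := 0) ENNReal.zero_lt_top fun t ht => by
      rw [Measure.dirac_apply' _ (measurableSet_hasLargeImages _ _ _),
        Set.indicator_of_mem (by exact h t ht)]
      exact one_pos
  refine ⟨r, hr, fun t ht => ?_⟩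
  have hpos := hb.trans_le (hdirac t ht)
  rw [Measure.dirac_apply' _ (measurableSet_hasLargeImages _ _ _)] at hpos
  have hmem : ℓ ∈ {ℓ | HasLargeImages (‖t‖ * r) k ℓ t} := Set.mem_of_indicator_ne_zero hpos.ne'
  exact hmem

variable {Ω : Type*} {A : ℕ → Ω → Mat d}

lemma hasLargeImages_zero_iff_le_countNonzero {k : ℕ} {t : Fin d → ℝ} {ω : Ω} :
    HasLargeImages 0 k (fun j => A j ω) t ↔ (k : ℕ∞) ≤ countNonzero A t ω := by
  simp only [HasLargeImages, countNonzero, norm_pos_iff]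
  constructor
  · rintro ⟨F, rfl, hF⟩
    rw [← Set.encard_coe_eq_coe_finsetCard]
    exact Set.encard_le_encard hF
  · intro h
    obtain ⟨s, hs, hcard⟩ := Set.exists_subset_encard_eq h
    lift s to Finset ℕ using Set.finite_of_encard_eq_coe hcard
    exact ⟨s, by simpa [Set.encard_coe_eq_coe_finsetCard] using hcard, fun j hj => hs hj⟩

variable [MeasurableSpace Ω] {P : Measure Ω}

lemma survives_of_one_le_countNonzero
    (h : ∀ᵐ ω ∂P, ∀ t : Fin d → ℝ, t ≠ 0 → 1 ≤ countNonzero A t ω) : Survives P A :=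
  h.mono fun ω hω t ht => hasLargeImages_zero_iff_le_countNonzero.2 (by simpa using hω t ht)

variable [IsProbabilityMeasure P]

lemma measure_hasLargeImages_two_pos
    (h1 : ∀ᵐ ω ∂P, ∀ t : Fin d → ℝ, t ≠ 0 → 1 ≤ countNonzero A t ω)
    (h2 : ∀ t : Fin d → ℝ, t ≠ 0 → P {ω | countNonzero A t ω = 1} < 1)
    {t : Fin d → ℝ} (ht : t ≠ 0) : 0 < P {ω | HasLargeImages 0 2 (fun j => A j ω) t} := by
  refine pos_iff_ne_zero.2 fun hzero => (h2 t ht).not_ge ?_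
  have hnot : ∀ᵐ ω ∂P, ¬ HasLargeImages 0 2 (fun j => A j ω) t :=
    measure_eq_zero_iff_ae_notMem.1 hzero
  rw [← measure_univ (μ := P)]
  refine measure_mono_ae ?_
  filter_upwards [h1, hnot] with ω hone hω _
  rw [hasLargeImages_zero_iff_le_countNonzero, not_le] at hω
  exact le_antisymm (Order.le_of_lt_add_one (by simpa [one_add_one_eq_two] using hω)) (hone t ht)

lemma exists_radius_le_measureReal_hasLargeImages_two (hA : ∀ i, Measurable (A i))
    (h : ∀ t : Fin d → ℝ, t ≠ 0 → 0 < P {ω | HasLargeImages 0 2 (fun j => A j ω) t}) :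
    ∃ r : ℝ, 0 < r ∧ ∃ p : ℝ, 0 < p ∧ ∀ t : Fin d → ℝ, t ≠ 0 →
      p ≤ P.real {ω | HasLargeImages (‖t‖ * r) 2 (fun j => A j ω) t} := by
  have hlaw : ∀ r t, (P.map fun ω j => A j ω) {ℓ | HasLargeImages r 2 ℓ t}
      = P {ω | HasLargeImages r 2 (fun j => A j ω) t} := fun r t =>
    Measure.map_apply (measurable_pi_lambda _ hA) (measurableSet_hasLargeImages r 2 t)
  obtain ⟨r, hr, p, hp, hle⟩ := exists_radius_le_measure_hasLargeImages_of_ne_zero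
    (P.map fun ω j => A j ω) 2 (c := 0) ENNReal.zero_lt_top (by simpa only [hlaw] using h)
  refine ⟨r, hr, (min p 1).toReal, ENNReal.toReal_pos (by simp [hp.ne']) (by simp),
    fun t ht => ENNReal.toReal_mono (measure_ne_top _ _) ?_⟩
  exact (min_le_left _ _).trans ((hle t ht).trans_eq (hlaw _ t))

lemma measure_compl_hasLargeImages_le (hA : ∀ i, Measurable (A i)) {k : ℕ} {r p : ℝ}
    (hr : 0 ≤ r) {t : Fin d → ℝ} (h : p ≤ P.real {ω | HasLargeImages r k (fun j => A j ω) t}) :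
    P {ω | HasLargeImages 0 k (fun j => A j ω) t}ᶜ ≤ 1 - ENNReal.ofReal p := by
  have hmeas : MeasurableSet {ω | HasLargeImages 0 k (fun j => A j ω) t} :=
    (measurableSet_hasLargeImages 0 k t).preimage (measurable_pi_lambda _ hA)
  rw [prob_compl_eq_one_sub hmeas]
  exact tsub_le_tsub_left ((ENNReal.ofReal_le_of_le_toReal h).trans
    (measure_mono fun ω hω => hω.mono_radius hr)) _

end Branching

section UniformBound

variable {d : ℕ}

lemma integral_le_one_sub_mul {X : Type*} [MeasurableSpace X] {Q : Measure X}
    [IsProbabilityMeasure Q] {f : X → ℝ} (hf : Integrable f Q) (hf1 : ∀ x, f x ≤ 1) {E : Set X}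
    (hE : MeasurableSet E) {y p : ℝ} (hy : y ≤ 1) (hp : p ≤ Q.real E)
    (hfE : ∀ᵐ x ∂Q, x ∈ E → f x ≤ y) : ∫ x, f x ∂Q ≤ 1 - p * (1 - y) := by
  have hint : Integrable (E.indicator fun _ => 1 - y) Q := (integrable_const _).indicator hE
  calc ∫ x, f x ∂Q ≤ ∫ x, (1 - E.indicator (fun _ => 1 - y) x) ∂Q := by
        refine integral_mono_ae hf ((integrable_const _).sub hint) ?_
        filter_upwards [hfE] with x hx
        by_cases h : x ∈ E
        · simpa [h] using hx h
        · simpa [h] using hf1 x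
    _ = 1 - Q.real E * (1 - y) := by
        rw [integral_sub (integrable_const _) hint, integral_indicator_const _ hE]
        simp
    _ ≤ 1 - p * (1 - y) := by gcongr

section Moduli

variable (η : Measure (Fin d → ℝ)) [IsProbabilityMeasure η]

lemma integrable_norm_cf_sumLaw (Q : Measure (St d)) [IsFiniteMeasure Q] (t : Fin d → ℝ) :
    Integrable (fun ℓ => ‖cf (sumLaw η ℓ) t‖) Q := by
  refine Integrable.of_bound (C := 1)
    (measurable_cf_kernel (sumLaw η) t).norm.aestronglyMeasurable (ae_of_all _ fun ℓ => ?_)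
  rw [norm_norm]
  exact norm_cf_le_one _ _

lemma norm_cf_sumLaw_le_sq {ℓ : St d} (hℓ : ℓ ∈ finStates d) {r y : ℝ} {t : Fin d → ℝ}
    (hlarge : HasLargeImages r 2 ℓ t) (hsmall : ∀ k, opNorm (ℓ k) ≤ 1)
    (hy : ∀ u, r ≤ ‖u‖ → ‖u‖ ≤ ‖t‖ → ‖cf η u‖ ≤ y) : ‖cf (sumLaw η ℓ) t‖ ≤ y ^ 2 := by
  obtain ⟨F, hF, hFr⟩ := hlarge
  refine (norm_cf_sumLaw_le η hℓ t F).trans ?_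
  rw [← hF, ← Finset.prod_const]
  refine Finset.prod_le_prod (fun _ _ => norm_nonneg _) fun j hj => hy _ (hFr j hj).le ?_
  exact (norm_transpose_mulVec_le _ _).trans
    (mul_le_of_le_one_left (norm_nonneg _) (hsmall j))

lemma exists_forall_norm_cf_le_of_norm_le {t : Fin d → ℝ} (ht : 1 ≤ ‖t‖) :
    ∃ s : Fin d → ℝ, 1 ≤ ‖s‖ ∧ ‖s‖ ≤ ‖t‖ ∧
      ∀ u : Fin d → ℝ, 1 ≤ ‖u‖ → ‖u‖ ≤ ‖t‖ → ‖cf η u‖ ≤ ‖cf η s‖ := by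
  have hcompact : IsCompact (Metric.closedBall (0 : Fin d → ℝ) ‖t‖ ∩ {u | 1 ≤ ‖u‖}) :=
    (isCompact_closedBall _ _).inter_right (isClosed_le continuous_const continuous_norm)
  obtain ⟨s, ⟨hst, hs⟩, hmax⟩ :=
    hcompact.exists_isMaxOn ⟨t, by simp, ht⟩ (continuous_cf η).norm.continuousOn
  exact ⟨s, hs, by simpa using hst, fun u hu hut => hmax ⟨by simpa using hut, hu⟩⟩

lemma exists_norm_cf_le_of_norm_le (hlt : ∀ t : Fin d → ℝ, t ≠ 0 → ‖cf η t‖ < 1) (R : ℝ) :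
    ∃ x < 1, ∀ t : Fin d → ℝ, 1 ≤ ‖t‖ → ‖t‖ ≤ R → ‖cf η t‖ ≤ x := by
  have hcompact : IsCompact (Metric.closedBall (0 : Fin d → ℝ) R ∩ {u | 1 ≤ ‖u‖}) :=
    (isCompact_closedBall _ _).inter_right (isClosed_le continuous_const continuous_norm)
  obtain ⟨δ, hδ, hle⟩ := hcompact.exists_forall_le'
    (continuous_const.sub (continuous_cf η).norm).continuousOn
    fun t ht => sub_pos.2 (hlt t (norm_pos_iff.1 (one_pos.trans_le ht.2)))
  exact ⟨1 - δ, sub_lt_self 1 hδ, fun t ht htR =>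
    le_sub_comm.1 (hle t ⟨by simpa using htR, ht⟩)⟩

end Moduli

variable {Ω : Type*} [MeasurableSpace Ω] {P : Measure Ω} [IsProbabilityMeasure P] {N : Ω → ℕ}
  {A : ℕ → Ω → Mat d} {η : Measure (Fin d → ℝ)} [IsProbabilityMeasure η] {q : ℝ≥0∞}

lemma norm_cf_le_integral_step_pow (hA : IsWeightFamily P N A) (hη : smoothing P N A η = η)
    (n : ℕ) (t : Fin d → ℝ) :
    ‖cf η t‖ ≤ ∫ ℓ, ‖cf (sumLaw η ℓ) t‖ ∂((step P A ^ n) (root d)) := by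
  have := isMarkovKernel_step P hA.measurable
  conv_lhs => rw [← bind_step_pow_root hA hη n, cf_bind]
  exact norm_integral_le_integral_norm _

lemma exists_step_pow_three_fifths_le (hA : ∀ i, Measurable (A i)) (hne : Survives P A)
    (hgen : HasSmallGenerations P A) (hq1 : q < 1)
    (hq : ∀ t : Fin d → ℝ, t ≠ 0 → P {ω | HasLargeImages 0 2 (fun j => A j ω) t}ᶜ ≤ q) :
    ∃ n : ℕ, ∃ r : ℝ, 0 < r ∧ ∀ t : Fin d → ℝ, t ≠ 0 →
      3 / 5 ≤ ((step P A ^ n) (root d)).real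
        {ℓ | HasLargeImages (‖t‖ * r) 2 ℓ t ∧ ∀ k, opNorm (ℓ k) ≤ 1} := by
  have := isMarkovKernel_step P hA
  obtain ⟨m, hm⟩ :=
    exists_forall_pow_compl_hasLargeImages_le hA hne hq1 hq
      (ε := ENNReal.ofReal (1 / 10)) (by simp) 2
  obtain ⟨n, hmn, hn⟩ := hgen m 1 one_pos (ENNReal.ofReal (1 / 5)) (by simp)
  set Q := (step P A ^ n) (root d)
  have hlarge : ∀ t : Fin d → ℝ, t ≠ 0 →
      ENNReal.ofReal (4 / 5) < Q {ℓ | HasLargeImages 0 2 ℓ t} := by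
    intro t ht
    have hcompl := ENNReal.toReal_le_of_le_ofReal (by norm_num)
      (hm n hmn t _ (hasLargeImages_root ht))
    rw [← measureReal_def, probReal_compl_eq_one_sub (measurableSet_hasLargeImages 0 2 t)]
      at hcompl
    rw [ENNReal.ofReal_lt_iff_lt_toReal (by norm_num) (measure_ne_top _ _), ← measureReal_def]
    linarith
  obtain ⟨r, hr, b, hb, h⟩ :=
    exists_radius_le_measure_hasLargeImages_of_ne_zero Q 2 ENNReal.ofReal_lt_top hlarge
  refine ⟨n, r, hr, fun t ht => ?_⟩
  have hradius : 4 / 5 ≤ Q.real {ℓ | HasLargeImages (‖t‖ * r) 2 ℓ t} :=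
    (ENNReal.ofReal_le_iff_le_toReal (measure_ne_top _ _)).1 (hb.le.trans (h t ht))
  have hnorm : Q.real {ℓ | ∃ k, 1 < opNorm (ℓ k)} ≤ 1 / 5 :=
    ENNReal.toReal_le_of_le_ofReal (by norm_num) hn
  have hdiff := le_measureReal_sdiff (μ := Q) (s₁ := {ℓ | HasLargeImages (‖t‖ * r) 2 ℓ t})
    (s₂ := {ℓ | ∃ k, 1 < opNorm (ℓ k)})
  have hset : {ℓ | HasLargeImages (‖t‖ * r) 2 ℓ t} \ {ℓ | ∃ k, 1 < opNorm (ℓ k)}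
      = {ℓ | HasLargeImages (‖t‖ * r) 2 ℓ t ∧ ∀ k, opNorm (ℓ k) ≤ 1} := by
    ext ℓ; simp
  rw [hset] at hdiff
  linarith

lemma measurableSet_hasLargeImages_and_opNorm_le (r : ℝ) (k : ℕ) (t : Fin d → ℝ) (c : ℝ) :
    MeasurableSet {ℓ : St d | HasLargeImages r k ℓ t ∧ ∀ j, opNorm (ℓ j) ≤ c} := by
  have hnorm : MeasurableSet {ℓ : St d | ∀ j, opNorm (ℓ j) ≤ c} := by
    rw [Set.ofPred_forall]
    exact .iInter fun j => (isClosed_le (by fun_prop) continuous_const).measurableSet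
  exact (measurableSet_hasLargeImages r k t).inter hnorm

-- If `|cf η|` on `1 ≤ ‖u‖ ≤ ‖t‖` peaks at `s` with value `y`, then for large `s` the two particles
-- of a suitable generation give `y ≤ 1 - 3/5 * (1 - y ^ 2)`, so that `y ≤ 2/3`.
lemma exists_norm_cf_le_of_one_le_norm (hA : IsWeightFamily P N A) (hne : Survives P A)
    (hgen : HasSmallGenerations P A) (hq1 : q < 1)
    (hq : ∀ t : Fin d → ℝ, t ≠ 0 → P {ω | HasLargeImages 0 2 (fun j => A j ω) t}ᶜ ≤ q)
    (hη : smoothing P N A η = η) (hlt : ∀ t : Fin d → ℝ, t ≠ 0 → ‖cf η t‖ < 1) :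
    ∃ ρ < 1, ∀ t : Fin d → ℝ, 1 ≤ ‖t‖ → ‖cf η t‖ ≤ ρ := by
  have := isMarkovKernel_step P hA.measurable
  obtain ⟨n, r, hr, hgood⟩ := exists_step_pow_three_fifths_le hA.measurable hne hgen hq1 hq
  obtain ⟨x, hx1, hx⟩ := exists_norm_cf_le_of_norm_le η hlt (1 / r)
  refine ⟨max x (2 / 3), max_lt hx1 (by norm_num), fun t ht => ?_⟩
  obtain ⟨s, hs, hst, hmax⟩ := exists_forall_norm_cf_le_of_norm_le η ht
  refine (hmax t ht le_rfl).trans ?_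
  rcases le_or_gt ‖s‖ (1 / r) with hsr | hsr
  · exact (hx s hs hsr).trans (le_max_left _ _)
  refine le_max_of_le_right ?_
  have hs0 : s ≠ 0 := norm_pos_iff.1 (one_pos.trans_le hs)
  have hsr1 : 1 ≤ ‖s‖ * r := ((div_lt_iff₀ hr).1 hsr).le
  have hy0 := norm_nonneg (cf η s)
  have hy1 := hlt s hs0
  have hcontract : ‖cf η s‖ ≤ 1 - 3 / 5 * (1 - ‖cf η s‖ ^ 2) := by
    refine (norm_cf_le_integral_step_pow hA hη n s).trans (integral_le_one_sub_mul
      (integrable_norm_cf_sumLaw η _ s) (fun _ => norm_cf_le_one _ _)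
      (measurableSet_hasLargeImages_and_opNorm_le _ 2 s 1) (by nlinarith) (hgood s hs0) ?_)
    filter_upwards [(isAbsorbing_finStates hA).ae_pow_mem n root_mem_finStates]
      with ℓ hℓ ⟨hlarge, hsmall⟩
    exact norm_cf_sumLaw_le_sq η hℓ hlarge hsmall fun u hu hus =>
      hmax u (hsr1.trans hu) (hus.trans hst)
  nlinarith

end UniformBound

section NegativeMoments

variable {d : ℕ}

lemma l1_smul (c : ℝ) (x : Fin d → ℝ) : l1 (c • x) = |c| * l1 x := by
  simp [l1, abs_mul, Finset.mul_sum]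

lemma l1_nonneg (x : Fin d → ℝ) : 0 ≤ l1 x := Finset.sum_nonneg fun _ _ => abs_nonneg _

lemma norm_le_l1 (x : Fin d → ℝ) : ‖x‖ ≤ l1 x :=
  (pi_norm_le_iff_of_nonneg (l1_nonneg x)).2 fun i =>
    Finset.single_le_sum (f := fun i => |x i|) (fun _ _ => abs_nonneg _) (Finset.mem_univ i)

lemma l1_le_card_mul_norm (x : Fin d → ℝ) : l1 x ≤ d * ‖x‖ := by
  have hsum : ∑ i, |x i| ≤ ∑ _ : Fin d, ‖x‖ := Finset.sum_le_sum fun i _ => norm_le_pi_norm x i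
  simpa [l1] using hsum

lemma measurable_l1 : Measurable (l1 (d := d)) := by
  unfold l1
  fun_prop

lemma norm_div_norm_rpow_neg_le_l1 {ε : ℝ} (hε : 0 ≤ ε) {x u : Fin d → ℝ} (hx : x ≠ 0)
    (hu : l1 u = 1) : (‖x‖ / ‖u‖) ^ (-ε) ≤ d ^ ε * l1 x ^ (-ε) := by
  have hu0 : u ≠ 0 := by
    rintro rfl
    simp [l1] at hu
  have hx0 : 0 < l1 x := (norm_pos_iff.2 hx).trans_le (norm_le_l1 x)
  have hd : (0 : ℝ) < d :=
    pos_of_mul_pos_left (hx0.trans_le (l1_le_card_mul_norm x)) (norm_nonneg x)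
  calc (‖x‖ / ‖u‖) ^ (-ε) ≤ (l1 x / d) ^ (-ε) := by
        refine Real.rpow_le_rpow_of_nonpos (by positivity) ?_ (neg_nonpos.2 hε)
        rw [div_le_div_iff₀ hd (norm_pos_iff.2 hu0), mul_comm ‖x‖]
        calc l1 x * ‖u‖ ≤ l1 x * 1 := by gcongr; exact (norm_le_l1 u).trans_eq hu
          _ = l1 x := mul_one _
          _ ≤ d * ‖x‖ := l1_le_card_mul_norm x
    _ = d ^ ε * l1 x ^ (-ε) := by
        rw [Real.div_rpow hx0.le hd.le, Real.rpow_neg hd.le, div_inv_eq_mul, mul_comm]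

variable {Ω : Type*} [MeasurableSpace Ω] {P : Measure Ω} {A : ℕ → Ω → Mat d}

/-- In each direction some randomly chosen weight is almost surely nondegenerate, and the
`(-ε)`-th moment of its stretching factor is at most `M`. -/
def HasNegativeMoment (P : Measure Ω) (A : ℕ → Ω → Mat d) (ε M : ℝ) : Prop :=
  ∀ t : Fin d → ℝ, t ≠ 0 → ∃ i : Ω → ℕ, (∀ᵐ ω ∂P, (A (i ω) ω)ᵀ *ᵥ t ≠ 0) ∧
    Integrable (fun ω => (‖(A (i ω) ω)ᵀ *ᵥ t‖ / ‖t‖) ^ (-ε)) P ∧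
    ∫ ω, (‖(A (i ω) ω)ᵀ *ᵥ t‖ / ‖t‖) ^ (-ε) ∂P ≤ M

lemma hasNegativeMoment_of_l1_eq_one {ε M : ℝ}
    (h : ∀ u : Fin d → ℝ, l1 u = 1 → ∃ i : Ω → ℕ, (∀ᵐ ω ∂P, (A (i ω) ω)ᵀ *ᵥ u ≠ 0) ∧
      Integrable (fun ω => (‖(A (i ω) ω)ᵀ *ᵥ u‖ / ‖u‖) ^ (-ε)) P ∧
      ∫ ω, (‖(A (i ω) ω)ᵀ *ᵥ u‖ / ‖u‖) ^ (-ε) ∂P ≤ M) : HasNegativeMoment P A ε M := by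
  intro t ht
  have hl : 0 < l1 t := (norm_pos_iff.2 ht).trans_le (norm_le_l1 t)
  obtain ⟨i, hne, hint, hle⟩ := h ((l1 t)⁻¹ • t) (by
    rw [l1_smul, abs_of_pos (inv_pos.2 hl), inv_mul_cancel₀ hl.ne'])
  have hratio : ∀ ω, ‖(A (i ω) ω)ᵀ *ᵥ ((l1 t)⁻¹ • t)‖ / ‖(l1 t)⁻¹ • t‖
      = ‖(A (i ω) ω)ᵀ *ᵥ t‖ / ‖t‖ := fun ω => by
    rw [Matrix.mulVec_smul, norm_smul, norm_smul,
      mul_div_mul_left _ _ (norm_ne_zero_iff.2 (inv_ne_zero hl.ne'))]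
  simp only [hratio] at hint hle
  refine ⟨i, hne.mono fun ω hω h0 => hω ?_, hint, hle⟩
  rw [Matrix.mulVec_smul, h0, smul_zero]

lemma exists_hasNegativeMoment (hA : ∀ i, Measurable (A i))
    (h : ∃ ε : ℝ, 0 < ε ∧ ∃ i : (Fin d → ℝ) → Ω → ℕ,
      (∀ t, l1 t = 1 → Measurable (i t) ∧ ∀ᵐ ω ∂P, (A (i t ω) ω)ᵀ *ᵥ t ≠ 0) ∧
      (⨆ (t : Fin d → ℝ) (_ : l1 t = 1),
        ∫⁻ ω, ENNReal.ofReal (l1 ((A (i t ω) ω)ᵀ *ᵥ t)) ^ (-ε) ∂P) < ⊤) :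
    ∃ ε : ℝ, 0 < ε ∧ ∃ M : ℝ, 0 ≤ M ∧ HasNegativeMoment P A ε M := by
  obtain ⟨ε, hε, i, hi, hsup⟩ := h
  set S := ⨆ (t : Fin d → ℝ) (_ : l1 t = 1),
    ∫⁻ ω, ENNReal.ofReal (l1 ((A (i t ω) ω)ᵀ *ᵥ t)) ^ (-ε) ∂P
  refine ⟨ε, hε, d ^ ε * S.toReal, by positivity, hasNegativeMoment_of_l1_eq_one fun u hu => ?_⟩
  obtain ⟨hmeas, hne⟩ := hi u hu
  set X := fun ω => (A (i u ω) ω)ᵀ *ᵥ u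
  have hX : Measurable X :=
    measurable_apply_nat_index hmeas (f := fun n ω => (A n ω)ᵀ *ᵥ u) fun n => by fun_prop
  have hpow : AEMeasurable (fun ω => ENNReal.ofReal (l1 (X ω)) ^ (-ε)) P :=
    ((measurable_l1.comp hX).ennreal_ofReal.pow_const _).aemeasurable
  have hle := le_iSup₂_of_le (f := fun (t : Fin d → ℝ) (_ : l1 t = 1) =>
    ∫⁻ ω, ENNReal.ofReal (l1 ((A (i t ω) ω)ᵀ *ᵥ t)) ^ (-ε) ∂P) u hu le_rfl
  have htop := (hle.trans_lt hsup).ne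
  have hreal : ∀ ω, (ENNReal.ofReal (l1 (X ω)) ^ (-ε)).toReal = l1 (X ω) ^ (-ε) := fun ω => by
    rw [← ENNReal.toReal_rpow, ENNReal.toReal_ofReal (l1_nonneg _)]
  have hint : Integrable (fun ω => (d : ℝ) ^ ε * l1 (X ω) ^ (-ε)) P := by
    simpa only [hreal] using (integrable_toReal_of_lintegral_ne_top hpow htop).const_mul _
  have hbound : ∀ᵐ ω ∂P, (‖X ω‖ / ‖u‖) ^ (-ε) ≤ d ^ ε * l1 (X ω) ^ (-ε) :=
    hne.mono fun ω hω => norm_div_norm_rpow_neg_le_l1 hε.le hω hu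
  have hratio : Integrable (fun ω => (‖X ω‖ / ‖u‖) ^ (-ε)) P :=
    hint.mono' ((hX.norm.div_const _).pow_const _).aestronglyMeasurable
      (hbound.mono fun ω hω => by rwa [Real.norm_of_nonneg (by positivity)])
  refine ⟨i u, hne, hratio, (integral_mono_ae hratio hint hbound).trans ?_⟩
  rw [integral_const_mul]
  simp only [← hreal]
  rw [integral_toReal hpow (ae_lt_top' hpow htop)]
  gcongr
  exact hsup.ne

end NegativeMoments

section Decay

lemma min_rpow_le_min_mul_rpow_mul {a ε s X T : ℝ} (ha : 0 < a) (haε : a ≤ ε) (hs : 0 < s)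
    (hX : 0 < X) (hT : 0 < T) :
    min s T ^ a ≤ min (s * X) T ^ a * (1 + a / ε * X ^ (-ε)) := by
  have hε : 0 < ε := ha.trans_le haε
  have hm : 0 < min s T := lt_min hs hT
  rcases le_total 1 X with h | h
  · calc min s T ^ a ≤ min (s * X) T ^ a := by
          gcongr
          exact le_mul_of_one_le_right hs.le h
      _ ≤ min (s * X) T ^ a * (1 + a / ε * X ^ (-ε)) :=
          le_mul_of_one_le_right (by positivity) (le_add_of_nonneg_right (by positivity))
  · have hmin : min s T * X ≤ min (s * X) T :=
      le_min (by gcongr; exact min_le_left _ _)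
        ((mul_le_of_le_one_right hm.le h).trans (min_le_right _ _))
    have hbernoulli : X ^ (-a) ≤ 1 + a / ε * X ^ (-ε) := by
      have hXε : 0 ≤ X ^ (-ε) := by positivity
      have hpow := rpow_one_add_le_one_add_mul_self (s := X ^ (-ε) - 1) (by linarith)
        (p := a / ε) (by positivity) ((div_le_one hε).2 haε)
      rw [add_sub_cancel, ← Real.rpow_mul hX.le, neg_mul, mul_div_cancel₀ _ hε.ne'] at hpow
      refine hpow.trans ?_
      gcongr
      linarith
    calc min s T ^ a = (min s T * X) ^ a * X ^ (-a) := by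
          rw [Real.mul_rpow hm.le hX.le, mul_assoc, ← Real.rpow_add hX]
          simp
      _ ≤ min (s * X) T ^ a * (1 + a / ε * X ^ (-ε)) := by gcongr

lemma le_of_forall_le_max_mul {X : Type*} {f : X → ℝ} (hf : BddAbove (Set.range f))
    {q C : ℝ} (hq : q < 1) (hC : 0 ≤ C)
    (h : ∀ S, (∀ x, f x ≤ S) → ∀ x, f x ≤ max C (q * S)) (x : X) : f x ≤ C := by
  have : Nonempty X := ⟨x⟩
  have hle : ∀ y, f y ≤ ⨆ z, f z := le_ciSup hf
  refine (hle x).trans ?_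
  rcases le_max_iff.1 (ciSup_le (h _ hle)) with hsup | hsup
  · exact hsup
  · nlinarith

lemma exists_pos_le_div_mul_lt {ε M c : ℝ} (hε : 0 < ε) (hM : 0 ≤ M) (hc : 0 < c) :
    ∃ a : ℝ, 0 < a ∧ a ≤ ε ∧ a / ε * M < c := by
  refine ⟨min ε (ε * (c / (M + 1))), by positivity, min_le_left _ _, ?_⟩
  calc min ε (ε * (c / (M + 1))) / ε * M ≤ ε * (c / (M + 1)) / ε * M := by
        gcongr
        exact min_le_right _ _
    _ = c * (M / (M + 1)) := by field_simp
    _ < c := mul_lt_of_lt_one_right hc ((div_lt_one (by linarith)).2 (by linarith))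

variable {d : ℕ} {η : Measure (Fin d → ℝ)}

/-- The quantity `‖t‖ ^ a * |cf η t|`, with `‖t‖` truncated at `T` to make it bounded in `t`. -/
def truncatedCf (η : Measure (Fin d → ℝ)) (a T : ℝ) (t : Fin d → ℝ) : ℝ :=
  min ‖t‖ T ^ a * ‖cf η t‖

lemma truncatedCf_nonneg (a : ℝ) {T : ℝ} (hT : 0 ≤ T) (t : Fin d → ℝ) :
    0 ≤ truncatedCf η a T t :=
  mul_nonneg (Real.rpow_nonneg (le_min (norm_nonneg _) hT) _) (norm_nonneg _)

lemma min_rpow_mul_le_of_truncatedCf_le {a ε T S ξ y : ℝ} (ha : 0 < a) (haε : a ≤ ε)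
    (hT : 0 < T) {t u : Fin d → ℝ} (ht : t ≠ 0) (hu : u ≠ 0) (hS : truncatedCf η a T u ≤ S)
    (hξ0 : 0 ≤ ξ) (hξ1 : ξ ≤ 1) (hy : y ≤ ξ * ‖cf η u‖) :
    min ‖t‖ T ^ a * y ≤ S * (ξ + a / ε * (‖u‖ / ‖t‖) ^ (-ε)) := by
  have htn : 0 < ‖t‖ := norm_pos_iff.2 ht
  have hε : 0 < ε := ha.trans_le haε
  set X := ‖u‖ / ‖t‖
  have hX : 0 < X := div_pos (norm_pos_iff.2 hu) htn
  have hXt : ‖t‖ * X = ‖u‖ := mul_div_cancel₀ _ htn.ne'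
  calc min ‖t‖ T ^ a * y ≤ min ‖t‖ T ^ a * (ξ * ‖cf η u‖) := by gcongr
    _ ≤ min ‖u‖ T ^ a * (1 + a / ε * X ^ (-ε)) * (ξ * ‖cf η u‖) := by
        gcongr
        exact hXt ▸ min_rpow_le_min_mul_rpow_mul ha haε htn hX hT
    _ = truncatedCf η a T u * (ξ + ξ * (a / ε * X ^ (-ε))) := by rw [truncatedCf]; ring
    _ ≤ S * (ξ + a / ε * X ^ (-ε)) :=
        mul_le_mul hS (add_le_add_right (mul_le_of_le_one_left (by positivity) hξ1) ξ)
          (by positivity) ((truncatedCf_nonneg a hT.le u).trans hS)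

variable [IsProbabilityMeasure η]

lemma truncatedCf_le {a R : ℝ} (ha : 0 ≤ a) {T : ℝ} (hT : 0 ≤ T) {t : Fin d → ℝ}
    (h : min ‖t‖ T ≤ R) : truncatedCf η a T t ≤ R ^ a := by
  have hmin : 0 ≤ min ‖t‖ T := le_min (norm_nonneg _) hT
  exact (mul_le_of_le_one_right (Real.rpow_nonneg hmin a) (norm_cf_le_one η t)).trans
    (Real.rpow_le_rpow hmin h ha)

/-- The factor by which a second particle, at distance at least one from the origin, damps the
characteristic function when the latter is at most `ρ` there. -/
def damping (ρ : ℝ) (t : Fin d → ℝ) (ℓ : St d) : ℝ :=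
  1 - {ℓ | HasLargeImages 1 2 ℓ t}.indicator (fun _ => 1 - ρ) ℓ

lemma integrable_damping_comp {X : Type*} [MeasurableSpace X] {Q : Measure X} [IsFiniteMeasure Q]
    {ℓ : X → St d} (hℓ : Measurable ℓ) (ρ : ℝ) (t : Fin d → ℝ) :
    Integrable (fun x => damping ρ t (ℓ x)) Q :=
  (integrable_const _).sub
    ((integrable_const _).indicator (hℓ (measurableSet_hasLargeImages 1 2 t)))

lemma damping_of_hasLargeImages {ρ : ℝ} {t : Fin d → ℝ} {ℓ : St d}
    (h : HasLargeImages 1 2 ℓ t) : damping ρ t ℓ = ρ := by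
  have hmem : ℓ ∈ {ℓ | HasLargeImages 1 2 ℓ t} := h
  simp [damping, Set.indicator_of_mem hmem]

lemma damping_of_not_hasLargeImages {ρ : ℝ} {t : Fin d → ℝ} {ℓ : St d}
    (h : ¬ HasLargeImages 1 2 ℓ t) : damping ρ t ℓ = 1 := by
  have hmem : ℓ ∉ {ℓ | HasLargeImages 1 2 ℓ t} := h
  simp [damping, Set.indicator_of_notMem hmem]

lemma damping_nonneg {ρ : ℝ} (hρ : 0 ≤ ρ) (t : Fin d → ℝ) (ℓ : St d) : 0 ≤ damping ρ t ℓ := by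
  by_cases h : HasLargeImages 1 2 ℓ t
  · rwa [damping_of_hasLargeImages h]
  · simp [damping_of_not_hasLargeImages h]

lemma damping_le_one {ρ : ℝ} (hρ : ρ ≤ 1) (t : Fin d → ℝ) (ℓ : St d) : damping ρ t ℓ ≤ 1 := by
  by_cases h : HasLargeImages 1 2 ℓ t
  · rwa [damping_of_hasLargeImages h]
  · simp [damping_of_not_hasLargeImages h]

lemma norm_cf_sumLaw_le_damping_mul {ρ : ℝ} (hρ : ∀ u : Fin d → ℝ, 1 ≤ ‖u‖ → ‖cf η u‖ ≤ ρ)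
    {ℓ : St d} (hℓ : ℓ ∈ finStates d) (t : Fin d → ℝ) (i : ℕ) :
    ‖cf (sumLaw η ℓ) t‖ ≤ damping ρ t ℓ * ‖cf η ((ℓ i)ᵀ *ᵥ t)‖ := by
  by_cases h : HasLargeImages 1 2 ℓ t
  · rw [damping_of_hasLargeImages h]
    obtain ⟨F, hF, hFlarge⟩ := h
    obtain ⟨j, hj, hji⟩ := Finset.exists_mem_ne (by omega : 1 < F.card) i
    calc ‖cf (sumLaw η ℓ) t‖ ≤ ‖cf η ((ℓ j)ᵀ *ᵥ t)‖ * ‖cf η ((ℓ i)ᵀ *ᵥ t)‖ :=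
          (norm_cf_sumLaw_le η hℓ t {j, i}).trans_eq (Finset.prod_pair hji)
      _ ≤ ρ * ‖cf η ((ℓ i)ᵀ *ᵥ t)‖ := by
          gcongr
          exact hρ _ (hFlarge j hj).le
  · rw [damping_of_not_hasLargeImages h, one_mul]
    exact (norm_cf_sumLaw_le η hℓ t {i}).trans_eq (Finset.prod_singleton _ _)

variable {Ω : Type*} [MeasurableSpace Ω] {P : Measure Ω} [IsProbabilityMeasure P] {N : Ω → ℕ}
  {A : ℕ → Ω → Mat d}

lemma truncatedCf_le_mul (hA : IsWeightFamily P N A) (hη : smoothing P N A η = η)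
    {a ε T M S p ρ : ℝ} (ha : 0 < a) (haε : a ≤ ε) (hT : 0 < T) (hneg : HasNegativeMoment P A ε M)
    (hρ1 : ρ ≤ 1) (hρ : ∀ u : Fin d → ℝ, 1 ≤ ‖u‖ → ‖cf η u‖ ≤ ρ)
    (hS : ∀ u, truncatedCf η a T u ≤ S) {t : Fin d → ℝ} (ht : t ≠ 0)
    (hp : p ≤ P.real {ω | HasLargeImages 1 2 (fun j => A j ω) t}) :
    truncatedCf η a T t ≤ (1 - p * (1 - ρ) + a / ε * M) * S := by
  have hρ0 : 0 ≤ ρ := (norm_nonneg _).trans (hρ (‖t‖⁻¹ • t) (by simp [norm_smul, ht]))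
  have hS0 : 0 ≤ S := (truncatedCf_nonneg a hT.le 0).trans (hS 0)
  have hε : 0 < ε := ha.trans_le haε
  have hmeas : Measurable fun ω j => A j ω := measurable_pi_lambda _ hA.measurable
  obtain ⟨i, hne, hint, hM⟩ := hneg t ht
  set D := fun ω => damping ρ t fun j => A j ω
  have hD : Integrable D P := integrable_damping_comp hmeas ρ t
  have hDle : ∫ ω, D ω ∂P ≤ 1 - p * (1 - ρ) :=
    integral_le_one_sub_mul hD (fun ω => damping_le_one hρ1 t _)
      (hmeas (measurableSet_hasLargeImages 1 2 t)) hρ1 hp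
      (ae_of_all _ fun ω hω => (damping_of_hasLargeImages hω).le)
  set Y := fun ω => (‖(A (i ω) ω)ᵀ *ᵥ t‖ / ‖t‖) ^ (-ε)
  have hpointwise : ∀ᵐ ω ∂P, min ‖t‖ T ^ a * ‖∏ j ∈ Finset.range (N ω), cf η ((A j ω)ᵀ *ᵥ t)‖
      ≤ S * (D ω + a / ε * Y ω) := by
    filter_upwards [hne, hA.ae_eq_zero] with ω hω h0
    refine min_rpow_mul_le_of_truncatedCf_le ha haε hT ht hω (hS _) (damping_nonneg hρ0 t _)
      (damping_le_one hρ1 t _) ?_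
    rw [← cf_sumLaw η (ℓ := fun j => A j ω) fun k hk => h0 k (by simpa using hk)]
    exact norm_cf_sumLaw_le_damping_mul hρ ⟨N ω, h0⟩ t (i ω)
  calc truncatedCf η a T t
      ≤ min ‖t‖ T ^ a * ∫ ω, ‖∏ j ∈ Finset.range (N ω), cf η ((A j ω)ᵀ *ᵥ t)‖ ∂P := by
        unfold truncatedCf
        gcongr
        exact norm_cf_le_integral_norm_prod hA.measurable_card hA.measurable hη t
    _ = ∫ ω, min ‖t‖ T ^ a * ‖∏ j ∈ Finset.range (N ω), cf η ((A j ω)ᵀ *ᵥ t)‖ ∂P :=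
        (integral_const_mul _ _).symm
    _ ≤ ∫ ω, S * (D ω + a / ε * Y ω) ∂P :=
        integral_mono_ae ((integrable_norm_prod_cf hA.measurable_card hA.measurable t).const_mul _)
          ((hD.add (hint.const_mul _)).const_mul _) hpointwise
    _ = (∫ ω, D ω ∂P + a / ε * ∫ ω, Y ω ∂P) * S := by
        rw [integral_const_mul, integral_add hD (hint.const_mul _), integral_const_mul, mul_comm]
    _ ≤ (1 - p * (1 - ρ) + a / ε * M) * S := by gcongr

-- For small `a` the supremum `S` of `truncatedCf η a T` satisfies `S ≤ max ((1 / r) ^ a) (q * S)`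
-- with some `q < 1`, and the resulting bound `S ≤ (1 / r) ^ a` does not involve `T`.
lemma exists_rpow_mul_norm_cf_le (hA : IsWeightFamily P N A) (hη : smoothing P N A η = η)
    {ε M p ρ r : ℝ} (hε : 0 < ε) (hM : 0 ≤ M) (hneg : HasNegativeMoment P A ε M) (hρ1 : ρ < 1)
    (hρ : ∀ u : Fin d → ℝ, 1 ≤ ‖u‖ → ‖cf η u‖ ≤ ρ) (hr : 0 < r) (hp : 0 < p)
    (hlarge : ∀ t : Fin d → ℝ, t ≠ 0 →
      p ≤ P.real {ω | HasLargeImages (‖t‖ * r) 2 (fun j => A j ω) t}) :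
    ∃ a : ℝ, 0 < a ∧ ∃ C : ℝ, ∀ t : Fin d → ℝ, ‖t‖ ^ a * ‖cf η t‖ ≤ C := by
  obtain ⟨a, ha, haε, hlt⟩ := exists_pos_le_div_mul_lt hε hM (mul_pos hp (sub_pos.2 hρ1))
  have htruncated : ∀ T : ℝ, 0 < T → ∀ t : Fin d → ℝ, truncatedCf η a T t ≤ (1 / r) ^ a := by
    intro T hT
    refine le_of_forall_le_max_mul (q := 1 - p * (1 - ρ) + a / ε * M)
      ⟨T ^ a, Set.forall_mem_range.2 fun t => truncatedCf_le ha.le hT.le (min_le_right _ _)⟩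
      (by linarith) (by positivity) fun S hS t => ?_
    rcases le_or_gt ‖t‖ (1 / r) with ht | ht
    · exact le_max_of_le_left (truncatedCf_le ha.le hT.le ((min_le_left _ _).trans ht))
    · have ht0 : t ≠ 0 := norm_pos_iff.1 ((one_div_pos.2 hr).trans ht)
      have hp1 : p ≤ P.real {ω | HasLargeImages 1 2 (fun j => A j ω) t} :=
        (hlarge t ht0).trans
          (measureReal_mono fun ω hω => hω.mono_radius ((div_lt_iff₀ hr).1 ht).le)
      exact le_max_of_le_right (truncatedCf_le_mul hA hη ha haε hT hneg hρ1.le hρ hS ht0 hp1)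
  refine ⟨a, ha, (1 / r) ^ a, fun t => ?_⟩
  rcases eq_or_ne t 0 with rfl | ht
  · rw [norm_zero, Real.zero_rpow ha.ne', zero_mul]
    positivity
  · simpa [truncatedCf] using htruncated ‖t‖ (norm_pos_iff.2 ht) t

end Decay

section Density

lemma absolutelyContinuous_of_norm_rpow_mul_norm_cf_le {ι : Type*} [Fintype ι]
    (η : Measure (ι → ℝ)) [IsProbabilityMeasure η] {b C : ℝ} (hb : Fintype.card ι < b)
    (h : ∀ t : ι → ℝ, ‖t‖ ^ b * ‖cf η t‖ ≤ C) : η ≪ (volume : Measure (ι → ℝ)) := by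
  have hb0 : 0 ≤ b := (Nat.cast_nonneg _).trans hb.le
  have hbound : ∀ t : ι → ℝ, ‖cf η t‖ ≤ 2 ^ b * max 1 C * (1 + ‖t‖) ^ (-b) := fun t => by
    have ht : 0 < 1 + ‖t‖ := by positivity
    rw [Real.rpow_neg ht.le, ← div_eq_mul_inv, le_div_iff₀ (by positivity), mul_comm]
    rcases le_total ‖t‖ 1 with h1 | h1
    · calc (1 + ‖t‖) ^ b * ‖cf η t‖ ≤ 2 ^ b * 1 := by
            gcongr
            · linarith
            · exact norm_cf_le_one η t
        _ ≤ 2 ^ b * max 1 C := by gcongr; exact le_max_left _ _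
    · calc (1 + ‖t‖) ^ b * ‖cf η t‖ ≤ (2 * ‖t‖) ^ b * ‖cf η t‖ := by gcongr; linarith
        _ = 2 ^ b * (‖t‖ ^ b * ‖cf η t‖) := by
            rw [Real.mul_rpow zero_le_two (norm_nonneg t), mul_assoc]
        _ ≤ 2 ^ b * max 1 C := by gcongr; exact (h t).trans (le_max_right _ _)
  have hint : Integrable fun t : ι → ℝ => 2 ^ b * max 1 C * (1 + ‖t‖) ^ (-b) :=
    (integrable_one_add_norm (by simpa using hb)).const_mul _
  exact absolutelyContinuous_of_integrable_cf η
    (hint.mono' (continuous_cf η).aestronglyMeasurable (ae_of_all _ hbound))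

variable {d : ℕ} {η : Measure (Fin d → ℝ)} [IsProbabilityMeasure η] {a C : ℝ}

lemma norm_rpow_mul_norm_cf_sumLaw_le (ha : 0 ≤ a) (h : ∀ t, ‖t‖ ^ a * ‖cf η t‖ ≤ C) {ℓ : St d}
    (hℓ : ℓ ∈ finStates d) {r : ℝ} (hr : 0 < r) {k : ℕ} {t : Fin d → ℝ}
    (hlarge : HasLargeImages (‖t‖ * r) k ℓ t) :
    ‖t‖ ^ (a * k) * ‖cf (sumLaw η ℓ) t‖ ≤ (C / r ^ a) ^ k := by
  obtain ⟨F, rfl, hF⟩ := hlarge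
  rw [Real.rpow_mul (norm_nonneg t), Real.rpow_natCast]
  calc (‖t‖ ^ a) ^ F.card * ‖cf (sumLaw η ℓ) t‖
      ≤ (‖t‖ ^ a) ^ F.card * ∏ j ∈ F, ‖cf η ((ℓ j)ᵀ *ᵥ t)‖ := by
        gcongr
        exact norm_cf_sumLaw_le η hℓ t F
    _ = ∏ j ∈ F, ‖t‖ ^ a * ‖cf η ((ℓ j)ᵀ *ᵥ t)‖ := by
        rw [Finset.prod_mul_distrib, Finset.prod_const]
    _ ≤ ∏ _j ∈ F, C / r ^ a := by
        refine Finset.prod_le_prod (fun _ _ => by positivity) fun j hj => ?_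
        rw [le_div_iff₀ (by positivity), mul_right_comm, ← Real.mul_rpow (norm_nonneg t) hr.le]
        refine le_trans ?_ (h ((ℓ j)ᵀ *ᵥ t))
        gcongr
        exact (hF j hj).le
    _ = (C / r ^ a) ^ F.card := Finset.prod_const _

lemma absolutelyContinuous_sumLaw (ha : 0 ≤ a) (h : ∀ t, ‖t‖ ^ a * ‖cf η t‖ ≤ C) {k : ℕ}
    (hk : d < a * k) {ℓ : St d} (hℓ : ℓ ∈ finStates d)
    (hlarge : ∀ t : Fin d → ℝ, t ≠ 0 → HasLargeImages 0 k ℓ t) : sumLaw η ℓ ≪ volume := by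
  have hk0 : 0 < a * k := (Nat.cast_nonneg d).trans_lt hk
  have hC : 0 ≤ C := (by positivity : 0 ≤ ‖(0 : Fin d → ℝ)‖ ^ a * ‖cf η 0‖).trans (h 0)
  obtain ⟨r, hr, hradius⟩ := exists_radius_hasLargeImages hlarge
  refine absolutelyContinuous_of_norm_rpow_mul_norm_cf_le (sumLaw η ℓ)
    (b := a * k) (C := (C / r ^ a) ^ k) (by simpa using hk) fun t => ?_
  rcases eq_or_ne t 0 with rfl | ht
  · rw [norm_zero, Real.zero_rpow hk0.ne', zero_mul]
    positivity
  · exact norm_rpow_mul_norm_cf_sumLaw_le ha h hℓ hr (hradius t ht)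

variable {Ω : Type*} [MeasurableSpace Ω] {P : Measure Ω} [IsProbabilityMeasure P] {N : Ω → ℕ}
  {A : ℕ → Ω → Mat d} {q : ℝ≥0∞}

lemma absolutelyContinuous_of_smoothing_eq
    (hA : IsWeightFamily P N A) (hne : Survives P A) (hη : smoothing P N A η = η) (hq1 : q < 1)
    (hq : ∀ t : Fin d → ℝ, t ≠ 0 → P {ω | HasLargeImages 0 2 (fun j => A j ω) t}ᶜ ≤ q)
    (ha : 0 < a) (h : ∀ t, ‖t‖ ^ a * ‖cf η t‖ ≤ C) : η ≪ volume := by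
  have := isMarkovKernel_step P hA.measurable
  obtain ⟨k, hk⟩ := exists_nat_gt (d / a)
  rw [div_lt_iff₀' ha] at hk
  have hsurviving : Tendsto (fun n => (step P A ^ n) (root d) (survivingStates k {0}ᶜ)ᶜ) atTop
      (𝓝 0) := by
    have htop := tendsto_pow_compl_survivingStates hA hne hq1 hq k ⊤ root_mem_finStates
      fun t ht => hasLargeImages_root ht
    rwa [Submodule.top_coe, ← Set.compl_eq_univ_sdiff] at htop
  refine Measure.AbsolutelyContinuous.mk fun B hB hB0 => le_antisymm ?_ zero_le
  refine ge_of_tendsto' hsurviving fun n => ?_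
  calc η B = ∫⁻ ℓ, sumLaw η ℓ B ∂((step P A ^ n) (root d)) := by
        conv_lhs => rw [← bind_step_pow_root hA hη n]
        exact Measure.bind_apply hB (Kernel.aemeasurable _)
    _ ≤ ∫⁻ ℓ, (survivingStates k {0}ᶜ)ᶜ.indicator 1 ℓ ∂((step P A ^ n) (root d)) := by
        refine lintegral_mono_ae ?_
        filter_upwards [(isAbsorbing_finStates hA).ae_pow_mem n root_mem_finStates] with ℓ hℓ
        by_cases hmem : ℓ ∈ survivingStates k {0}ᶜ
        · rw [absolutelyContinuous_sumLaw ha.le h hk hℓ (fun t ht => hmem t ht) hB0]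
          exact zero_le
        · rw [Set.indicator_of_mem (by exact hmem)]
          exact prob_le_one
    _ ≤ (step P A ^ n) (root d) (survivingStates k {0}ᶜ)ᶜ := lintegral_indicator_one_le _

end Density

section Hypotheses

variable {d : ℕ} {Ω : Type*} [MeasurableSpace Ω] {P : Measure Ω} {N : Ω → ℕ}
  {A : ℕ → Ω → Mat d}

lemma CondN.isWeightFamily (h : CondN P N A) (hN : Measurable N) (hA : ∀ i, Measurable (A i)) :
    IsWeightFamily P N A :=
  ⟨hN, hA, h.2.2.2.mono fun _ hω i => (hω i).2.2⟩

lemma CondN.ae_nonneg (h : CondN P N A) : ∀ᵐ ω ∂P, ∀ i j k, 0 ≤ A i ω j k :=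
  h.2.2.2.mono fun _ hω i => (hω i).1

end Hypotheses

end SmoothingTransform

end

open SmoothingTransform in
theorem mainTheorem6_general {d : ℕ} {Ω : Type*} [MeasurableSpace Ω] (P : Measure Ω)
    [IsProbabilityMeasure P] (N : Ω → ℕ) (A : ℕ → Ω → Mat d) (hA : IsWeightFamily P N A)
    (hnn : ∀ᵐ ω ∂P, ∀ i j k, 0 ≤ A i ω j k) (hmean : meanN P N ≠ 0) (hmean' : meanN P N ≠ ⊤)
    (hcover : ∃ l, IsCoverSum P A l ∧ StrictlyPos l ∧ 1 < specRad l)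
    (hmoment : ∃ s, 0 < s ∧ s ∈ momentSet (mu P N A) ∧ mFun P N A s < 1)
    (hharmonic : CondHarmonic P A)
    (hΛ : ∃ v : Fin d → (Fin d → ℝ), (∀ i, v i ∈ Lam (mu P N A)) ∧ LinearIndependent ℝ v)
    (η : Measure (Fin d → ℝ)) (hfix : IsFixedPoint P N A η) (hη0 : η {0} = 0) :
    η ≪ (volume : Measure (Fin d → ℝ)) := by
  obtain ⟨_, hηnn, hη⟩ := hfix
  obtain ⟨l, hl, hlpos, hlr⟩ := hcover
  obtain ⟨s, hs, hsmem, hslt⟩ := hmoment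
  obtain ⟨hone, htwo, hneg⟩ := hharmonic
  obtain ⟨v, hv, hli⟩ := hΛ
  have hsurvives : Survives P A := survives_of_one_le_countNonzero hone
  have hgen : HasSmallGenerations P A :=
    hasSmallGenerations_of_mFun_lt_one hA hmean hmean' hs hsmem hslt
  obtain ⟨r, hr, p, hp, hlarge⟩ := exists_radius_le_measureReal_hasLargeImages_two hA.measurable
    fun t ht => measure_hasLargeImages_two_pos hone htwo ht
  have hq1 : 1 - ENNReal.ofReal p < 1 :=
    ENNReal.sub_lt_self ENNReal.one_ne_top one_ne_zero (ENNReal.ofReal_pos.2 hp).ne'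
  have hq := fun t ht => measure_compl_hasLargeImages_le hA.measurable (by positivity) (hlarge t ht)
  obtain ⟨ρ, hρ1, hρ⟩ := exists_norm_cf_le_of_one_le_norm hA hsurvives hgen hq1 hq hη fun t ht =>
    norm_cf_lt_one hA hsurvives hnn hgen hl hlpos hlr hv hli hη hηnn hη0 ht
  obtain ⟨ε, hε, M, hM, hnegM⟩ := exists_hasNegativeMoment hA.measurable hneg
  obtain ⟨a, ha, C, hdecay⟩ := exists_rpow_mul_norm_cf_le hA hη hε hM hnegM hρ1 hρ hr hp hlarge
  exact absolutelyContinuous_of_smoothing_eq hA hsurvives hη hq1 hq ha hdecay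

theorem mainTheorem6 {d : ℕ} (hd : 1 ≤ d)
    {Ω : Type*} [MeasurableSpace Ω] (P : Measure Ω) [IsProbabilityMeasure P]
    (N : Ω → ℕ) (A : ℕ → Ω → SmoothingTransform.Mat d)
    (hN : Measurable N) (hA : ∀ i, Measurable (A i))
    (h1 : SmoothingTransform.CondN P N A)
    (h2 : SmoothingTransform.CondMu (SmoothingTransform.mu P N A))
    (h3 : SmoothingTransform.CondCover P A)
    (h4 : SmoothingTransform.CondAlpha P N A)
    (h5 : SmoothingTransform.CondHarmonic P A)
    (hΛ : ∃ v : Fin d → (Fin d → ℝ),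
      (∀ i, v i ∈ SmoothingTransform.Lam (SmoothingTransform.mu P N A)) ∧ LinearIndependent ℝ v)
    {Ω' : Type*} [MeasurableSpace Ω'] (P' : Measure Ω') [IsProbabilityMeasure P']
    (Z : Ω' → Fin d → ℝ) (hZ : Measurable Z)
    (hfix : SmoothingTransform.IsFixedPoint P N A (P'.map Z))
    (hZ0 : P' {ω | Z ω = 0} = 0) :
    (P'.map Z) ≪ (volume : Measure (Fin d → ℝ)) := by
  obtain ⟨-, l, -, hl, -, hlpos, -, hlr⟩ := h3
  exact mainTheorem6_general P N A (h1.isWeightFamily hN hA) h1.ae_nonneg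
    (one_pos.trans h1.2.1).ne' h1.2.2.1.ne ⟨l, hl, hlpos, hlr⟩ h4.exists_mFun_lt_one h5 hΛ _ hfix
    ((Measure.map_apply hZ (measurableSet_singleton 0)).trans hZ0)
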